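/- Let $m,k\ge 1$ be integers with $k\le [\frac m2]+1$ and let $n=4m+1-2k$ (so $n$ is odd and $2m<n<4m$). Let $V:\mathbf R^n\to\mathbf R$ be measurable with $|V(x)|\le C(1+|x|)^{-\beta}$ for some constant $C$ and some $\beta>n+4k$, and let $H=(-\Delta)^m+V$. Notation. $L^2=L^2(\mathbf R^n;\mathbf C)$; $L^2_s=\{f:(1+|\cdot|)^sf\in L^2\}$; $W_\sigma=\bigcap_{s>\sigma}L^2_{-s}$; $v=|V|^{1/2}$; $U(x)=1$ if $V(x)\ge 0$ and $U(x)=-1$ if $V(x)<0$. Let $G_0=(-\Delta)^{-m}$, with kernel $c_0|x-y|^{2m-n}$, $c_0=\frac{\Gamma(n/2-m)}{4^m\pi^{n/2}\Gamma(m)}$, let $P=\|v\|_{L^2}^{-2}\,v\langle v,\cdot\rangle$ be the orthogonal projection onto the span of $v$ ($P=0$ if $v=0$ a.e.), and for $2\le j\le k$ let $G_j$ have the kernel $|x-y|^{2j-2}$. The operators $U+vG_0v$, $P$ and $vG_jv$ ($2\le j\le k$) are bounded on $L^2$. Put $T_0=U+vG_0v$, let $S_1$ be the orthogonal (Riesz)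 projection of $L^2$ onto $\ker T_0$, put $T_1=S_1PS_1$, and $T_j=S_jvG_jvS_j$ for $2\le j\le k$, where for $1\le j\le k$, $S_{j+1}$ is the orthogonal (Riesz) projection onto the kernel of $T_j$ acting on $S_jL^2$. "$H\psi=0$" means $\int\psi\,\big((-\Delta)^m\eta+V\eta\big)\,dx=0$ for all $\eta\in C_c^\infty(\mathbf R^n)$. Functions are identified when they agree almost everywhere. Then: (i) $\phi\in S_1L^2\setminus\{0\}$ if and only if $\phi=Uv\psi$ for some nonzero $\psi\in W_{2m-\frac n2}$ with $H\psi=0$. (ii) For $2\le j\le k$: $\phi\in S_jL^2\setminus\{0\}$ if and only if $\phi=Uv\psi$ for some nonzero $\psi\in W_{2m-\frac n2-j+1}$ with $H\psi=0$. Moreover, if $\phi=Uv\psi\in L^2$ with a nonzero $\psi\in W_{2m-\frac n2}$ and $H\psi=0$, then $\phi\in S_jL^2\setminus\{0\}$ if and only if $\psi\in W_{2m-\frac n2-j+1}$. (iii) $\phi\in S_{k+1}L^2\setminus\{0\}$ if and only if $\phi=Uv\psi$ for some nonzero $\psi\in L^2$ with $H\psi=0$, i.e. a zero eigenfunction of $H$.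 Moreover, if $\phi=Uv\psi\in L^2$ with a nonzero $\psi\in W_{2m-\frac n2}$ and $H\psi=0$, then $\phi\in S_{k+1}L^2\setminus\{0\}$ if and only if $\psi\in L^2$. (iv) For $1\le N\le k$ and $\phi\in L^2$: $\phi\in S_{N+1}L^2$ if and only if $\phi\in S_1L^2$ and $\int_{\mathbf R^n}p(y)v(y)\phi(y)\,dy=0$ for every polynomial $p$ of degree at most $N-1$. -/

import Mathlib

open MeasureTheory

noncomputable section

namespace HigherSchrodinger

/-- Euclidean space `ℝⁿ`. -/
abbrev Rn (n : ℕ) := EuclideanSpace ℝ (Fin n)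

/-- The complex Hilbert space `L²(ℝⁿ)`. -/
abbrev L2 (n : ℕ) := Lp ℂ 2 (volume : Measure (Rn n))

/-- The weighted space `L²_s(ℝⁿ)` of functions `f` with `(1 + |·|)^s f ∈ L²(ℝⁿ)`. -/
def WeightedL2 (n : ℕ) (s : ℝ) : Set (Rn n → ℂ) :=
  {f | MemLp (fun x => (((1 + ‖x‖) ^ s : ℝ) : ℂ) * f x) 2 volume}

/-- The space `W_σ(ℝⁿ)`, the intersection of the `L²_{-s}(ℝⁿ)` over `s > σ`. -/
def W (n : ℕ) (σ : ℝ) : Set (Rn n → ℂ) :=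
  {f | ∀ s : ℝ, σ < s → f ∈ WeightedL2 n (-s)}

/-- The polyharmonic operator `(-Δ)^m`, acting on smooth functions. -/
def polyLaplacian (n m : ℕ) : (Rn n → ℂ) → Rn n → ℂ :=
  (fun f => -Laplacian.laplacian f)^[m]

/-- `((-Δ)^m + V) ψ = 0` in the sense of distributions, for a locally integrable `ψ` and a
locally bounded real `V`; the operator is its own transpose, so it is moved onto the
test function without a sign. -/
def SolvesZeroEnergy {n : ℕ} (m : ℕ) (V : Rn n → ℝ) (ψ : Rn n → ℂ) : Prop :=
  ∀ η : Rn n → ℂ, ContDiff ℝ (⊤ : ℕ∞) η → HasCompactSupport η →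
    ∫ x, ψ x * (polyLaplacian n m η x + (V x : ℂ) * η x) = 0

/-- `v = |V|^{1/2}`. -/
def vFun {n : ℕ} (V : Rn n → ℝ) (x : Rn n) : ℝ := Real.sqrt |V x|

/-- `U = sign V`, with the value `1` where `V` vanishes, so that `U² = 1`. -/
def uFun {n : ℕ} (V : Rn n → ℝ) (x : Rn n) : ℝ := if 0 ≤ V x then 1 else -1

/-- The function `U v ψ`. -/
def UvMul {n : ℕ} (V : Rn n → ℝ) (ψ : Rn n → ℂ) (x : Rn n) : ℂ :=
  (uFun V x : ℂ) * (vFun V x : ℂ) * ψ x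

/-- The constant `c₀` for which `c₀ |x - y|^{2m-n}` is the kernel of `G₀ = (-Δ)^{-m}` on `ℝⁿ`,
`2m < n`. -/
def rieszConst (n m : ℕ) : ℝ :=
  Real.Gamma ((n : ℝ) / 2 - m) / (4 ^ m * Real.pi ^ ((n : ℝ) / 2) * Real.Gamma m)

/-- The operators met in the expansion of `U + v R₀(z) v` at `z = 0` (with the scalar
coefficients of the terms of positive order left out), as operations on functions:
* index `0`: `U + v G₀ v`, where `G₀` has the kernel `c₀ |x - y|^{2m-n}`;
* index `1`: the orthogonal projection `P = ‖v‖⁻² v ⟨v, ·⟩` onto the span of `v`;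
* index `j ≥ 2`: `v G_j v`, where `G_j` has the kernel `|x - y|^{2j-2}`. -/
def formalOp {n : ℕ} (m : ℕ) (V : Rn n → ℝ) : ℕ → (Rn n → ℂ) → Rn n → ℂ
  | 0, φ, x => (uFun V x : ℂ) * φ x + (vFun V x : ℂ) *
      ∫ y, ((rieszConst n m * ‖x - y‖ ^ (2 * (m : ℝ) - n) : ℝ) : ℂ) * ((vFun V y : ℂ) * φ y)
  | 1, φ, x => (((∫ y, vFun V y ^ 2)⁻¹ : ℝ) : ℂ) * (vFun V x : ℂ) * ∫ y, (vFun V y : ℂ) * φ y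
  | j + 2, φ, x => (vFun V x : ℂ) *
      ∫ y, ((‖x - y‖ ^ (2 * (j + 2) - 2) : ℝ) : ℂ) * ((vFun V y : ℂ) * φ y)

/-- The bounded operator `A` on `L²(ℝⁿ)` acts on functions as `F`. -/
def ActsAs {n : ℕ} (A : L2 n →L[ℂ] L2 n) (F : (Rn n → ℂ) → Rn n → ℂ) : Prop :=
  ∀ φ : L2 n, A φ =ᵐ[volume] F φ

open Classical in
/-- The bounded operator on `L²(ℝⁿ)` acting on functions as `F` (it is unique, if it exists). -/
def opOf {n : ℕ} (F : (Rn n → ℂ) → Rn n → ℂ) : L2 n →L[ℂ] L2 n :=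
  if h : ∃ A : L2 n →L[ℂ] L2 n, ActsAs A F then h.choose else 0

theorem opOf_eq {n : ℕ} {F : (Rn n → ℂ) → Rn n → ℂ} {A : L2 n →L[ℂ] L2 n}
    (hA : ActsAs A F) : opOf F = A := by
  have h : ∃ A : L2 n →L[ℂ] L2 n, ActsAs A F := ⟨A, hA⟩
  rw [opOf, dif_pos h]
  ext1 φ
  exact Lp.ext ((h.choose_spec φ).trans (hA φ).symm)

/-- The bounded operators on `L²(ℝⁿ)` given by `formalOp`: `U + v G₀ v`, then `P`, then
`v G₂ v`, `v G₃ v`, and so on. -/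
def expansionOp {n : ℕ} (m : ℕ) (V : Rn n → ℝ) (j : ℕ) : L2 n →L[ℂ] L2 n :=
  opOf (formalOp m V j)

/-- For a closed subspace `K` with orthogonal projection `S`, the operator `S A S`. -/
def compress {n : ℕ} (K : ClosedSubmodule ℂ (L2 n)) (A : L2 n →L[ℂ] L2 n) : L2 n →L[ℂ] L2 n :=
  K.toSubmodule.starProjection ∘L A ∘L K.toSubmodule.starProjection

/-- The subspaces `S_j L²(ℝⁿ)`, with `S_0 = I`. With `T_0 = U + v G₀ v`, `T_1 = S_1 P S_1` and
`T_j = S_j v G_j v S_j` for `j ≥ 2`, the space `S_{j+1} L²(ℝⁿ)` is the kernel of `T_j` acting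
on `S_j L²(ℝⁿ)`, and `S_{j+1}` is the orthogonal projection onto it (the Riesz projection at `0`
of the selfadjoint operator `T_j`). -/
def SSpace {n : ℕ} (m : ℕ) (V : Rn n → ℝ) : ℕ → ClosedSubmodule ℂ (L2 n)
  | 0 => ⊤
  | j + 1 => SSpace m V j ⊓
      ClosedSubmodule.comap (compress (SSpace m V j) (expansionOp m V j)) ⊥

end HigherSchrodinger

end

open HigherSchrodinger

/-!
The spaces `S_j L²` are described through the function `ψ = -G₀ v φ` (`resonance`).

Since `T_0 φ = U (φ - U v ψ)`, the condition `φ ∈ S_1 L²` says exactly that `φ = U v ψ`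
(`DecayingPotential.mem_SSpace_one_iff`), and then `v φ = V ψ`, so that `H ψ = 0` because `G₀` is a
fundamental solution of `(-Δ)^m` (`integral_riesz_mul_polyLaplacian`, obtained by writing the Riesz
kernel as a superposition of Gaussians and using the Fourier transform). The kernel estimate gives
`|ψ(x)| ≤ C (1 + |x|)^{2m-n}`, which puts `ψ` in `W_{2m-n/2}`. Conversely, if `ψ ∈ W_{2m-n/2}`
solves `H ψ = 0` and `φ = U v ψ`, then `ψ + G₀ v φ` is polyharmonic, and its averages over large
balls tend to zero because `2m - n/2 < n/2`; hence it vanishes by a Liouville theorem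
(`ae_eq_zero_of_polyharmonic`), which mollifies and uses the mean value property of harmonic
functions, one factor of `(-Δ)^m` at a time. Thus `ψ` and `φ` determine each other.

The kernel `|x - y|^{2j-2}` is a polynomial, so the quadratic form of `v G_j v` is a finite
combination of products of moments of `v φ`. When the moments of order less than `j - 1` vanish,
only the products of two moments of order `j - 1` survive, and they enter with the common sign
`(-1)^{j-1}`: the form vanishes if and only if these moments do. By induction, `S_{N+1} L²` consists
of the `φ ∈ S_1 L²` for which all moments of `v φ` of order at most `N - 1` vanish
(`DecayingPotential.mem_SSpace_iff_moments`).

Vanishing moments are then matched with decay. Testing `H ψ = 0` with a monomial of degree `b` cut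
off at radius `R` shows that the moments of order `b` vanish when `ψ ∈ L²_{-s}` and
`b + s < 2m - n/2` (`DecayingPotential.radialMoment_eq_zero_of_mem_weightedL2`). In the other
direction, if the moments of order less than `N` vanish, the Taylor polynomial of the Riesz kernel
at `y = 0` may be subtracted from it in `G₀ v φ`, which improves the decay of `ψ` to
`(1 + |x|)^{2m-n-N}` (`DecayingPotential.exists_resonance_bound_of_moments`). Since
`2m - n/2 = k - 1/2`, the order `N = k` is exactly what is needed for `ψ ∈ L²`.
-/

namespace HigherSchrodinger

open Metric Set Filter Topology
open scoped SchwartzMap FourierTransform ContDiff Convolution ComplexConjugate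

/-! ### Power weights -/

theorem one_add_norm_pos {n : ℕ} (x : Rn n) : 0 < 1 + ‖x‖ := by positivity

theorem integrable_weight {n : ℕ} {r : ℝ} (hr : (n : ℝ) < r) :
    Integrable (fun x : Rn n => (1 + ‖x‖) ^ (-r)) := by
  apply integrable_one_add_norm
  simpa using hr

theorem integrableOn_norm_rpow_ball {n : ℕ} (hn : 1 ≤ n) {b : ℝ} (hb : b < n) :
    IntegrableOn (fun x : Rn n => ‖x‖ ^ (-b)) (ball 0 1) := by
  have : Nonempty (Fin n) := ⟨⟨0, hn⟩⟩
  rw [integrableOn_fun_norm_addHaar volume (f := fun t : ℝ => t ^ (-b))]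
  have h1 : IntegrableOn (fun t : ℝ => t ^ ((n : ℝ) - 1 - b)) (Ioo 0 1) := by
    rw [← intervalIntegrable_iff_integrableOn_Ioo_of_le zero_le_one]
    exact intervalIntegral.intervalIntegrable_rpow' (by linarith)
  refine h1.congr_fun ?_ measurableSet_Ioo
  intro t ht
  simp only [finrank_euclideanSpace, Fintype.card_fin, smul_eq_mul]
  rw [← Real.rpow_natCast, ← Real.rpow_add ht.1, Nat.cast_sub hn]
  congr 1; push_cast; ring

/-- Uniform bound for the convolution of a negative power of the norm with a negative power of the
Japanese bracket, of total order greater than the dimension. -/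
theorem exists_kernel_bound {n : ℕ} (hn : 1 ≤ n) {b r : ℝ} (hb0 : 0 ≤ b) (hb : b < n)
    (hr : (n : ℝ) < b + r) :
    ∃ M : ℝ, 0 ≤ M ∧ ∀ x : Rn n,
      Integrable (fun y => ‖x - y‖ ^ (-b) * (1 + ‖y‖) ^ (-r)) ∧
      ∫ y, ‖x - y‖ ^ (-b) * (1 + ‖y‖) ^ (-r) ≤ M := by
  have hr0 : 0 ≤ r := by linarith
  set g : Rn n → ℝ := (ball 0 1).indicator (fun x => ‖x‖ ^ (-b)) with hg
  set w : Rn n → ℝ := fun y => (1 + ‖y‖) ^ (-(b + r)) with hw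
  have hgi : Integrable g := (integrableOn_norm_rpow_ball hn hb).integrable_indicator
    measurableSet_ball
  have hwi : Integrable w := integrable_weight (n := n) hr
  have hg0 : ∀ x, 0 ≤ g x := fun x => indicator_nonneg (fun z _ => by positivity) x
  have hw0 : ∀ x, 0 ≤ w x := fun x => by simp only [hw]; positivity
  have hle : ∀ x y : Rn n, ‖x - y‖ ^ (-b) * (1 + ‖y‖) ^ (-r) ≤
      g (x - y) + 2 ^ b * (w (x - y) + w y) := by
    intro x y
    by_cases h : x - y ∈ ball (0 : Rn n) 1
    · have hw1 : (1 + ‖y‖) ^ (-r) ≤ 1 :=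
        Real.rpow_le_one_of_one_le_of_nonpos (by linarith [norm_nonneg y]) (by linarith)
      have h1 : 0 ≤ 2 ^ b * (w (x - y) + w y) :=
        mul_nonneg (by positivity) (add_nonneg (hw0 _) (hw0 _))
      have h2 : g (x - y) = ‖x - y‖ ^ (-b) := by rw [hg, indicator_of_mem h]
      have : 0 ≤ ‖x - y‖ ^ (-b) := by positivity
      rw [h2]
      nlinarith
    · have h1 : 1 ≤ ‖x - y‖ := by simpa using h
      refine le_trans ?_ (le_add_of_nonneg_left (hg0 _))
      have h2 : ‖x - y‖ ^ (-b) ≤ 2 ^ b * (1 + ‖x - y‖) ^ (-b) := by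
        rw [Real.rpow_neg (by positivity), Real.rpow_neg (by positivity), ← div_eq_mul_inv,
          ← Real.div_rpow (by norm_num) (by positivity), ← Real.inv_rpow (by positivity)]
        refine Real.rpow_le_rpow (by positivity) ?_ hb0
        rw [inv_le_comm₀ (by positivity) (by positivity), inv_div]
        linarith
      have h3 : (1 + ‖x - y‖) ^ (-b) * (1 + ‖y‖) ^ (-r) ≤ w (x - y) + w y := by
        simp only [hw, neg_add]
        rw [Real.rpow_add (by positivity), Real.rpow_add (by positivity)]
        have p1 : 0 ≤ (1 + ‖x - y‖) ^ (-b) := by positivity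
        have p2 : 0 ≤ (1 + ‖y‖) ^ (-r) := by positivity
        rcases le_total ‖x - y‖ ‖y‖ with h | h
        · have : (1 + ‖y‖) ^ (-r) ≤ (1 + ‖x - y‖) ^ (-r) :=
            Real.rpow_le_rpow_of_nonpos (by positivity) (by linarith) (by linarith)
          exact (mul_le_mul_of_nonneg_left this p1).trans
            (le_add_of_nonneg_right (by positivity))
        · have : (1 + ‖x - y‖) ^ (-b) ≤ (1 + ‖y‖) ^ (-b) :=
            Real.rpow_le_rpow_of_nonpos (by positivity) (by linarith) (by linarith)
          exact (mul_le_mul_of_nonneg_right this p2).trans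
            (le_add_of_nonneg_left (by positivity))
      calc ‖x - y‖ ^ (-b) * (1 + ‖y‖) ^ (-r)
          ≤ 2 ^ b * (1 + ‖x - y‖) ^ (-b) * (1 + ‖y‖) ^ (-r) := by gcongr
        _ ≤ _ := by rw [mul_assoc]; gcongr
  have hww : ∀ x : Rn n, Integrable (fun y => w (x - y) + w y) := fun x =>
    (hwi.comp_sub_left x).add hwi
  have hint : ∀ x : Rn n, Integrable (fun y => g (x - y) + 2 ^ b * (w (x - y) + w y)) := fun x =>
    (hgi.comp_sub_left x).add ((hww x).const_mul _)
  refine ⟨(∫ y, g y) + 2 ^ b * ((∫ y, w y) + ∫ y, w y), ?_, fun x => ?_⟩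
  · have : 0 ≤ ∫ y, g y := integral_nonneg fun y => hg0 y
    have : 0 ≤ ∫ y, w y := integral_nonneg fun y => hw0 y
    positivity
  · have hi : Integrable (fun y => ‖x - y‖ ^ (-b) * (1 + ‖y‖) ^ (-r)) := by
      refine (hint x).mono' (Measurable.aestronglyMeasurable (by fun_prop))
        (ae_of_all _ fun y => ?_)
      rw [Real.norm_of_nonneg (by positivity)]
      exact hle x y
    refine ⟨hi, (integral_mono hi (hint x) (hle x)).trans (le_of_eq ?_)⟩
    rw [integral_add (hgi.comp_sub_left x) ((hww x).const_mul _),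
      integral_const_mul, integral_add (hwi.comp_sub_left x) hwi, integral_sub_left_eq_self,
      integral_sub_left_eq_self]

/-- Peetre-type inequality for the singular kernel `‖x - y‖ ^ (-a)`. -/
theorem norm_sub_rpow_neg_le {n : ℕ} {a : ℝ} (ha : 0 < a) (x y : Rn n) :
    ‖x - y‖ ^ (-a) ≤
      2 ^ a * (1 + ‖x‖) ^ (-a) * (1 + (1 + ‖y‖) ^ a * ‖x - y‖ ^ (-a)) := by
  rcases eq_or_lt_of_le (norm_nonneg (x - y)) with h | h
  · rw [← h, Real.zero_rpow (by linarith)]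
    positivity
  set d := ‖x - y‖
  have hx : 1 + ‖x‖ ≤ d + (1 + ‖y‖) := by
    have : ‖x‖ ≤ d + ‖y‖ := by simpa [d] using norm_add_le (x - y) y
    linarith
  have hxa : (1 + ‖x‖) ^ a ≤ 2 ^ a * (d ^ a + (1 + ‖y‖) ^ a) := by
    have p1 : 0 ≤ d ^ a := by positivity
    have p2 : 0 ≤ (1 + ‖y‖) ^ a := by positivity
    rcases le_total d (1 + ‖y‖) with h' | h'
    · calc (1 + ‖x‖) ^ a ≤ (2 * (1 + ‖y‖)) ^ a :=
            Real.rpow_le_rpow (by positivity) (by linarith) ha.le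
        _ = 2 ^ a * (1 + ‖y‖) ^ a := Real.mul_rpow (by norm_num) (by positivity)
        _ ≤ _ := by gcongr; linarith
    · calc (1 + ‖x‖) ^ a ≤ (2 * d) ^ a :=
            Real.rpow_le_rpow (by positivity) (by linarith) ha.le
        _ = 2 ^ a * d ^ a := Real.mul_rpow (by norm_num) h.le
        _ ≤ _ := by gcongr; linarith
  have h1 : (1 + ‖x‖) ^ a * (1 + ‖x‖) ^ (-a) = 1 := by
    rw [← Real.rpow_add (by positivity)]; simp
  have h3 : d ^ a * d ^ (-a) = 1 := by rw [← Real.rpow_add h]; simp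
  calc d ^ (-a) = (1 + ‖x‖) ^ a * (1 + ‖x‖) ^ (-a) * d ^ (-a) := by rw [h1, one_mul]
    _ ≤ (2 ^ a * (d ^ a + (1 + ‖y‖) ^ a)) * (1 + ‖x‖) ^ (-a) * d ^ (-a) := by gcongr
    _ = 2 ^ a * (1 + ‖x‖) ^ (-a) * (d ^ a * d ^ (-a) + (1 + ‖y‖) ^ a * d ^ (-a)) := by ring
    _ = _ := by rw [h3]

theorem norm_ofReal_rpow_mul {n : ℕ} (x : Rn n) (s : ℝ) (z : ℂ) :
    ‖(((1 + ‖x‖) ^ s : ℝ) : ℂ) * z‖ = (1 + ‖x‖) ^ s * ‖z‖ := by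
  rw [norm_mul, Complex.norm_real, Real.norm_of_nonneg (by positivity)]

/-! ### Weighted spaces -/

theorem WeightedL2.aestronglyMeasurable {n : ℕ} {s : ℝ} {f : Rn n → ℂ}
    (hf : f ∈ WeightedL2 n s) : AEStronglyMeasurable f volume := by
  have h1 : AEStronglyMeasurable (fun x : Rn n => (((1 + ‖x‖) ^ (-s) : ℝ) : ℂ)) volume :=
    Measurable.aestronglyMeasurable (by fun_prop)
  refine (h1.mul (MemLp.aestronglyMeasurable hf)).congr (ae_of_all _ fun x => ?_)
  simp only [Pi.mul_apply]
  rw [← mul_assoc, ← Complex.ofReal_mul, ← Real.rpow_add (one_add_norm_pos x)]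
  simp

theorem mem_weightedL2_iff {n : ℕ} {s : ℝ} {f : Rn n → ℂ} (hf : AEStronglyMeasurable f volume) :
    f ∈ WeightedL2 n s ↔ Integrable (fun x : Rn n => (1 + ‖x‖) ^ (2 * s) * ‖f x‖ ^ 2) := by
  have h1 : AEStronglyMeasurable (fun x : Rn n => (((1 + ‖x‖) ^ s : ℝ) : ℂ) * f x) volume :=
    (Measurable.aestronglyMeasurable (by fun_prop)).mul hf
  have e : ∀ x : Rn n, ‖(((1 + ‖x‖) ^ s : ℝ) : ℂ) * f x‖ ^ 2 =
      (1 + ‖x‖) ^ (2 * s) * ‖f x‖ ^ 2 := by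
    intro x
    rw [norm_ofReal_rpow_mul, mul_pow, mul_comm 2 s, Real.rpow_mul (by positivity)]
    norm_cast
  show MemLp _ _ _ ↔ _
  rw [memLp_two_iff_integrable_sq_norm h1]
  simp_rw [e]

theorem WeightedL2.mono {n : ℕ} {s t : ℝ} (h : s ≤ t) {f : Rn n → ℂ}
    (hf : f ∈ WeightedL2 n t) : f ∈ WeightedL2 n s := by
  have hm := WeightedL2.aestronglyMeasurable hf
  rw [mem_weightedL2_iff hm] at hf ⊢
  refine hf.mono' ?_ (ae_of_all _ fun x => ?_)
  · exact (Measurable.aestronglyMeasurable (by fun_prop)).mul (hm.norm.pow 2)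
  · rw [Real.norm_of_nonneg (by positivity)]
    gcongr
    linarith [norm_nonneg x]

theorem mem_weightedL2_zero {n : ℕ} {f : Rn n → ℂ} :
    f ∈ WeightedL2 n 0 ↔ MemLp f 2 volume := by
  simp [WeightedL2]

/-- Pointwise decay of order `d` gives membership in `L²_s` for `s < d - n / 2`. -/
theorem mem_weightedL2_of_bound {n : ℕ} {s d C : ℝ} {f : Rn n → ℂ}
    (hf : AEStronglyMeasurable f volume) (hb : ∀ᵐ x, ‖f x‖ ≤ C * (1 + ‖x‖) ^ (-d))
    (hs : s + n / 2 < d) : f ∈ WeightedL2 n s := by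
  rw [mem_weightedL2_iff hf]
  refine ((integrable_weight (n := n) (r := 2 * d - 2 * s) (by linarith)).const_mul (C ^ 2)).mono'
    ((Measurable.aestronglyMeasurable (by fun_prop)).mul (hf.norm.pow 2)) ?_
  filter_upwards [hb] with x hx
  rw [Real.norm_of_nonneg (by positivity)]
  calc (1 + ‖x‖) ^ (2 * s) * ‖f x‖ ^ 2 ≤ (1 + ‖x‖) ^ (2 * s) * (C * (1 + ‖x‖) ^ (-d)) ^ 2 := by
        gcongr
    _ = C ^ 2 * ((1 + ‖x‖) ^ (2 * s) * (1 + ‖x‖) ^ (-d * 2)) := by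
        rw [mul_pow, Real.rpow_mul (by positivity) (-d) 2]; norm_cast; ring
    _ = _ := by
        rw [← Real.rpow_add (one_add_norm_pos x)]; congr 2; ring

/-- Growth of the `L¹` norm over balls for functions in `L²_{-s}`, by Cauchy-Schwarz. -/
theorem exists_setIntegral_norm_le {n : ℕ} {s : ℝ} (hs : 0 ≤ s) {w : Rn n → ℂ}
    (hw : w ∈ WeightedL2 n (-s)) :
    ∃ C : ℝ, 0 ≤ C ∧ ∀ ρ : ℝ, 1 ≤ ρ → IntegrableOn w (closedBall 0 ρ) ∧
      ∫ x in closedBall 0 ρ, ‖w x‖ ≤ C * ρ ^ (s + n / 2) := by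
  have hm := WeightedL2.aestronglyMeasurable hw
  have hi := (mem_weightedL2_iff hm).1 hw
  set I := ∫ x : Rn n, (1 + ‖x‖) ^ (2 * -s) * ‖w x‖ ^ 2 with hI
  have hI0 : 0 ≤ I := integral_nonneg fun x => by positivity
  set B := volume.real (ball (0 : Rn n) 1)
  have hB0 : 0 ≤ B := measureReal_nonneg
  refine ⟨I + 2 ^ (2 * s) * B, by positivity, fun ρ hρ => ?_⟩
  have hρ0 : 0 < ρ := by linarith
  set t := ρ ^ (s + n / 2) with ht
  have ht0 : 0 < t := by positivity
  -- the weighted arithmetic-geometric mean inequality with the weight `t`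
  have key : ∀ x ∈ closedBall (0 : Rn n) ρ, ‖w x‖ ≤
      t * ((1 + ‖x‖) ^ (2 * -s) * ‖w x‖ ^ 2) + t⁻¹ * (2 ^ (2 * s) * ρ ^ (2 * s)) := by
    intro x hx
    have hx' : ‖x‖ ≤ ρ := by simpa using hx
    set p := (1 + ‖x‖) ^ s with hp
    have hp0 : 0 < p := by positivity
    have e1 : (1 + ‖x‖) ^ (2 * -s) = (p ^ 2)⁻¹ := by
      rw [hp, show 2 * -s = -(s * 2) by ring, Real.rpow_neg (by positivity),
        Real.rpow_mul (by positivity)]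
      norm_cast
    have e2 : p ^ 2 ≤ 2 ^ (2 * s) * ρ ^ (2 * s) := by
      rw [← Real.mul_rpow (by norm_num) hρ0.le, mul_comm 2 s, Real.rpow_mul (by positivity)]
      norm_cast
      gcongr
      exact Real.rpow_le_rpow (by positivity) (by linarith) hs
    rw [e1]
    have e3 : t⁻¹ * p ^ 2 ≤ t⁻¹ * (2 ^ (2 * s) * ρ ^ (2 * s)) := by gcongr
    refine le_trans ?_ (add_le_add_right e3 _)
    have : 0 ≤ t * (p⁻¹ * ‖w x‖ - t⁻¹ * p) ^ 2 := by positivity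
    have e4 : t * (p⁻¹ * ‖w x‖ - t⁻¹ * p) ^ 2 =
        t * ((p ^ 2)⁻¹ * ‖w x‖ ^ 2) + t⁻¹ * p ^ 2 - 2 * ‖w x‖ := by
      field_simp
      ring
    linarith [norm_nonneg (w x)]
  have hvol : volume.real (closedBall (0 : Rn n) ρ) = ρ ^ (n : ℝ) * B := by
    rw [Measure.addHaar_real_closedBall _ _ hρ0.le]; simp [B]
  have hfin : volume (closedBall (0 : Rn n) ρ) ≠ ⊤ := measure_closedBall_lt_top.ne
  have hgi : IntegrableOn (fun x : Rn n => t * ((1 + ‖x‖) ^ (2 * -s) * ‖w x‖ ^ 2) +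
      t⁻¹ * (2 ^ (2 * s) * ρ ^ (2 * s))) (closedBall 0 ρ) :=
    (hi.const_mul t).integrableOn.add (integrableOn_const hfin)
  have hwi : IntegrableOn w (closedBall 0 ρ) := by
    refine Integrable.mono' hgi hm.restrict ?_
    filter_upwards [ae_restrict_mem measurableSet_closedBall] with x hx using key x hx
  refine ⟨hwi, (setIntegral_mono_on hwi.norm hgi measurableSet_closedBall key).trans ?_⟩
  rw [integral_add (hi.const_mul t).integrableOn (integrableOn_const hfin), integral_const_mul,
    setIntegral_const, hvol, smul_eq_mul, add_mul]
  refine add_le_add ?_ (le_of_eq ?_)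
  · rw [mul_comm]
    refine mul_le_mul_of_nonneg_right ?_ ht0.le
    exact setIntegral_le_integral hi (ae_of_all _ fun x => by positivity)
  · have : ρ ^ (n : ℝ) * ρ ^ (2 * s) = t * t := by
      rw [ht, ← Real.rpow_add hρ0, ← Real.rpow_add hρ0]; congr 1; ring
    calc ρ ^ (n : ℝ) * B * (t⁻¹ * (2 ^ (2 * s) * ρ ^ (2 * s))) =
        2 ^ (2 * s) * B * t⁻¹ * (ρ ^ (n : ℝ) * ρ ^ (2 * s)) := by ring
      _ = _ := by rw [this]; field_simp

theorem WeightedL2.locallyIntegrable {n : ℕ} {s : ℝ} {w : Rn n → ℂ}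
    (hw : w ∈ WeightedL2 n s) : LocallyIntegrable w := by
  have h1 : w ∈ WeightedL2 n (-|s|) := WeightedL2.mono (neg_abs_le s) hw
  obtain ⟨C, -, hC⟩ := exists_setIntegral_norm_le (abs_nonneg s) h1
  intro x
  refine ⟨closedBall 0 (‖x‖ + 1), ?_, (hC _ (by linarith [norm_nonneg x])).1⟩
  exact mem_of_superset (isOpen_ball.mem_nhds (show x ∈ ball 0 (‖x‖ + 1) by simp))
    ball_subset_closedBall

/-! ### The fundamental solution of `(-Δ)^m` -/

/-- Fubini for an integral operator with a nonnegative kernel whose integral over the parameter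
is known. -/
theorem integral_integral_kernel {E : Type*} [MeasurableSpace E] {ν : Measure E} [SFinite ν]
    {μ : Measure ℝ} [SFinite μ] {k : ℝ → E → ℝ} (hk : Measurable (Function.uncurry k))
    (hk0 : ∀ᵐ b ∂μ, ∀ y, 0 ≤ k b y) {J : E → ℝ}
    (hJ : ∀ᵐ y ∂ν, Integrable (fun b => k b y) μ ∧ ∫ b, k b y ∂μ = J y)
    {G : E → ℂ} (hG : AEStronglyMeasurable G ν) (hi : Integrable (fun y => J y * ‖G y‖) ν) :
    ∫ b, ∫ y, (k b y : ℂ) * G y ∂ν ∂μ = ∫ y, (J y : ℂ) * G y ∂ν := by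
  have hint : Integrable (Function.uncurry fun b y => (k b y : ℂ) * G y) (μ.prod ν) := by
    rw [integrable_prod_iff']
    · refine ⟨?_, hi.congr ?_⟩
      · filter_upwards [hJ] with y hy
        exact (hy.1.ofReal (𝕜 := ℂ)).mul_const (G y)
      · filter_upwards [hJ] with y hy
        rw [← hy.2, ← integral_mul_const]
        refine integral_congr_ae ?_
        filter_upwards [hk0] with b hb
        simp [abs_of_nonneg (hb y)]
    · exact (Complex.measurable_ofReal.comp hk).aestronglyMeasurable.mul hG.comp_snd
  rw [integral_integral_swap hint]
  refine integral_congr_ae ?_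
  filter_upwards [hJ] with y hy
  rw [integral_mul_const, integral_complex_ofReal, hy.2]

theorem integral_pow_mul_exp_neg {m : ℕ} (hm : 1 ≤ m) {τ : ℝ} (hτ : 0 < τ) :
    IntegrableOn (fun b : ℝ => b ^ ((m : ℝ) - 1) * Real.exp (-(b * τ))) (Ioi 0) ∧
    ∫ b in Ioi (0 : ℝ), b ^ ((m : ℝ) - 1) * Real.exp (-(b * τ)) =
      Real.Gamma m * (τ ^ m)⁻¹ := by
  have hm' : (0 : ℝ) < m := by exact_mod_cast hm
  have e : ∫ b in Ioi (0 : ℝ), b ^ ((m : ℝ) - 1) * Real.exp (-(b * τ)) =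
      Real.Gamma m * (τ ^ m)⁻¹ := by
    have := Real.integral_rpow_mul_exp_neg_mul_Ioi hm' hτ
    simp_rw [mul_comm τ] at this
    rw [this, Real.rpow_natCast, one_div, inv_pow, mul_comm]
  refine ⟨?_, e⟩
  have : 0 < Real.Gamma m * (τ ^ m)⁻¹ := mul_pos (Real.Gamma_pos_of_pos hm') (by positivity)
  by_contra h
  rw [integral_undef h] at e
  linarith

/-- The Gamma integral that produces a negative power of `τ` from the Gaussians `exp (-τ / b)`. -/
theorem integral_rpow_mul_exp_neg_div {p : ℝ} (hp : 0 < p) {τ : ℝ} (hτ : 0 < τ) :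
    IntegrableOn (fun b : ℝ => b ^ (-p - 1) * Real.exp (-(τ / b))) (Ioi 0) ∧
    ∫ b in Ioi (0 : ℝ), b ^ (-p - 1) * Real.exp (-(τ / b)) =
      Real.Gamma p * τ ^ (-p) := by
  have e : ∫ b in Ioi (0 : ℝ), b ^ (-p - 1) * Real.exp (-(τ / b)) =
      Real.Gamma p * τ ^ (-p) := by
    have h1 := Real.integral_rpow_mul_exp_neg_mul_Ioi hp hτ
    rw [← integral_comp_rpow_Ioi (fun t : ℝ => t ^ (p - 1) * Real.exp (-(τ * t)))
      (show (-1 : ℝ) ≠ 0 by norm_num)] at h1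
    rw [show Real.Gamma p * τ ^ (-p) = (1 / τ) ^ p * Real.Gamma p by
      rw [one_div, Real.inv_rpow hτ.le, Real.rpow_neg hτ.le, mul_comm], ← h1]
    refine setIntegral_congr_fun measurableSet_Ioi fun b (hb : 0 < b) => ?_
    simp only [abs_neg, abs_one, one_mul, smul_eq_mul]
    rw [← Real.rpow_mul hb.le, ← mul_assoc, ← Real.rpow_add hb, Real.rpow_neg_one, div_eq_mul_inv]
    congr 2; ring
  refine ⟨?_, e⟩
  have : 0 < Real.Gamma p * τ ^ (-p) := mul_pos (Real.Gamma_pos_of_pos hp) (by positivity)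
  by_contra h
  rw [integral_undef h] at e
  linarith

theorem exists_schwartz_decay {n : ℕ} (g : 𝓢(Rn n, ℂ)) (k : ℕ) :
    ∃ C : ℝ, 0 ≤ C ∧ ∀ x, ‖g x‖ ≤ C * (1 + ‖x‖) ^ (-(k : ℝ)) := by
  refine ⟨2 ^ k * ((Finset.Iic (k, 0)).sup fun m => SchwartzMap.seminorm ℝ m.1 m.2) g,
    by positivity, fun x => ?_⟩
  have := SchwartzMap.one_add_le_sup_seminorm_apply (𝕜 := ℝ) (m := (k, 0)) le_rfl le_rfl g x
  rw [norm_iteratedFDeriv_zero] at this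
  rw [Real.rpow_neg (by positivity), Real.rpow_natCast, ← div_eq_mul_inv,
    le_div_iff₀ (by positivity), mul_comm]
  exact this

/-- `-Δ` on Schwartz functions. -/
noncomputable def negLap (n : ℕ) (f : 𝓢(Rn n, ℂ)) : 𝓢(Rn n, ℂ) := -Laplacian.laplacian f

theorem polyLaplacian_schwartz (n m : ℕ) (f : 𝓢(Rn n, ℂ)) :
    polyLaplacian n m f = ((negLap n)^[m] f : 𝓢(Rn n, ℂ)) := by
  induction m generalizing f with
  | zero => rfl
  | succ m ih =>
    have h : (-Laplacian.laplacian (f : Rn n → ℂ)) = ((negLap n f : 𝓢(Rn n, ℂ)) : Rn n → ℂ) := by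
      ext x
      simp [negLap, SchwartzMap.laplacian_apply]
    rw [Function.iterate_succ_apply, ← ih, ← h]
    rfl

theorem fourier_negLap {n : ℕ} (f : 𝓢(Rn n, ℂ)) (v : Rn n) :
    𝓕 (negLap n f) v = (((2 * Real.pi) ^ 2 * ‖v‖ ^ 2 : ℝ) : ℂ) * 𝓕 f v := by
  have h2 : Function.HasTemperateGrowth (fun x : Rn n => ‖x‖ ^ 2) := by fun_prop
  rw [negLap, SchwartzMap.laplacian_eq_fourierMultiplierCLM, SchwartzMap.fourierMultiplierCLM_apply]
  rw [neg_smul, neg_neg, FourierTransform.fourier_smul, FourierTransform.fourier_fourierInv_eq]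
  rw [_root_.smul_apply, SchwartzMap.smulLeftCLM_apply_apply h2]
  simp [mul_assoc]

theorem fourier_negLap_iterate {n : ℕ} (m : ℕ) (f : 𝓢(Rn n, ℂ)) (v : Rn n) :
    𝓕 ((negLap n)^[m] f) v = ((((2 * Real.pi) ^ 2 * ‖v‖ ^ 2) ^ m : ℝ) : ℂ) * 𝓕 f v := by
  induction m with
  | zero => simp
  | succ m ih =>
    rw [Function.iterate_succ_apply', fourier_negLap, ih, pow_succ]
    push_cast
    ring

/-- The heat semigroup on the Fourier side: pairing with a Gaussian centred at `x`. -/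
theorem integral_gaussian_mul {n : ℕ} (g : 𝓢(Rn n, ℂ)) (x : Rn n) {b : ℝ} (hb : 0 < b) :
    ∫ y, (((Real.pi / b) ^ ((n : ℝ) / 2) * Real.exp (-(Real.pi ^ 2 * ‖x - y‖ ^ 2 / b)) : ℝ) : ℂ)
        * g y =
      ∫ v, ((Real.exp (-(b * ‖v‖ ^ 2)) : ℝ) : ℂ) *
        (Complex.exp (2 * Real.pi * Complex.I * (inner ℝ x v : ℝ)) * 𝓕 g v) := by
  have hb' : 0 < (b : ℂ).re := by simpa using hb
  set F : Rn n → ℂ := fun v => Complex.exp (-(b : ℂ) * ‖v‖ ^ 2 +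
    2 * Real.pi * Complex.I * (inner ℝ x v : ℝ)) with hF
  have hFi : Integrable F := by
    have := GaussianFourier.integrable_cexp_neg_mul_sq_norm_add hb' (2 * Real.pi * Complex.I) x
    simpa [hF] using this
  have hsa := VectorFourier.integral_fourierIntegral_smul_eq_flip (L := innerₗ (Rn n))
    (μ := volume) (ν := volume) Real.continuous_fourierChar continuous_inner hFi g.integrable
  have hflip : (innerₗ (Rn n)).flip = innerₗ (Rn n) := by
    ext a b
    simp
  rw [hflip] at hsa
  have h1 : ∀ y, VectorFourier.fourierIntegral Real.fourierChar volume (innerₗ (Rn n)) F y =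
      (((Real.pi / b) ^ ((n : ℝ) / 2) * Real.exp (-(Real.pi ^ 2 * ‖x - y‖ ^ 2 / b)) : ℝ) : ℂ) := by
    intro y
    have := fourier_gaussian_innerProductSpace' hb' x y
    rw [show VectorFourier.fourierIntegral Real.fourierChar volume (innerₗ (Rn n)) F y = 𝓕 F y
      from rfl, hF, this]
    push_cast
    rw [Complex.ofReal_cpow (by positivity)]
    push_cast
    simp only [finrank_euclideanSpace, Fintype.card_fin]
    congr 2
    ring
  have h2 : ∀ v, VectorFourier.fourierIntegral Real.fourierChar volume (innerₗ (Rn n)) g v =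
      𝓕 g v := fun v => rfl
  simp_rw [h1, h2, smul_eq_mul] at hsa
  rw [hsa]
  refine integral_congr_ae (ae_of_all _ fun v => ?_)
  simp only [hF]
  rw [Complex.exp_add, mul_assoc]
  push_cast
  congr 2
  ring

/-- The Riesz kernel is a fundamental solution of `(-Δ)^m`. The kernel is a superposition of
Gaussians, whose pairing with `(-Δ)^m χ` is computed on the Fourier side. -/
theorem integral_riesz_mul_polyLaplacian {n m : ℕ} (hm : 1 ≤ m) (hmn : 2 * m < n)
    (χ : 𝓢(Rn n, ℂ)) (x : Rn n) :
    ∫ y, ((rieszConst n m * ‖x - y‖ ^ (2 * (m : ℝ) - n) : ℝ) : ℂ) * polyLaplacian n m χ y =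
      χ x := by
  have hn : 1 ≤ n := by omega
  have hmn' : 2 * (m : ℝ) < n := by exact_mod_cast hmn
  have hm' : (0 : ℝ) < m := by exact_mod_cast hm
  have : Nonempty (Fin n) := ⟨⟨0, hn⟩⟩
  have hpi := Real.pi_pos
  set p : ℝ := n / 2 - m with hp
  have hp0 : 0 < p := by rw [hp]; linarith
  rw [polyLaplacian_schwartz]
  set g : 𝓢(Rn n, ℂ) := (negLap n)^[m] χ with hg
  set μ : Measure ℝ := volume.restrict (Ioi 0) with hμ
  have hμpos : ∀ᵐ b ∂μ, 0 < b := ae_restrict_mem measurableSet_Ioi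
  -- integrating the Gaussians over their width produces the Riesz kernel in the space variable
  set k₁ : ℝ → Rn n → ℝ := fun b y => b ^ (-p - 1) * Real.exp (-(Real.pi ^ 2 * ‖x - y‖ ^ 2 / b))
  have hk₁m : Measurable (Function.uncurry k₁) := by
    simp only [k₁, Function.uncurry_def]
    fun_prop
  set J₁ : Rn n → ℝ := fun y => Real.Gamma p * (Real.pi ^ 2 * ‖x - y‖ ^ 2) ^ (-p)
  have hJ₁ : ∀ᵐ y : Rn n, Integrable (fun b => k₁ b y) μ ∧ ∫ b, k₁ b y ∂μ = J₁ y := by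
    filter_upwards [(Measure.ae_ne volume x)] with y hy
    have : 0 < ‖x - y‖ := norm_pos_iff.2 (sub_ne_zero.2 (Ne.symm hy))
    exact integral_rpow_mul_exp_neg_div hp0 (by positivity)
  have hJ₁' : ∀ y, J₁ y = Real.Gamma p * Real.pi ^ (2 * (m : ℝ) - n) *
      ‖x - y‖ ^ (2 * (m : ℝ) - n) := by
    intro y
    simp only [J₁]
    rw [Real.mul_rpow (by positivity) (by positivity), ← Real.rpow_natCast, ← Real.rpow_natCast,
      ← Real.rpow_mul hpi.le, ← Real.rpow_mul (norm_nonneg _), mul_assoc]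
    congr 3 <;> (rw [hp]; push_cast; ring)
  have hi₁ : Integrable (fun y => J₁ y * ‖g y‖) := by
    obtain ⟨M, -, hM⟩ := exists_kernel_bound hn (b := n - 2 * m) (r := n + 1) (by linarith)
      (by linarith) (by linarith)
    obtain ⟨C, -, hC⟩ := exists_schwartz_decay g (n + 1)
    refine (((hM x).1).const_mul (Real.Gamma p * Real.pi ^ (2 * (m : ℝ) - n) * C)).mono'
      (Measurable.aestronglyMeasurable (by fun_prop)) (ae_of_all _ fun y => ?_)
    have hΓ := Real.Gamma_pos_of_pos hp0
    have h0 : 0 ≤ J₁ y := by rw [hJ₁']; positivity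
    rw [norm_mul, norm_norm, Real.norm_of_nonneg h0, hJ₁',
      show -((n : ℝ) - 2 * m) = 2 * m - n by ring]
    calc Real.Gamma p * Real.pi ^ (2 * (m : ℝ) - n) * ‖x - y‖ ^ (2 * (m : ℝ) - n) * ‖g y‖
        ≤ Real.Gamma p * Real.pi ^ (2 * (m : ℝ) - n) * ‖x - y‖ ^ (2 * (m : ℝ) - n) *
          (C * (1 + ‖y‖) ^ (-((n + 1 : ℕ) : ℝ))) := by gcongr; exact hC y
      _ = _ := by push_cast; ring
  have e₁ := integral_integral_kernel hk₁m (by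
    filter_upwards [hμpos] with b hb y
    simp only [k₁]; positivity) hJ₁ g.continuous.aestronglyMeasurable hi₁
  -- and the factor `|ξ|^{-2m}` in the Fourier variable, which cancels the symbol of `(-Δ)^m`
  set k₂ : ℝ → Rn n → ℝ := fun b v => b ^ ((m : ℝ) - 1) * Real.exp (-(b * ‖v‖ ^ 2))
  have hk₂m : Measurable (Function.uncurry k₂) := by
    simp only [k₂, Function.uncurry_def]
    fun_prop
  set J₂ : Rn n → ℝ := fun v => Real.Gamma m * ((‖v‖ ^ 2) ^ m)⁻¹
  have hJ₂ : ∀ᵐ v : Rn n, Integrable (fun b => k₂ b v) μ ∧ ∫ b, k₂ b v ∂μ = J₂ v := by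
    filter_upwards [(Measure.ae_ne volume (0 : Rn n))] with v hv
    have : 0 < ‖v‖ := norm_pos_iff.2 hv
    exact integral_pow_mul_exp_neg hm (by positivity)
  set G : Rn n → ℂ := fun v => Complex.exp (2 * Real.pi * Complex.I * (inner ℝ x v : ℝ)) * 𝓕 g v
  have hG : ∀ v, v ≠ 0 → (J₂ v : ℂ) * G v = ((Real.Gamma m * (2 * Real.pi) ^ (2 * m) : ℝ) : ℂ) *
      (Complex.exp (2 * Real.pi * Complex.I * (inner ℝ x v : ℝ)) * 𝓕 χ v) := by
    intro v hv
    have h0 : (‖v‖ : ℂ) ≠ 0 := by simpa using hv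
    simp only [J₂, G, hg, fourier_negLap_iterate]
    push_cast
    rw [pow_mul (2 * (Real.pi : ℂ)) 2 m, mul_pow ((2 * (Real.pi : ℂ)) ^ 2)]
    field_simp
  have hnexp : ∀ v : Rn n, ‖Complex.exp (2 * Real.pi * Complex.I * (inner ℝ x v : ℝ))‖ = 1 := by
    intro v
    rw [show 2 * Real.pi * Complex.I * (inner ℝ x v : ℝ) =
      ((2 * Real.pi * inner ℝ x v : ℝ) : ℂ) * Complex.I by push_cast; ring]
    exact Complex.norm_exp_ofReal_mul_I _
  have hi₂ : Integrable (fun v => J₂ v * ‖G v‖) := by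
    refine ((𝓕 χ).integrable.norm.const_mul (Real.Gamma m * (2 * Real.pi) ^ (2 * m))).congr ?_
    filter_upwards [(Measure.ae_ne volume (0 : Rn n))] with v hv
    have h1 := congrArg norm (hG v hv)
    have h2 : 0 ≤ J₂ v := mul_nonneg (Real.Gamma_pos_of_pos hm').le (by positivity)
    have h3 : 0 ≤ Real.Gamma m * (2 * Real.pi) ^ (2 * m) :=
      mul_nonneg (Real.Gamma_pos_of_pos hm').le (by positivity)
    rw [norm_mul, norm_mul ((Real.Gamma m * (2 * Real.pi) ^ (2 * m) : ℝ) : ℂ), Complex.norm_real,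
      Complex.norm_real, Real.norm_of_nonneg h2, Real.norm_of_nonneg h3,
      norm_mul _ (𝓕 χ v), hnexp, one_mul] at h1
    exact h1.symm
  have hGc : Continuous G := by
    have := (𝓕 g).continuous
    simp only [G]
    fun_prop
  have e₂ := integral_integral_kernel hk₂m (by
    filter_upwards [hμpos] with b hb v
    simp only [k₂]; positivity) hJ₂ hGc.aestronglyMeasurable hi₂
  -- the two sides agree for every Gaussian
  have e₃ : ((Real.pi ^ ((n : ℝ) / 2) : ℝ) : ℂ) * ∫ b, (∫ y, (k₁ b y : ℂ) * g y) ∂μ =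
      ∫ b, (∫ v, (k₂ b v : ℂ) * G v) ∂μ := by
    rw [← integral_const_mul]
    refine integral_congr_ae ?_
    filter_upwards [hμpos] with b hb
    have h := integral_gaussian_mul g x hb
    have h' := congrArg (fun z : ℂ => ((b ^ ((m : ℝ) - 1) : ℝ) : ℂ) * z) h
    simp only [← integral_const_mul] at h' ⊢
    refine Eq.trans (integral_congr_ae (ae_of_all _ fun y => ?_)) (h'.trans
      (integral_congr_ae (ae_of_all _ fun v => ?_)))
    · simp only [k₁, ← mul_assoc, ← Complex.ofReal_mul]
      congr 3
      rw [Real.div_rpow hpi.le hb.le, hp, div_eq_mul_inv (Real.pi ^ _),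
        ← Real.rpow_neg hb.le]
      rw [mul_left_comm, ← Real.rpow_add hb]
      congr 2; ring
    · simp only [k₂, G]; push_cast; ring
  have e₄ : ∫ v, (J₂ v : ℂ) * G v =
      ((Real.Gamma m * (2 * Real.pi) ^ (2 * m) : ℝ) : ℂ) * χ x := by
    have : (χ : 𝓢(Rn n, ℂ)) x = 𝓕⁻ (𝓕 χ) x := by
      rw [FourierTransform.fourierInv_fourier_eq]
    rw [this, SchwartzMap.fourierInv_coe, Real.fourierInv_eq', ← integral_const_mul]
    refine integral_congr_ae ?_
    filter_upwards [(Measure.ae_ne volume (0 : Rn n))] with v hv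
    rw [hG v hv, smul_eq_mul, real_inner_comm]
    congr 3
    push_cast; ring
  rw [e₁, e₂, e₄] at e₃
  have hc : ((Real.Gamma m * (2 * Real.pi) ^ (2 * m) : ℝ) : ℂ) ≠ 0 := by
    have := Real.Gamma_pos_of_pos hm'
    exact_mod_cast (by positivity : Real.Gamma m * (2 * Real.pi) ^ (2 * m) ≠ 0)
  apply mul_left_cancel₀ hc
  rw [← e₃, ← integral_const_mul, ← integral_const_mul]
  refine integral_congr_ae (ae_of_all _ fun y => ?_)
  simp only [← mul_assoc, ← Complex.ofReal_mul, hJ₁']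
  congr 2
  rw [rieszConst, ← hp, Real.rpow_sub hpi, mul_pow, pow_mul 2]
  have hΓ := (Real.Gamma_pos_of_pos hm').ne'
  have : Real.pi ^ (2 * (m : ℝ)) = Real.pi ^ (2 * m) := by
    rw [← Real.rpow_natCast]; push_cast; rfl
  rw [this, show Real.pi ^ (n : ℝ) = Real.pi ^ ((n : ℝ) / 2) * Real.pi ^ ((n : ℝ) / 2) by
    rw [← Real.rpow_add hpi]; congr 1; ring]
  have : Real.pi ^ ((n : ℝ) / 2) ≠ 0 := by positivity
  field_simp
  norm_num

/-! ### Test functions and the Laplacian -/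

theorem laplacian_apply_eq {n : ℕ} (f : Rn n → ℂ) (x : Rn n) :
    Laplacian.laplacian f x = ∑ i, fderiv ℝ (fderiv ℝ f) x
      (EuclideanSpace.basisFun (Fin n) ℝ i) (EuclideanSpace.basisFun (Fin n) ℝ i) := by
  rw [InnerProductSpace.laplacian_eq_iteratedFDeriv_orthonormalBasis f
    (EuclideanSpace.basisFun (Fin n) ℝ)]
  simp [iteratedFDeriv_two_apply]

theorem laplacian_comp_add_right {n : ℕ} (f : Rn n → ℂ) (a : Rn n) :
    Laplacian.laplacian (fun x => f (x + a)) = fun x => Laplacian.laplacian f (x + a) := by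
  ext x
  simp [InnerProductSpace.laplacian_eq_iteratedFDeriv_orthonormalBasis _
    (EuclideanSpace.basisFun (Fin n) ℝ), iteratedFDeriv_comp_add_right]

theorem polyLaplacian_comp_add_right {n : ℕ} (m : ℕ) (f : Rn n → ℂ) (a : Rn n) :
    polyLaplacian n m (fun x => f (x + a)) = fun x => polyLaplacian n m f (x + a) := by
  induction m generalizing f with
  | zero => rfl
  | succ m ih =>
    have h : -Laplacian.laplacian (fun x => f (x + a)) =
        fun x => (-Laplacian.laplacian f) (x + a) := by
      rw [laplacian_comp_add_right]; rfl
    simp only [polyLaplacian, Function.iterate_succ_apply] at ih ⊢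
    rw [h, ih]

theorem hasCompactSupport_laplacian {n : ℕ} {f : Rn n → ℂ} (hf : HasCompactSupport f) :
    HasCompactSupport (Laplacian.laplacian f) := by
  refine HasCompactSupport.intro hf fun x hx => ?_
  have h : f =ᶠ[𝓝 x] fun _ => 0 := by
    have := notMem_tsupport_iff_eventuallyEq.1 hx
    exact this
  rw [(InnerProductSpace.laplacian_congr_nhds h).eq_of_nhds, InnerProductSpace.laplacian_const]
  rfl

theorem hasCompactSupport_polyLaplacian {n : ℕ} (m : ℕ) {f : Rn n → ℂ}
    (hf : HasCompactSupport f) : HasCompactSupport (polyLaplacian n m f) := by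
  induction m generalizing f with
  | zero => exact hf
  | succ m ih =>
    rw [polyLaplacian, Function.iterate_succ_apply]
    exact ih (hasCompactSupport_laplacian hf).neg

theorem contDiff_polyLaplacian {n : ℕ} (m : ℕ) {f : Rn n → ℂ} (hf : ContDiff ℝ ∞ f)
    (hc : HasCompactSupport f) : ContDiff ℝ ∞ (polyLaplacian n m f) := by
  have : f = (hc.toSchwartzMap hf : 𝓢(Rn n, ℂ)) := rfl
  rw [this, polyLaplacian_schwartz]
  exact SchwartzMap.smooth _ _

/-! ### Mean values of harmonic functions -/

theorem hasDerivAt_max_zero_sq (t : ℝ) :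
    HasDerivAt (fun t : ℝ => max t 0 ^ 2) (2 * max t 0) t := by
  rcases lt_trichotomy t 0 with h | h | h
  · have e : (fun t : ℝ => max t 0 ^ 2) =ᶠ[𝓝 t] fun _ => 0 := by
      filter_upwards [gt_mem_nhds h] with s hs
      rw [max_eq_right hs.le]; norm_num
    rw [max_eq_right h.le, mul_zero]
    exact (hasDerivAt_const t 0).congr_of_eventuallyEq e
  · subst h
    simp only [max_self, mul_zero]
    rw [hasDerivAt_iff_isLittleO_nhds_zero]
    simp only [zero_add, max_self, smul_zero, sub_zero]
    refine Asymptotics.IsBigO.trans_isLittleO (g := fun h : ℝ => h ^ 2) ?_ ?_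
    · refine Asymptotics.isBigO_of_le _ fun h => ?_
      rcases le_total h 0 with h0 | h0
      · rw [max_eq_right h0]; simpa using sq_nonneg h
      · rw [max_eq_left h0]; simp
    · simpa using Asymptotics.isLittleO_pow_id (𝕜 := ℝ) one_lt_two
  · have e : (fun t : ℝ => max t 0 ^ 2) =ᶠ[𝓝 t] fun t => t ^ 2 := by
      filter_upwards [lt_mem_nhds h] with s hs
      rw [max_eq_left hs.le]
    rw [max_eq_left h.le]
    simpa using (hasDerivAt_pow 2 t).congr_of_eventuallyEq e

/-- The radial weight `(1 - |z|²)₊` against which harmonic functions are averaged. -/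
noncomputable def parabolicWeight {n : ℕ} (z : Rn n) : ℝ := max (1 - ‖z‖ ^ 2) 0

theorem continuous_parabolicWeight {n : ℕ} : Continuous (parabolicWeight (n := n)) := by
  unfold parabolicWeight; fun_prop

theorem parabolicWeight_nonneg {n : ℕ} (z : Rn n) : 0 ≤ parabolicWeight z := le_max_right _ _

theorem parabolicWeight_le_one {n : ℕ} (z : Rn n) : parabolicWeight z ≤ 1 :=
  max_le (by nlinarith [norm_nonneg z]) zero_le_one

theorem parabolicWeight_eq_zero {n : ℕ} {z : Rn n} (hz : 1 ≤ ‖z‖) : parabolicWeight z = 0 :=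
  max_eq_right (by nlinarith)

theorem hasCompactSupport_parabolicWeight {n : ℕ} :
    HasCompactSupport (parabolicWeight (n := n)) := by
  refine HasCompactSupport.intro (isCompact_closedBall (0 : Rn n) 1) fun z hz => ?_
  exact parabolicWeight_eq_zero (le_of_lt (by simpa using hz))

theorem integral_parabolicWeight_pos {n : ℕ} : 0 < ∫ z : Rn n, parabolicWeight z := by
  refine continuous_parabolicWeight.integral_pos_of_hasCompactSupport_nonneg_nonzero
    hasCompactSupport_parabolicWeight parabolicWeight_nonneg (x := 0) ?_
  simp [parabolicWeight]

/-- The weight `(1 - |z|²)₊` is radial, hence `z` times it is a gradient. -/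
theorem hasFDerivAt_parabolicWeight_sq {n : ℕ} (z : Rn n) :
    HasFDerivAt (fun z : Rn n => parabolicWeight z ^ 2)
      ((-4 * parabolicWeight z) • innerSL ℝ z) z := by
  have h1 : HasFDerivAt (fun z : Rn n => 1 - ‖z‖ ^ 2) (-(2 • innerSL ℝ z)) z := by
    simpa using (hasStrictFDerivAt_norm_sq z).hasFDerivAt.const_sub 1
  have h2 := (hasDerivAt_max_zero_sq (1 - ‖z‖ ^ 2)).comp_hasFDerivAt z h1
  refine h2.congr_fderiv ?_
  ext v
  simp [parabolicWeight]
  ring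

theorem integrable_parabolicWeight_mul {n : ℕ} {f : Rn n → ℂ} (hf : Continuous f) :
    Integrable (fun z => (parabolicWeight z : ℂ) * f z) := by
  refine Continuous.integrable_of_hasCompactSupport ?_ ?_
  · exact (Complex.continuous_ofReal.comp continuous_parabolicWeight).mul hf
  · exact (hasCompactSupport_parabolicWeight.comp_left Complex.ofReal_zero).mul_right

/-- Averages of a harmonic function over dilated balls do not depend on the dilation, in
differentiated form: an integration by parts, since `z (1 - |z|²)₊` is a gradient. -/
theorem integral_parabolicWeight_mul_fderiv {n : ℕ} {u : Rn n → ℂ} (hu : ContDiff ℝ ∞ u)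
    (hΔ : ∀ x, Laplacian.laplacian u x = 0) (R : ℝ) :
    ∫ z, (parabolicWeight z : ℂ) * fderiv ℝ u (R • z) z = 0 := by
  set e := EuclideanSpace.basisFun (Fin n) ℝ with he
  have hu1 : ContDiff ℝ ∞ (fderiv ℝ u) := hu.fderiv_right (by simp)
  set q : Rn n → ℂ := fun z => ((parabolicWeight z ^ 2 : ℝ) : ℂ) with hq
  have hqd : ∀ z, HasFDerivAt q (Complex.ofRealCLM.comp
      ((-4 * parabolicWeight z) • innerSL ℝ z)) z := fun z =>
    Complex.ofRealCLM.hasFDerivAt.comp z (hasFDerivAt_parabolicWeight_sq z)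
  set U : Fin n → Rn n → ℂ := fun i z => fderiv ℝ u (R • z) (e i) with hU
  have hUd : ∀ i z, HasFDerivAt (U i)
      (((ContinuousLinearMap.apply ℝ ℂ (e i)).comp (fderiv ℝ (fderiv ℝ u) (R • z))).comp
        (R • ContinuousLinearMap.id ℝ (Rn n))) z := by
    intro i z
    have h1 : HasFDerivAt (fun z : Rn n => R • z) (R • ContinuousLinearMap.id ℝ (Rn n)) z :=
      (hasFDerivAt_id z).const_smul R
    have h2 := ((hu1.differentiable (by simp)) (R • z)).hasFDerivAt.comp z h1
    have h3 := (ContinuousLinearMap.apply ℝ ℂ (e i)).hasFDerivAt.comp z h2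
    exact h3
  have hUc : ∀ i, Continuous (U i) := fun i =>
    (hu1.continuous.comp (by fun_prop : Continuous fun z : Rn n => R • z)).clm_apply
      continuous_const
  have hU'c : ∀ i, Continuous (fun z => fderiv ℝ (fderiv ℝ u) (R • z) (e i) (e i)) := fun i =>
    ((((hu1.fderiv_right (m := ∞) (by simp)).continuous).comp
      (by fun_prop : Continuous fun z : Rn n => R • z)).clm_apply
      continuous_const).clm_apply continuous_const
  have hqf : ∀ i z, fderiv ℝ q z (e i) = (parabolicWeight z : ℂ) * (-4 * (z i : ℂ)) := by
    intro i z
    rw [(hqd z).fderiv]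
    simp [he, EuclideanSpace.inner_single_right]
    ring
  have hUf : ∀ i z, fderiv ℝ (U i) z (e i) =
      R * fderiv ℝ (fderiv ℝ u) (R • z) (e i) (e i) := by
    intro i z
    rw [(hUd i z).fderiv]
    simp
  have hqm : ∀ f : Rn n → ℂ, (fun z => q z * f z) =
      fun z => (parabolicWeight z : ℂ) * ((parabolicWeight z : ℂ) * f z) := by
    intro f; ext z; simp only [hq]; push_cast; ring
  have hwc : Continuous (fun z : Rn n => (parabolicWeight z : ℂ)) :=
    Complex.continuous_ofReal.comp continuous_parabolicWeight
  have key : ∀ i, ∫ z, (parabolicWeight z : ℂ) * ((-4 * (z i : ℂ)) * U i z) =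
      - ∫ z, q z * (R * fderiv ℝ (fderiv ℝ u) (R • z) (e i) (e i)) := by
    intro i
    have := integral_mul_fderiv_eq_neg_fderiv_mul_of_integrable (μ := volume) (f := q)
      (g := U i) (v := e i) ?_ ?_ ?_ (fun z _ => (hqd z).differentiableAt)
      (fun z _ => (hUd i z).differentiableAt)
    · simp only [hqf, hUf] at this
      rw [this, neg_neg]
      simp only [mul_assoc]
    · simp only [hqf, mul_assoc]
      exact integrable_parabolicWeight_mul (by have := hUc i; fun_prop)
    · simp only [hUf]
      rw [hqm]
      exact integrable_parabolicWeight_mul (hwc.mul (continuous_const.mul (hU'c i)))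
    · rw [hqm]
      exact integrable_parabolicWeight_mul (hwc.mul (hUc i))
  have hint1 : ∀ i, Integrable fun z => (parabolicWeight z : ℂ) * ((-4 * (z i : ℂ)) * U i z) :=
    fun i => integrable_parabolicWeight_mul (by have := hUc i; fun_prop)
  have hint2 : ∀ i, Integrable fun z =>
      q z * (R * fderiv ℝ (fderiv ℝ u) (R • z) (e i) (e i)) := fun i => by
    rw [hqm]
    exact integrable_parabolicWeight_mul (hwc.mul (continuous_const.mul (hU'c i)))
  have hsum := Finset.sum_congr (rfl : (Finset.univ : Finset (Fin n)) = _) fun i _ => key i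
  rw [Finset.sum_neg_distrib, ← integral_finsetSum _ (fun i _ => hint1 i),
    ← integral_finsetSum _ (fun i _ => hint2 i)] at hsum
  have hr : ∀ z, ∑ i, q z * (R * fderiv ℝ (fderiv ℝ u) (R • z) (e i) (e i)) = 0 := by
    intro z
    rw [← Finset.mul_sum, ← Finset.mul_sum, ← laplacian_apply_eq, hΔ]
    simp
  simp only [hr, integral_zero, neg_zero] at hsum
  have hl : ∀ z, ∑ i, (parabolicWeight z : ℂ) * ((-4 * (z i : ℂ)) * U i z) =
      -4 * ((parabolicWeight z : ℂ) * fderiv ℝ u (R • z) z) := by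
    intro z
    have hz : fderiv ℝ u (R • z) z = ∑ i, (z i : ℂ) * U i z := by
      have := congrArg (fderiv ℝ u (R • z)) (e.sum_repr z)
      rw [map_sum] at this
      rw [← this]
      simp [he, hU]
    rw [hz, Finset.mul_sum, Finset.mul_sum]
    exact Finset.sum_congr rfl fun i _ => by ring
  simp only [hl] at hsum
  rw [integral_const_mul] at hsum
  simpa using hsum

/-- Mean value property of harmonic functions, for averages against `(1 - |z|²)₊`. -/
theorem integral_parabolicWeight_mul_harmonic {n : ℕ} {u : Rn n → ℂ} (hu : ContDiff ℝ ∞ u)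
    (hΔ : ∀ x, Laplacian.laplacian u x = 0) (R : ℝ) :
    ∫ z, (parabolicWeight z : ℂ) * u (R • z) = ((∫ z : Rn n, parabolicWeight z : ℝ) : ℂ) * u 0 := by
  have hu1 : Continuous (fderiv ℝ u) := (hu.fderiv_right (m := ∞) (by simp)).continuous
  have hd : ∀ R : ℝ, HasDerivAt (fun R : ℝ => ∫ z, (parabolicWeight z : ℂ) * u (R • z)) 0 R := by
    intro R
    obtain ⟨C, hC⟩ := (isCompact_closedBall (0 : Rn n) (|R| + 1)).exists_bound_of_continuousOn
      hu1.continuousOn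
    have := hasDerivAt_integral_of_dominated_loc_of_deriv_le (μ := (volume : Measure (Rn n)))
      (F := fun (R : ℝ) (z : Rn n) => (parabolicWeight z : ℂ) * u (R • z))
      (F' := fun R z => (parabolicWeight z : ℂ) * fderiv ℝ u (R • z) z)
      (x₀ := R) (s := ball R 1) (bound := fun z => parabolicWeight z * C)
      (ball_mem_nhds R one_pos) ?_ ?_ ?_ ?_ ?_ ?_
    · rw [← integral_parabolicWeight_mul_fderiv hu hΔ R]
      exact this.2
    · refine Eventually.of_forall fun R => (integrable_parabolicWeight_mul ?_).aestronglyMeasurable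
      exact hu.continuous.comp (by fun_prop)
    · exact integrable_parabolicWeight_mul (hu.continuous.comp (by fun_prop))
    · exact (integrable_parabolicWeight_mul ((hu1.comp
        (by fun_prop : Continuous fun z : Rn n => R • z)).clm_apply
        continuous_id)).aestronglyMeasurable
    · refine ae_of_all _ fun z R' hR' => ?_
      rw [norm_mul, Complex.norm_real, Real.norm_of_nonneg (parabolicWeight_nonneg z)]
      rcases le_or_gt 1 ‖z‖ with hz | hz
      · rw [parabolicWeight_eq_zero hz]; simp
      · refine mul_le_mul_of_nonneg_left ?_ (parabolicWeight_nonneg z)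
        have hR'' : |R'| ≤ |R| + 1 := by
          have h1 : |R' - R| < 1 := by simpa [Real.dist_eq] using hR'
          have h2 := abs_add_le R (R' - R)
          rw [add_sub_cancel] at h2
          linarith
        have hmem : R' • z ∈ closedBall (0 : Rn n) (|R| + 1) := by
          rw [mem_closedBall_zero_iff, norm_smul, Real.norm_eq_abs]
          nlinarith [abs_nonneg R', norm_nonneg z]
        have hC' := hC _ hmem
        have h0 : 0 ≤ ‖fderiv ℝ u (R' • z)‖ := norm_nonneg _
        calc ‖fderiv ℝ u (R' • z) z‖ ≤ ‖fderiv ℝ u (R' • z)‖ * ‖z‖ :=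
              ContinuousLinearMap.le_opNorm _ _
          _ ≤ C := by nlinarith [norm_nonneg z]
    · exact (continuous_parabolicWeight.integrable_of_hasCompactSupport
        hasCompactSupport_parabolicWeight).mul_const C
    · refine ae_of_all _ fun z R' _ => ?_
      have h1 : HasDerivAt (fun R : ℝ => R • z) z R' := by
        simpa using (hasDerivAt_id R').smul_const z
      exact (((hu.differentiable (by simp)) (R' • z)).hasFDerivAt.comp_hasDerivAt R' h1).const_mul _
  have hc := is_const_of_deriv_eq_zero (fun R => (hd R).differentiableAt)
    (fun R => (hd R).deriv) R 0
  rw [hc]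
  simp only [zero_smul]
  rw [integral_mul_const, integral_complex_ofReal]

/-! ### A Liouville theorem -/

theorem contDiff_convolution_test {n : ℕ} {w χ : Rn n → ℂ} (hw : LocallyIntegrable w)
    (hχ : ContDiff ℝ ∞ χ) (hc : HasCompactSupport χ) :
    ContDiff ℝ ∞ (w ⋆[ContinuousLinearMap.mul ℝ ℂ] χ) :=
  hc.contDiff_convolution_right _ hw hχ

theorem fderiv_convolution_test {n : ℕ} {w χ : Rn n → ℂ} (hw : LocallyIntegrable w)
    (hχ : ContDiff ℝ ∞ χ) (hc : HasCompactSupport χ) (x v : Rn n) :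
    fderiv ℝ (w ⋆[ContinuousLinearMap.mul ℝ ℂ] χ) x v =
      (w ⋆[ContinuousLinearMap.mul ℝ ℂ] fun y => fderiv ℝ χ y v) x := by
  rw [(hc.hasFDerivAt_convolution_right _ hw (hχ.of_le (by simp)) x).fderiv]
  exact convolution_precompR_apply _ hw (hc.fderiv ℝ) (hχ.continuous_fderiv (by simp)) x v

theorem laplacian_convolution_test {n : ℕ} {w χ : Rn n → ℂ} (hw : LocallyIntegrable w)
    (hχ : ContDiff ℝ ∞ χ) (hc : HasCompactSupport χ) (x : Rn n) :
    Laplacian.laplacian (w ⋆[ContinuousLinearMap.mul ℝ ℂ] χ) x =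
      (w ⋆[ContinuousLinearMap.mul ℝ ℂ] Laplacian.laplacian χ) x := by
  set e := EuclideanSpace.basisFun (Fin n) ℝ with he
  have hD : ∀ v, ContDiff ℝ ∞ (fun y => fderiv ℝ χ y v) := fun v =>
    (hχ.fderiv_right (m := ∞) (by simp)).clm_apply contDiff_const
  have hDc : ∀ v, HasCompactSupport (fun y => fderiv ℝ χ y v) := fun v => hc.fderiv_apply ℝ v
  have h2 : ∀ {f : Rn n → ℂ}, ContDiff ℝ ∞ f → ∀ x v v',
      fderiv ℝ (fderiv ℝ f) x v v' = fderiv ℝ (fun y => fderiv ℝ f y v') x v := by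
    intro f hf x v v'
    have := ((hf.fderiv_right (m := ∞) (by simp)).differentiable (by simp)) x
    rw [fderiv_clm_apply this (differentiableAt_const _)]
    simp
  have hex : ∀ i, ConvolutionExistsAt w
      (fun y => fderiv ℝ (fun y => fderiv ℝ χ y (e i)) y (e i)) x
      (ContinuousLinearMap.mul ℝ ℂ) volume := fun i =>
    (HasCompactSupport.convolutionExists_right _ ((hDc (e i)).fderiv_apply ℝ _) hw
      ((((hD (e i)).fderiv_right (m := ∞) (by simp)).clm_apply contDiff_const).continuous)) x
  rw [laplacian_apply_eq]
  simp only [h2 (contDiff_convolution_test hw hχ hc), fderiv_convolution_test hw hχ hc,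
    fderiv_convolution_test hw (hD _) (hDc _)]
  simp only [convolution]
  rw [← integral_finsetSum _ fun i _ => hex i]
  refine integral_congr_ae (ae_of_all _ fun t => ?_)
  simp only [laplacian_apply_eq, h2 hχ, ← map_sum]
  rfl

/-- A smooth function obtained by mollifying a function of `L²_{-s}`, `s < n / 2`, vanishes as
soon as it is harmonic: its averages over large balls tend to zero. -/
theorem convolution_eq_zero_of_harmonic {n : ℕ} {s : ℝ} (hs0 : 0 ≤ s) (hs : s < n / 2)
    {w χ : Rn n → ℂ} (hw : w ∈ WeightedL2 n (-s)) (hχ : ContDiff ℝ ∞ χ)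
    (hc : HasCompactSupport χ)
    (h : ∀ x, (w ⋆[ContinuousLinearMap.mul ℝ ℂ] Laplacian.laplacian χ) x = 0) :
    (w ⋆[ContinuousLinearMap.mul ℝ ℂ] χ) 0 = 0 := by
  have hloc := WeightedL2.locallyIntegrable hw
  set u := w ⋆[ContinuousLinearMap.mul ℝ ℂ] χ with hu
  have huC : ContDiff ℝ ∞ u := contDiff_convolution_test hloc hχ hc
  have hmean := integral_parabolicWeight_mul_harmonic huC
    (fun x => (laplacian_convolution_test hloc hχ hc x).trans (h x))
  obtain ⟨C, hC0, hC⟩ := exists_setIntegral_norm_le hs0 hw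
  obtain ⟨r, hr1, hr⟩ : ∃ r : ℝ, 1 ≤ r ∧ ∀ x, χ x ≠ 0 → ‖x‖ ≤ r := by
    obtain ⟨r, hr⟩ := hc.isCompact.isBounded.exists_norm_le
    exact ⟨max r 1, le_max_right _ _, fun x hx =>
      (hr x (subset_tsupport _ hx)).trans (le_max_left _ _)⟩
  set A := ∫ x, ‖χ x‖
  have hχi : Integrable χ := hχ.continuous.integrable_of_hasCompactSupport hc
  set I := ∫ z : Rn n, parabolicWeight z with hI
  have hIpos : 0 < I := integral_parabolicWeight_pos
  have hbound : ∀ R : ℝ, r ≤ R →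
      I * ‖u 0‖ ≤ (2 ^ (s + n / 2) * C * A) * R ^ (-(n / 2 - s)) := by
    intro R hR
    have hR0 : 0 < R := by linarith
    set W : Rn n → ℝ := (closedBall 0 (2 * R)).indicator (fun t => ‖w t‖) with hW
    have hWi : Integrable W :=
      (integrable_indicator_iff measurableSet_closedBall).2 (hC (2 * R) (by linarith)).1.norm
    set H : Rn n → ℂ := fun x => (parabolicWeight (R⁻¹ • x) : ℂ) * u x with hH
    set Q : Rn n → ℝ := W ⋆[ContinuousLinearMap.mul ℝ ℝ] (fun x => ‖χ x‖) with hQ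
    have hQi : Integrable Q := hWi.integrable_convolution _ hχi.norm
    have hQ0 : ∀ x, 0 ≤ Q x := fun x => by
      refine integral_nonneg fun t => mul_nonneg ?_ (norm_nonneg _)
      exact indicator_nonneg (fun _ _ => norm_nonneg _) _
    have hHQ : ∀ x, ‖H x‖ ≤ Q x := by
      intro x
      rcases le_or_gt R ‖x‖ with hx | hx
      · have : 1 ≤ ‖R⁻¹ • x‖ := by
          rw [norm_smul, norm_inv, Real.norm_of_nonneg hR0.le, ← div_eq_inv_mul, one_le_div hR0]
          exact hx
        simp only [hH, parabolicWeight_eq_zero this]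
        simpa using hQ0 x
      · have h1 : ‖H x‖ ≤ ‖u x‖ := by
          simp only [hH]
          rw [norm_mul, Complex.norm_real, Real.norm_of_nonneg (parabolicWeight_nonneg _)]
          exact mul_le_of_le_one_left (norm_nonneg _) (parabolicWeight_le_one _)
        refine h1.trans ((norm_integral_le_integral_norm _).trans (le_of_eq ?_))
        refine integral_congr_ae (ae_of_all _ fun t => ?_)
        simp only [ContinuousLinearMap.mul_apply', norm_mul, hW]
        by_cases ht : χ (x - t) = 0
        · simp [ht]
        · rw [indicator_of_mem]
          have h2 := hr _ ht
          have h3 : ‖t‖ ≤ ‖x‖ + ‖x - t‖ := by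
            simpa using norm_sub_le x (x - t)
          rw [mem_closedBall_zero_iff]
          linarith
    have e1 : ∫ z, (parabolicWeight z : ℂ) * u (R • z) = ∫ z, H (R • z) := by
      refine integral_congr_ae (ae_of_all _ fun z => ?_)
      simp only [hH, smul_smul, inv_mul_cancel₀ hR0.ne', one_smul]
    have e2 : I * ‖u 0‖ = ‖∫ z, H (R • z)‖ := by
      rw [← e1, hmean R, norm_mul, Complex.norm_real, Real.norm_of_nonneg hIpos.le]
    rw [e2, Measure.integral_comp_smul, norm_smul]
    have e3 : ‖∫ x, H x‖ ≤ C * (2 * R) ^ (s + n / 2) * A := by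
      calc ‖∫ x, H x‖ ≤ ∫ x, Q x := norm_integral_le_of_norm_le hQi (ae_of_all _ hHQ)
        _ = (∫ x, W x) * A := by
          rw [hQ, integral_convolution _ hWi hχi.norm]; rfl
        _ ≤ C * (2 * R) ^ (s + n / 2) * A := by
          refine mul_le_mul_of_nonneg_right ?_ (integral_nonneg fun x => norm_nonneg _)
          rw [hW, integral_indicator measurableSet_closedBall]
          exact (hC (2 * R) (by linarith)).2
    have e4 : ‖|(R ^ Module.finrank ℝ (Rn n))⁻¹|‖ = R ^ (-(n : ℝ)) := by
      rw [norm_abs_eq_norm, norm_inv, norm_pow, Real.norm_of_nonneg hR0.le,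
        Real.rpow_neg hR0.le, Real.rpow_natCast]
      simp
    rw [e4]
    calc R ^ (-(n : ℝ)) * ‖∫ x, H x‖ ≤ R ^ (-(n : ℝ)) * (C * (2 * R) ^ (s + n / 2) * A) := by
          gcongr
      _ = 2 ^ (s + n / 2) * C * A * (R ^ (-(n : ℝ)) * R ^ (s + n / 2)) := by
          rw [Real.mul_rpow (by norm_num) hR0.le]; ring
      _ = _ := by rw [← Real.rpow_add hR0]; congr 2; ring
  have hlim : Tendsto (fun R : ℝ => (2 ^ (s + n / 2) * C * A) * R ^ (-(n / 2 - s)))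
      atTop (𝓝 0) := by
    simpa using (tendsto_rpow_neg_atTop (show 0 < n / 2 - s by linarith)).const_mul
      (2 ^ (s + n / 2) * C * A)
  have h0 : I * ‖u 0‖ ≤ 0 := ge_of_tendsto hlim
    ((eventually_ge_atTop r).mono hbound)
  have : ‖u 0‖ ≤ 0 := by
    by_contra hpos
    push Not at hpos
    nlinarith [mul_pos hIpos hpos]
  exact norm_le_zero_iff.1 this

theorem WeightedL2.comp_neg {n : ℕ} {s : ℝ} {w : Rn n → ℂ} (hw : w ∈ WeightedL2 n s) :
    (fun x => w (-x)) ∈ WeightedL2 n s := by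
  have := MemLp.comp_measurePreserving hw (Measure.measurePreserving_neg volume)
  simpa [WeightedL2, Function.comp_def] using this

theorem convolution_comp_neg_apply {n : ℕ} (w χ : Rn n → ℂ) (x : Rn n) :
    ((fun t => w (-t)) ⋆[ContinuousLinearMap.mul ℝ ℂ] χ) x = ∫ y, w y * χ (y + x) := by
  rw [convolution, ← integral_neg_eq_self]
  simp [add_comm]

/-- Liouville's theorem for `(-Δ)^m` in `L²_{-s}`, `s < n / 2`, in the sense of distributions. The
factors `-Δ` are removed one at a time: by translation invariance, the convolution of `w` with
`(-Δ)^{m-j-1} η` is harmonic as soon as `w` annihilates all `(-Δ)^{m-j} η`. -/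
theorem ae_eq_zero_of_polyharmonic {n m : ℕ} {s : ℝ} (hs0 : 0 ≤ s) (hs : s < n / 2)
    {w : Rn n → ℂ} (hw : w ∈ WeightedL2 n (-s))
    (h : ∀ η : Rn n → ℂ, ContDiff ℝ ∞ η → HasCompactSupport η →
      ∫ x, w x * polyLaplacian n m η x = 0) : w =ᵐ[volume] 0 := by
  have hall : ∀ j, j ≤ m → ∀ η : Rn n → ℂ, ContDiff ℝ ∞ η → HasCompactSupport η →
      ∫ x, w x * polyLaplacian n (m - j) η x = 0 := by
    intro j hj
    induction j with
    | zero => exact h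
    | succ j ih =>
      intro η hη hηc
      have ih' := ih (by omega)
      set χ := polyLaplacian n (m - (j + 1)) η with hχ
      have hχs := contDiff_polyLaplacian (m - (j + 1)) hη hηc
      have hχc := hasCompactSupport_polyLaplacian (m - (j + 1)) hηc
      have e : polyLaplacian n (m - j) η = -Laplacian.laplacian χ := by
        rw [show m - j = (m - (j + 1)) + 1 by omega, polyLaplacian,
          Function.iterate_succ_apply']
        rfl
      have key := convolution_eq_zero_of_harmonic hs0 hs (WeightedL2.comp_neg hw) hχs hχc ?_
      · rw [convolution_comp_neg_apply] at key
        simpa using key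
      · intro x
        have h1 := ih' (fun y => η (y + x)) (hη.comp (contDiff_id.add contDiff_const))
          (hηc.comp_homeomorph (Homeomorph.addRight x))
        rw [polyLaplacian_comp_add_right, e] at h1
        rw [convolution_comp_neg_apply]
        simpa [integral_neg] using h1
  have h0 := hall m le_rfl
  simp only [Nat.sub_self] at h0
  refine ae_eq_zero_of_integral_contDiff_smul_eq_zero
    (WeightedL2.locallyIntegrable hw) fun g hg hgc => ?_
  have := h0 (fun x => (g x : ℂ)) (Complex.ofRealCLM.contDiff.comp hg)
    (hgc.comp_left Complex.ofReal_zero)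
  rw [← this]
  refine integral_congr_ae (ae_of_all _ fun x => ?_)
  simp [polyLaplacian, mul_comm]

/-! ### The operators of the expansion -/

/-- Cauchy-Schwarz inequality. -/
theorem norm_integral_mul_le {n : ℕ} {f : Rn n → ℂ} (hf : MemLp f 2 volume) (φ : L2 n) :
    ‖∫ y, f y * φ y‖ ≤ Real.sqrt (∫ y, ‖f y‖ ^ 2) * ‖φ‖ := by
  set g : L2 n := hf.star.toLp _ with hg
  have hgc : g =ᵐ[volume] star f := MemLp.coeFn_toLp _
  have h1 : ∫ y, f y * φ y = inner ℂ g φ := by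
    rw [L2.inner_def]
    refine integral_congr_ae ?_
    filter_upwards [hgc] with y hy
    rw [hy]
    simp [mul_comm]
  have h2 : ‖g‖ = Real.sqrt (∫ y, ‖f y‖ ^ 2) := by
    rw [← Real.sqrt_sq (norm_nonneg g)]
    congr 1
    have := inner_self_eq_norm_sq_to_K (𝕜 := ℂ) g
    rw [L2.inner_def] at this
    have h3 : ∫ a, inner ℂ (g a) (g a) = ((∫ y, ‖f y‖ ^ 2 : ℝ) : ℂ) := by
      rw [← integral_complex_ofReal]
      refine integral_congr_ae ?_
      filter_upwards [hgc] with y hy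
      rw [inner_self_eq_norm_sq_to_K, hy]
      simp
    rw [h3] at this
    exact Complex.ofReal_injective (by simpa using this.symm)
  rw [h1, ← h2]
  exact norm_inner_le_norm _ _

/-- An integral operator is bounded on `L²` when the `L²` norms of the rows of its kernel are
dominated by a square integrable function. -/
theorem exists_clm_of_kernel {n : ℕ} {K : Rn n → Rn n → ℂ}
    (hK : Measurable (Function.uncurry K)) (hrow : ∀ x, MemLp (K x) 2 volume) {M : Rn n → ℝ}
    (hM : MemLp M 2 volume) (hle : ∀ x, Real.sqrt (∫ y, ‖K x y‖ ^ 2) ≤ M x) :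
    ∃ A : L2 n →L[ℂ] L2 n, ∀ φ : L2 n, A φ =ᵐ[volume] fun x => ∫ y, K x y * φ y := by
  have hm : ∀ φ : L2 n, AEStronglyMeasurable (fun x => ∫ y, K x y * φ y) volume := fun φ =>
    AEStronglyMeasurable.integral_prod_right' (f := fun p : Rn n × Rn n => K p.1 p.2 * φ p.2)
      (hK.aestronglyMeasurable.mul (Lp.aestronglyMeasurable φ).comp_snd)
  have hb : ∀ (φ : L2 n) (x : Rn n), ‖∫ y, K x y * φ y‖ ≤ ‖φ‖ * ‖M x‖ := fun φ x => by
    refine (norm_integral_mul_le (hrow x) φ).trans ?_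
    rw [mul_comm]
    exact mul_le_mul_of_nonneg_left ((hle x).trans (le_abs_self _)) (norm_nonneg _)
  have hmem : ∀ φ : L2 n, MemLp (fun x => ∫ y, K x y * φ y) 2 volume := fun φ =>
    MemLp.of_le_mul hM (hm φ) (ae_of_all _ (hb φ))
  have hint : ∀ (φ : L2 n) x, Integrable (fun y => K x y * φ y) := fun φ x =>
    (hrow x).integrable_mul (Lp.memLp φ)
  let A : L2 n →ₗ[ℂ] L2 n :=
    { toFun := fun φ => (hmem φ).toLp _
      map_add' := fun φ χ => by
        rw [← MemLp.toLp_add]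
        refine MemLp.toLp_congr _ _ (ae_of_all _ fun x => ?_)
        simp only [Pi.add_apply]
        rw [← integral_add (hint φ x) (hint χ x)]
        refine integral_congr_ae ?_
        filter_upwards [Lp.coeFn_add φ χ] with y hy
        rw [hy, Pi.add_apply, mul_add]
      map_smul' := fun c φ => by
        rw [RingHom.id_apply, ← MemLp.toLp_const_smul]
        refine MemLp.toLp_congr _ _ (ae_of_all _ fun x => ?_)
        simp only [Pi.smul_apply, smul_eq_mul]
        rw [← integral_const_mul]
        refine integral_congr_ae ?_
        filter_upwards [Lp.coeFn_smul c φ] with y hy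
        rw [hy, Pi.smul_apply, smul_eq_mul]
        ring }
  refine ⟨A.mkContinuous ‖hM.toLp M‖ fun φ => ?_, fun φ => ?_⟩
  · rw [mul_comm]
    refine Lp.norm_le_mul_norm_of_ae_le_mul ?_
    filter_upwards [(hmem φ).coeFn_toLp, hM.coeFn_toLp] with x hx hx'
    rw [show A φ = (hmem φ).toLp _ from rfl, hx, hx']
    exact hb φ x
  · exact (hmem φ).coeFn_toLp

/-- Multiplication by a measurable function bounded by `1`, as a bounded operator on `L²`. -/
theorem exists_clm_mul {n : ℕ} {U : Rn n → ℂ} (hU : Measurable U) (hU1 : ∀ x, ‖U x‖ ≤ 1) :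
    ∃ A : L2 n →L[ℂ] L2 n, ∀ φ : L2 n, A φ =ᵐ[volume] fun x => U x * φ x := by
  have hb : ∀ (φ : L2 n) x, ‖U x * φ x‖ ≤ ‖φ x‖ := fun φ x => by
    rw [norm_mul]
    exact mul_le_of_le_one_left (norm_nonneg _) (hU1 x)
  have hmem : ∀ φ : L2 n, MemLp (fun x => U x * φ x) 2 volume := fun φ =>
    (Lp.memLp φ).of_le (hU.aestronglyMeasurable.mul (Lp.aestronglyMeasurable φ))
      (ae_of_all _ (hb φ))
  let A : L2 n →ₗ[ℂ] L2 n :=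
    { toFun := fun φ => (hmem φ).toLp _
      map_add' := fun φ χ => by
        rw [← MemLp.toLp_add]
        refine MemLp.toLp_congr _ _ ?_
        filter_upwards [Lp.coeFn_add φ χ] with y hy
        rw [Pi.add_apply, hy, Pi.add_apply, mul_add]
      map_smul' := fun c φ => by
        rw [RingHom.id_apply, ← MemLp.toLp_const_smul]
        refine MemLp.toLp_congr _ _ ?_
        filter_upwards [Lp.coeFn_smul c φ] with y hy
        rw [Pi.smul_apply, hy, Pi.smul_apply, smul_eq_mul, smul_eq_mul]
        ring }
  refine ⟨A.mkContinuous 1 fun φ => ?_, fun φ => (hmem φ).coeFn_toLp⟩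
  rw [one_mul]
  refine Lp.norm_le_norm_of_ae_le ?_
  filter_upwards [(hmem φ).coeFn_toLp] with x hx
  rw [show A φ = (hmem φ).toLp _ from rfl, hx]
  exact hb φ x

section Potential

variable {n : ℕ} {V : Rn n → ℝ}

theorem measurable_vFun (hV : Measurable V) : Measurable (vFun V) :=
  Real.continuous_sqrt.measurable.comp hV.norm

theorem measurable_uFun (hV : Measurable V) : Measurable (uFun V) :=
  Measurable.ite (measurableSet_le measurable_const hV) measurable_const measurable_const

theorem vFun_nonneg (x : Rn n) : 0 ≤ vFun V x := Real.sqrt_nonneg _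

theorem vFun_sq (x : Rn n) : vFun V x ^ 2 = |V x| := Real.sq_sqrt (abs_nonneg _)

theorem uFun_mul_self (x : Rn n) : uFun V x * uFun V x = 1 := by
  unfold uFun; split_ifs <;> norm_num

theorem uFun_mul_vFun_sq (x : Rn n) : uFun V x * vFun V x ^ 2 = V x := by
  rw [vFun_sq]
  unfold uFun
  split_ifs with h
  · rw [abs_of_nonneg h, one_mul]
  · rw [abs_of_neg (not_le.1 h)]; ring

theorem norm_uFun (x : Rn n) : ‖(uFun V x : ℂ)‖ = 1 := by
  unfold uFun; split_ifs <;> simp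

theorem exists_bound_vFun {β : ℝ} (hV : ∃ C : ℝ, ∀ x, |V x| ≤ C * (1 + ‖x‖) ^ (-β)) :
    ∃ C : ℝ, 0 ≤ C ∧ ∀ x, vFun V x ≤ C * (1 + ‖x‖) ^ (-(β / 2)) := by
  obtain ⟨C, hC⟩ := hV
  have hC0 : 0 ≤ C := by
    have := (abs_nonneg _).trans (hC 0)
    simpa using this
  refine ⟨Real.sqrt C, Real.sqrt_nonneg _, fun x => ?_⟩
  rw [vFun]
  refine Real.sqrt_le_iff.2 ⟨by positivity, (hC x).trans (le_of_eq ?_)⟩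
  rw [mul_pow, Real.sq_sqrt hC0, ← Real.rpow_natCast ((1 + ‖x‖) ^ (-(β / 2))),
    ← Real.rpow_mul (by positivity)]
  congr 2
  push_cast; ring

/-- A polynomial weight times `v` is square integrable. -/
theorem memLp_weight_mul_vFun (hVm : Measurable V) {β : ℝ}
    (hV : ∃ C : ℝ, ∀ x, |V x| ≤ C * (1 + ‖x‖) ^ (-β)) {d : ℝ} (hd : n + 2 * d < β) :
    MemLp (fun x => (1 + ‖x‖) ^ d * vFun V x) 2 volume := by
  obtain ⟨C, hC0, hC⟩ := exists_bound_vFun hV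
  have hv := measurable_vFun hVm
  have hm : AEStronglyMeasurable (fun x : Rn n => (1 + ‖x‖) ^ d * vFun V x) volume :=
    Measurable.aestronglyMeasurable (by fun_prop)
  rw [memLp_two_iff_integrable_sq hm]
  refine ((integrable_weight (n := n) (r := β - 2 * d) (by linarith)).const_mul (C ^ 2)).mono'
    (hm.pow 2) (ae_of_all _ fun x => ?_)
  have h0 := vFun_nonneg (V := V) x
  rw [Real.norm_of_nonneg (by positivity)]
  calc ((1 + ‖x‖) ^ d * vFun V x) ^ 2
      ≤ ((1 + ‖x‖) ^ d * (C * (1 + ‖x‖) ^ (-(β / 2)))) ^ 2 := by gcongr; exact hC x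
    _ = C ^ 2 * ((1 + ‖x‖) ^ d * (1 + ‖x‖) ^ (-(β / 2))) ^ 2 := by ring
    _ = _ := by
      rw [← Real.rpow_add (by positivity), ← Real.rpow_natCast (_ ^ _),
        ← Real.rpow_mul (by positivity)]
      congr 2
      push_cast; ring

/-- Sandwiching a kernel between two factors `v` gives a bounded operator. -/
theorem exists_clm_of_sandwich (hVm : Measurable V) {k : Rn n → Rn n → ℝ}
    (hk : Measurable (Function.uncurry k)) {N : Rn n → ℝ} (hN0 : ∀ x, 0 ≤ N x)
    (hrow : ∀ x, Integrable (fun y => (k x y * vFun V y) ^ 2) ∧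
      ∫ y, (k x y * vFun V y) ^ 2 ≤ N x ^ 2)
    (hN : MemLp (fun x => N x * vFun V x) 2 volume) :
    ∃ A : L2 n →L[ℂ] L2 n, ∀ φ : L2 n, A φ =ᵐ[volume] fun x => (vFun V x : ℂ) *
      ∫ y, (k x y : ℂ) * ((vFun V y : ℂ) * φ y) := by
  have hv := measurable_vFun hVm
  set K : Rn n → Rn n → ℂ := fun x y => ((vFun V x * (k x y * vFun V y) : ℝ) : ℂ) with hK
  have hKm : Measurable (Function.uncurry K) := by
    refine Complex.measurable_ofReal.comp ?_
    exact (hv.comp measurable_fst).mul (hk.mul (hv.comp measurable_snd))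
  have hn : ∀ x y, ‖K x y‖ ^ 2 = vFun V x ^ 2 * (k x y * vFun V y) ^ 2 := fun x y => by
    rw [hK, Complex.norm_real, Real.norm_eq_abs, sq_abs, mul_pow]
  have hKrow : ∀ x, MemLp (K x) 2 volume := fun x => by
    have h1 : Measurable (K x) := hKm.comp measurable_prodMk_left
    rw [memLp_two_iff_integrable_sq_norm h1.aestronglyMeasurable]
    simp only [hn]
    exact (hrow x).1.const_mul _
  have hle : ∀ x, Real.sqrt (∫ y, ‖K x y‖ ^ 2) ≤ N x * vFun V x := fun x => by
    have h0 := vFun_nonneg (V := V) x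
    simp only [hn, integral_const_mul]
    refine Real.sqrt_le_iff.2 ⟨mul_nonneg (hN0 x) h0, ?_⟩
    rw [mul_pow, mul_comm]
    gcongr
    exact (hrow x).2
  obtain ⟨A, hA⟩ := exists_clm_of_kernel hKm hKrow hN hle
  refine ⟨A, fun φ => (hA φ).trans (ae_of_all _ fun x => ?_)⟩
  simp only
  rw [← integral_const_mul]
  refine integral_congr_ae (ae_of_all _ fun y => ?_)
  simp only [hK]
  push_cast
  ring

theorem norm_sub_le_weight_mul (x y : Rn n) : ‖x - y‖ ≤ (1 + ‖x‖) * (1 + ‖y‖) := by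
  have := norm_sub_le x y
  nlinarith [norm_nonneg x, norm_nonneg y]

/-- All operators of the expansion are bounded on `L²`. -/
theorem actsAs_expansionOp {m k : ℕ} (hk : 1 ≤ k) (hkm : k ≤ m / 2 + 1)
    (hn : n + 2 * k = 4 * m + 1) (hVm : Measurable V)
    {β : ℝ} (hβ : (n : ℝ) + 4 * k < β)
    (hV : ∃ C : ℝ, ∀ x, |V x| ≤ C * (1 + ‖x‖) ^ (-β)) {j : ℕ} (hj : j ≤ k) :
    ActsAs (expansionOp m V j) (formalOp m V j) := by
  suffices h : ∃ A : L2 n →L[ℂ] L2 n, ActsAs A (formalOp m V j) by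
    obtain ⟨A, hA⟩ := h
    rwa [expansionOp, opOf_eq hA]
  have hv := measurable_vFun hVm
  have hk0 : (1 : ℝ) ≤ k := by exact_mod_cast hk
  have hmem : ∀ d : ℝ, d ≤ 2 * k → MemLp (fun x => (1 + ‖x‖) ^ d * vFun V x) 2 volume :=
    fun d hd => memLp_weight_mul_vFun hVm hV (by linarith)
  have hv2 : MemLp (vFun V) 2 volume := by simpa using hmem 0 (by linarith)
  obtain ⟨Cv, hCv0, hCv⟩ := exists_bound_vFun hV
  match j, hj with
  | 0, _ =>
    have hn2 : (n : ℝ) + 2 * k = 4 * m + 1 := by exact_mod_cast hn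
    have hn1 : 1 ≤ n := by omega
    have h2m : 2 * (m : ℝ) ≤ n := by exact_mod_cast (by omega : 2 * m ≤ n)
    obtain ⟨M, hM0, hM⟩ := exists_kernel_bound hn1 (b := 2 * (n - 2 * m)) (r := β)
      (by linarith) (by linarith) (by linarith)
    set c := rieszConst n m
    obtain ⟨A₁, hA₁⟩ := exists_clm_mul (U := fun x => (uFun V x : ℂ))
      (Complex.measurable_ofReal.comp (measurable_uFun hVm)) (fun x => (norm_uFun x).le)
    have hle : ∀ x y : Rn n, (c * ‖x - y‖ ^ (2 * (m : ℝ) - n) * vFun V y) ^ 2 ≤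
        (c * Cv) ^ 2 * (‖x - y‖ ^ (-(2 * ((n : ℝ) - 2 * m))) * (1 + ‖y‖) ^ (-β)) := by
      intro x y
      have h0 := vFun_nonneg (V := V) y
      have h1 : vFun V y ^ 2 ≤ Cv ^ 2 * (1 + ‖y‖) ^ (-β) := by
        calc vFun V y ^ 2 ≤ (Cv * (1 + ‖y‖) ^ (-(β / 2))) ^ 2 := by gcongr; exact hCv y
          _ = _ := by
            rw [mul_pow, ← Real.rpow_natCast ((1 + ‖y‖) ^ (-(β / 2))),
              ← Real.rpow_mul (by positivity)]
            congr 2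
            push_cast; ring
      have h2 : (‖x - y‖ ^ (2 * (m : ℝ) - n)) ^ 2 = ‖x - y‖ ^ (-(2 * ((n : ℝ) - 2 * m))) := by
        rw [← Real.rpow_natCast, ← Real.rpow_mul (norm_nonneg _)]
        congr 1
        push_cast; ring
      calc (c * ‖x - y‖ ^ (2 * (m : ℝ) - n) * vFun V y) ^ 2
          = c ^ 2 * ‖x - y‖ ^ (-(2 * ((n : ℝ) - 2 * m))) * vFun V y ^ 2 := by
            rw [mul_pow, mul_pow, h2]
        _ ≤ c ^ 2 * ‖x - y‖ ^ (-(2 * ((n : ℝ) - 2 * m))) * (Cv ^ 2 * (1 + ‖y‖) ^ (-β)) := by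
            gcongr
        _ = _ := by ring
    obtain ⟨A₂, hA₂⟩ := exists_clm_of_sandwich hVm
      (k := fun x y => c * ‖x - y‖ ^ (2 * (m : ℝ) - n))
      (by rw [Function.uncurry_def]; fun_prop)
      (N := fun _ => Real.sqrt ((c * Cv) ^ 2 * M)) (fun _ => Real.sqrt_nonneg _)
      (fun x => by
        have hi : Integrable (fun y => (c * ‖x - y‖ ^ (2 * (m : ℝ) - n) * vFun V y) ^ 2) := by
          refine ((hM x).1.const_mul ((c * Cv) ^ 2)).mono'
            (Measurable.aestronglyMeasurable (by fun_prop)) (ae_of_all _ fun y => ?_)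
          rw [Real.norm_of_nonneg (sq_nonneg _)]
          exact hle x y
        refine ⟨hi, ?_⟩
        rw [Real.sq_sqrt (by positivity)]
        refine (integral_mono hi ((hM x).1.const_mul _) (hle x)).trans ?_
        rw [integral_const_mul]
        exact mul_le_mul_of_nonneg_left (hM x).2 (sq_nonneg _))
      (hv2.const_mul _)
    refine ⟨A₁ + A₂, fun φ => ?_⟩
    rw [_root_.add_apply]
    filter_upwards [Lp.coeFn_add (A₁ φ) (A₂ φ), hA₁ φ, hA₂ φ] with x h1 h2 h3
    rw [h1, Pi.add_apply, h2, h3]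
    rfl
  | 1, _ =>
    set c := (∫ y, vFun V y ^ 2)⁻¹ with hc
    have hi : Integrable fun y => (c * vFun V y) ^ 2 := (hv2.const_mul c).integrable_sq
    obtain ⟨A, hA⟩ := exists_clm_of_sandwich hVm (k := fun _ _ => c) measurable_const
      (N := fun _ => Real.sqrt (∫ y, (c * vFun V y) ^ 2)) (fun _ => Real.sqrt_nonneg _)
      (fun x => ⟨hi, by rw [Real.sq_sqrt (integral_nonneg fun y => sq_nonneg _)]⟩)
      (hv2.const_mul _)
    refine ⟨A, fun φ => (hA φ).trans (ae_of_all _ fun x => ?_)⟩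
    simp only [formalOp]
    rw [integral_const_mul]
    ring
  | j + 2, hj =>
    have hj' : ((2 * (j + 2) - 2 : ℕ) : ℝ) ≤ 2 * k := by
      exact_mod_cast (by omega : 2 * (j + 2) - 2 ≤ 2 * k)
    set d := 2 * (j + 2) - 2 with hd
    have hw := hmem d hj'
    simp only [Real.rpow_natCast] at hw
    have hle : ∀ x y : Rn n, (‖x - y‖ ^ d * vFun V y) ^ 2 ≤
        ((1 + ‖x‖) ^ d) ^ 2 * ((1 + ‖y‖) ^ d * vFun V y) ^ 2 := by
      intro x y
      have h0 := vFun_nonneg (V := V) y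
      rw [← mul_pow, ← mul_assoc, ← mul_pow]
      gcongr
      exact norm_sub_le_weight_mul x y
    obtain ⟨A, hA⟩ := exists_clm_of_sandwich hVm (k := fun x y => ‖x - y‖ ^ d)
      (by rw [Function.uncurry_def]; fun_prop)
      (N := fun x => Real.sqrt (∫ y, ((1 + ‖y‖) ^ d * vFun V y) ^ 2) * (1 + ‖x‖) ^ d)
      (fun x => by positivity)
      (fun x => by
        have hi : Integrable (fun y => (‖x - y‖ ^ d * vFun V y) ^ 2) := by
          refine (hw.integrable_sq.const_mul (((1 + ‖x‖) ^ d) ^ 2)).mono'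
            (Measurable.aestronglyMeasurable (by fun_prop)) (ae_of_all _ fun y => ?_)
          rw [Real.norm_of_nonneg (sq_nonneg _)]
          exact hle x y
        refine ⟨hi, (integral_mono hi (hw.integrable_sq.const_mul _) (hle x)).trans ?_⟩
        rw [integral_const_mul, mul_pow, Real.sq_sqrt (integral_nonneg fun y => sq_nonneg _),
          mul_comm])
      (by simpa only [mul_assoc] using hw.const_mul _)
    exact ⟨A, hA⟩

end Potential

/-! ### The standing assumptions -/

/-- The standing assumptions on the dimension, the order and the potential. -/
structure DecayingPotential (n m k : ℕ) (V : Rn n → ℝ) (β : ℝ) : Prop where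
  one_le : 1 ≤ k
  le_half : k ≤ m / 2 + 1
  dim_eq : n + 2 * k = 4 * m + 1
  measurable : Measurable V
  lt_decay : (n : ℝ) + 4 * k < β
  bound : ∃ C : ℝ, ∀ x, |V x| ≤ C * (1 + ‖x‖) ^ (-β)

namespace DecayingPotential

variable {n m k : ℕ} {V : Rn n → ℝ} {β : ℝ}

theorem one_le_m (h : DecayingPotential n m k V β) : 1 ≤ m := by
  have := h.one_le; have := h.dim_eq; omega

theorem two_mul_lt (h : DecayingPotential n m k V β) : 2 * m < n := by
  have := h.one_le; have := h.dim_eq; have := h.le_half; omega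

theorem dim_eq_real (h : DecayingPotential n m k V β) : (n : ℝ) + 2 * k = 4 * m + 1 := by
  exact_mod_cast h.dim_eq

theorem one_le_real (h : DecayingPotential n m k V β) : (1 : ℝ) ≤ k := by
  exact_mod_cast h.one_le

theorem two_mul_lt_real (h : DecayingPotential n m k V β) : 2 * (m : ℝ) < n := by
  exact_mod_cast h.two_mul_lt

theorem actsAs (h : DecayingPotential n m k V β) {j : ℕ} (hj : j ≤ k) :
    ActsAs (expansionOp m V j) (formalOp m V j) :=
  actsAs_expansionOp h.one_le h.le_half h.dim_eq h.measurable h.lt_decay h.bound hj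

theorem memLp_weight (h : DecayingPotential n m k V β) {d : ℝ} (hd : d ≤ 2 * k) :
    MemLp (fun x => (1 + ‖x‖) ^ d * vFun V x) 2 volume :=
  memLp_weight_mul_vFun h.measurable h.bound (by have := h.lt_decay; linarith)

end DecayingPotential

/-! ### Riesz potentials -/

/-- The Riesz potential `(-Δ)^{-m} f`. -/
noncomputable def rieszPotential {n : ℕ} (m : ℕ) (f : Rn n → ℂ) (x : Rn n) : ℂ :=
  ∫ y, ((rieszConst n m * ‖x - y‖ ^ (2 * (m : ℝ) - n) : ℝ) : ℂ) * f y

theorem aestronglyMeasurable_rieszPotential {n m : ℕ} {f : Rn n → ℂ}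
    (hf : AEStronglyMeasurable f volume) :
    AEStronglyMeasurable (rieszPotential m f) volume := by
  refine AEStronglyMeasurable.integral_prod_right' (f := fun p : Rn n × Rn n =>
    ((rieszConst n m * ‖p.1 - p.2‖ ^ (2 * (m : ℝ) - n) : ℝ) : ℂ) * f p.2) ?_
  exact AEStronglyMeasurable.mul (Measurable.aestronglyMeasurable (by fun_prop)) hf.comp_snd

theorem norm_rieszPotential_le {n m : ℕ} (f : Rn n → ℂ) (x : Rn n) :
    ‖rieszPotential m f x‖ ≤ |rieszConst n m| * ∫ y, ‖x - y‖ ^ (-((n : ℝ) - 2 * m)) * ‖f y‖ := by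
  refine (norm_integral_le_integral_norm _).trans (le_of_eq ?_)
  rw [← integral_const_mul]
  refine integral_congr_ae (ae_of_all _ fun y => ?_)
  simp only
  rw [norm_mul, Complex.norm_real, norm_mul, Real.norm_eq_abs,
    Real.norm_of_nonneg (by positivity), neg_sub, mul_assoc]

/-- Duality of the Riesz potential with `(-Δ)^m`, by Fubini and the fundamental solution. -/
theorem integral_rieszPotential_mul_polyLaplacian {n m : ℕ} (hm : 1 ≤ m) (hmn : 2 * m < n)
    {f : Rn n → ℂ} (hf : Integrable f) {η : Rn n → ℂ} (hη : ContDiff ℝ ∞ η)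
    (hηc : HasCompactSupport η) :
    ∫ x, rieszPotential m f x * polyLaplacian n m η x = ∫ y, f y * η y := by
  have hmn' : 2 * (m : ℝ) < n := by exact_mod_cast hmn
  have hm' : (0 : ℝ) < m := by exact_mod_cast hm
  set c := rieszConst n m with hc
  set χ := hηc.toSchwartzMap hη with hχ
  have hηχ : η = χ := rfl
  set g := polyLaplacian n m η with hg
  have hgS : g = ((negLap n)^[m] χ : SchwartzMap (Rn n) ℂ) := by
    rw [hg, hηχ, polyLaplacian_schwartz]
  obtain ⟨C, hC0, hC⟩ := exists_schwartz_decay ((negLap n)^[m] χ) (n + 1)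
  rw [← hgS] at hC
  have hgc : Continuous g := by rw [hgS]; exact SchwartzMap.continuous _
  obtain ⟨M, hM0, hM⟩ := exists_kernel_bound (n := n) (by omega) (b := n - 2 * m) (r := n + 1)
    (by linarith) (by linarith) (by linarith)
  have hle : ∀ x y : Rn n, ‖x - y‖ ^ (-((n : ℝ) - 2 * m)) * ‖g x‖ ≤
      C * (‖y - x‖ ^ (-((n : ℝ) - 2 * m)) * (1 + ‖x‖) ^ (-((n : ℝ) + 1))) := fun x y => by
    rw [norm_sub_rev y x, mul_left_comm]
    gcongr
    simpa using hC x
  have hint : ∀ y, Integrable fun x => ‖x - y‖ ^ (-((n : ℝ) - 2 * m)) * ‖g x‖ := fun y => by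
    refine ((hM y).1.const_mul C).mono' ?_ (ae_of_all _ fun x => ?_)
    · exact (Measurable.aestronglyMeasurable (by fun_prop)).mul hgc.norm.aestronglyMeasurable
    · rw [Real.norm_of_nonneg (by positivity)]
      exact hle x y
  have hintle : ∀ y, ∫ x, ‖x - y‖ ^ (-((n : ℝ) - 2 * m)) * ‖g x‖ ≤ C * M := fun y => by
    refine (integral_mono (hint y) ((hM y).1.const_mul C) (fun x => hle x y)).trans ?_
    rw [integral_const_mul]
    exact mul_le_mul_of_nonneg_left (hM y).2 hC0
  set F : Rn n → Rn n → ℂ := fun x y =>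
    (((c * ‖x - y‖ ^ (2 * (m : ℝ) - n) : ℝ) : ℂ) * f y) * g x with hF
  have hFm : AEStronglyMeasurable (Function.uncurry F) (volume.prod volume) := by
    refine AEStronglyMeasurable.mul (AEStronglyMeasurable.mul
      (Measurable.aestronglyMeasurable (by fun_prop)) hf.1.comp_snd) ?_
    exact hgc.aestronglyMeasurable.comp_fst
  have hFn : ∀ x y, ‖F x y‖ = (|c| * ‖f y‖) * (‖x - y‖ ^ (-((n : ℝ) - 2 * m)) * ‖g x‖) := by
    intro x y
    rw [hF, norm_mul, norm_mul, Complex.norm_real, norm_mul, Real.norm_eq_abs,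
      Real.norm_of_nonneg (by positivity), neg_sub]
    ring
  have hFi : Integrable (Function.uncurry F) (volume.prod volume) := by
    rw [integrable_prod_iff' hFm]
    constructor
    · filter_upwards [hFm.prodMk_right] with y hy
      refine Integrable.mono' ((hint y).const_mul (|c| * ‖f y‖)) hy (ae_of_all _ fun x => ?_)
      exact (hFn x y).le
    · refine Integrable.mono' ((hf.norm.const_mul |c|).mul_const (C * M))
        hFm.norm.prod_swap.integral_prod_right' (ae_of_all _ fun y => ?_)
      simp only [Function.uncurry]
      rw [Real.norm_of_nonneg (integral_nonneg fun x => norm_nonneg _)]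
      simp only [hFn, integral_const_mul]
      exact mul_le_mul_of_nonneg_left (hintle y) (by positivity)
  have e1 : ∀ x, rieszPotential m f x * g x = ∫ y, F x y := fun x => by
    rw [rieszPotential, ← integral_mul_const]
  simp only [e1]
  rw [integral_integral_swap hFi]
  refine integral_congr_ae (ae_of_all _ fun y => ?_)
  have := integral_riesz_mul_polyLaplacian hm hmn χ y
  simp only
  rw [hηχ, ← this, ← integral_const_mul]
  refine integral_congr_ae (ae_of_all _ fun x => ?_)
  simp only [hF]
  rw [norm_sub_rev x y, ← hηχ]
  ring

/-! ### The resonance function attached to an element of `L²` -/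

section Resonance

variable {n m k : ℕ} {V : Rn n → ℝ} {β : ℝ}

/-- The function `v φ`. -/
noncomputable def vMul (V : Rn n → ℝ) (φ : L2 n) (y : Rn n) : ℂ := (vFun V y : ℂ) * φ y

/-- The candidate `ψ = -G₀ v φ` for a solution of `H ψ = 0` with `U v ψ = φ`. -/
noncomputable def resonance (m : ℕ) (V : Rn n → ℝ) (φ : L2 n) (x : Rn n) : ℂ :=
  -rieszPotential m (vMul V φ) x

theorem DecayingPotential.integrable_weight_vMul (h : DecayingPotential n m k V β) {d : ℝ}
    (hd : d ≤ 2 * k) (φ : L2 n) :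
    Integrable fun y => (((1 + ‖y‖) ^ d : ℝ) : ℂ) * vMul V φ y := by
  have h1 := ((h.memLp_weight hd).ofReal (K := ℂ)).integrable_mul (Lp.memLp φ)
  refine h1.congr (ae_of_all _ fun y => ?_)
  simp only [vMul, Pi.mul_apply]
  rw [RCLike.ofReal_eq_complex_ofReal, Complex.ofReal_mul, mul_assoc]

theorem DecayingPotential.integrable_vMul (h : DecayingPotential n m k V β) (φ : L2 n) :
    Integrable (vMul V φ) := by
  simpa using h.integrable_weight_vMul (d := 0) (by have := h.one_le_real; linarith) φ

/-- Pointwise decay of the resonance function, of the order of the Riesz kernel. -/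
theorem DecayingPotential.exists_resonance_bound (h : DecayingPotential n m k V β) (φ : L2 n) :
    ∃ C : ℝ, 0 ≤ C ∧ ∀ x, ‖resonance m V φ x‖ ≤ C * (1 + ‖x‖) ^ (-((n : ℝ) - 2 * m)) := by
  have h2 := h.two_mul_lt_real
  have hd := h.dim_eq_real
  have hk := h.one_le_real
  have hβ := h.lt_decay
  set a : ℝ := n - 2 * m with ha
  have ha0 : 0 < a := by rw [ha]; linarith
  obtain ⟨Cv, hCv0, hCv⟩ := exists_bound_vFun h.bound
  obtain ⟨M, hM0, hM⟩ := exists_kernel_bound (n := n) (by have := h.two_mul_lt; omega)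
    (b := 2 * a) (r := β - 2 * a) (by linarith) (by linarith) (by linarith)
  have hfi := h.integrable_vMul φ
  set f := vMul V φ with hf
  have hφ2 : Integrable fun y => ‖φ y‖ ^ 2 :=
    (memLp_two_iff_integrable_sq_norm (Lp.aestronglyMeasurable φ)).1 (Lp.memLp φ)
  set G : Rn n → Rn n → ℝ := fun x y => ‖f y‖ +
    (Cv ^ 2 * (‖x - y‖ ^ (-(2 * a)) * (1 + ‖y‖) ^ (-(β - 2 * a))) + ‖φ y‖ ^ 2) with hG
  have hGi' : ∀ x, Integrable fun y =>
      Cv ^ 2 * (‖x - y‖ ^ (-(2 * a)) * (1 + ‖y‖) ^ (-(β - 2 * a))) + ‖φ y‖ ^ 2 := fun x =>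
    ((hM x).1.const_mul _).add hφ2
  have hGi : ∀ x, Integrable (G x) := fun x => hfi.norm.add (hGi' x)
  set B : ℝ := (∫ y, ‖f y‖) + (Cv ^ 2 * M + ∫ y, ‖φ y‖ ^ 2) with hB
  have hGB : ∀ x, ∫ y, G x y ≤ B := fun x => by
    have e : ∫ y, G x y = (∫ y, ‖f y‖) +
        (Cv ^ 2 * (∫ y, ‖x - y‖ ^ (-(2 * a)) * (1 + ‖y‖) ^ (-(β - 2 * a))) +
          ∫ y, ‖φ y‖ ^ 2) := by
      rw [← integral_const_mul, ← integral_add ((hM x).1.const_mul _) hφ2,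
        ← integral_add hfi.norm (hGi' x)]
    rw [e, hB]
    gcongr
    exact (hM x).2
  have hle : ∀ x y : Rn n, ‖x - y‖ ^ (-a) * ‖f y‖ ≤ 2 ^ a * (1 + ‖x‖) ^ (-a) * G x y := by
    intro x y
    have h0 := vFun_nonneg (V := V) y
    set t := (1 + ‖y‖) ^ a * ‖x - y‖ ^ (-a) with ht
    have ht0 : 0 ≤ t := by positivity
    have e1 : ‖f y‖ = vFun V y * ‖φ y‖ := by
      rw [hf, vMul, norm_mul, Complex.norm_real, Real.norm_of_nonneg h0]
    have e2 : (t * vFun V y) ^ 2 ≤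
        Cv ^ 2 * (‖x - y‖ ^ (-(2 * a)) * (1 + ‖y‖) ^ (-(β - 2 * a))) := by
      have e3 : t * vFun V y ≤ Cv * (‖x - y‖ ^ (-a) * (1 + ‖y‖) ^ (-(β / 2 - a))) := by
        calc t * vFun V y ≤ t * (Cv * (1 + ‖y‖) ^ (-(β / 2))) := by gcongr; exact hCv y
          _ = Cv * (‖x - y‖ ^ (-a) * ((1 + ‖y‖) ^ a * (1 + ‖y‖) ^ (-(β / 2)))) := by
            rw [ht]; ring
          _ = _ := by rw [← Real.rpow_add (by positivity)]; congr 3; ring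
      calc (t * vFun V y) ^ 2 ≤ (Cv * (‖x - y‖ ^ (-a) * (1 + ‖y‖) ^ (-(β / 2 - a)))) ^ 2 := by
            gcongr
        _ = Cv ^ 2 * ((‖x - y‖ ^ (-a)) ^ 2 * ((1 + ‖y‖) ^ (-(β / 2 - a))) ^ 2) := by ring
        _ = _ := by
          rw [← Real.rpow_natCast (‖x - y‖ ^ (-a)), ← Real.rpow_natCast (_ ^ (-(β / 2 - a))),
            ← Real.rpow_mul (by positivity), ← Real.rpow_mul (by positivity)]
          congr 3 <;> (push_cast; ring)
    have e4 : t * ‖f y‖ ≤ (t * vFun V y) ^ 2 + ‖φ y‖ ^ 2 := by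
      rw [e1]
      nlinarith [sq_nonneg (t * vFun V y - ‖φ y‖), sq_nonneg (t * vFun V y), sq_nonneg ‖φ y‖]
    calc ‖x - y‖ ^ (-a) * ‖f y‖ ≤ (2 ^ a * (1 + ‖x‖) ^ (-a) * (1 + t)) * ‖f y‖ := by
          gcongr
          exact norm_sub_rpow_neg_le ha0 x y
      _ = 2 ^ a * (1 + ‖x‖) ^ (-a) * (‖f y‖ + t * ‖f y‖) := by ring
      _ ≤ _ := by
        have := e4.trans (add_le_add_left e2 _)
        simp only [hG]
        gcongr
  refine ⟨|rieszConst n m| * (2 ^ a * B), ?_, fun x => ?_⟩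
  · have : 0 ≤ ∫ y, ‖f y‖ := integral_nonneg fun y => norm_nonneg _
    have : 0 ≤ ∫ y, ‖φ y‖ ^ 2 := integral_nonneg fun y => sq_nonneg _
    positivity
  · rw [resonance, norm_neg]
    refine (norm_rieszPotential_le _ x).trans ?_
    rw [mul_assoc]
    refine mul_le_mul_of_nonneg_left ?_ (abs_nonneg _)
    calc ∫ y, ‖x - y‖ ^ (-a) * ‖f y‖ ≤ ∫ y, 2 ^ a * (1 + ‖x‖) ^ (-a) * G x y := by
          refine integral_mono_of_nonneg (ae_of_all _ fun y => by positivity)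
            ((hGi x).const_mul _) (ae_of_all _ (hle x))
      _ = 2 ^ a * (1 + ‖x‖) ^ (-a) * ∫ y, G x y := integral_const_mul _ _
      _ ≤ 2 ^ a * (1 + ‖x‖) ^ (-a) * B := by gcongr; exact hGB x
      _ = _ := by ring

theorem DecayingPotential.aestronglyMeasurable_resonance (h : DecayingPotential n m k V β)
    (φ : L2 n) : AEStronglyMeasurable (resonance m V φ) volume :=
  (aestronglyMeasurable_rieszPotential (h.integrable_vMul φ).1).neg

theorem DecayingPotential.resonance_mem_W (h : DecayingPotential n m k V β) (φ : L2 n) :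
    resonance m V φ ∈ W n (2 * m - n / 2) := by
  obtain ⟨C, -, hC⟩ := h.exists_resonance_bound φ
  intro s hs
  exact mem_weightedL2_of_bound (h.aestronglyMeasurable_resonance φ) (ae_of_all _ hC)
    (by linarith)

/-! ### The first subspace -/

/-- Membership in `S_{j+1} L²` through the sesquilinear form of the operator on `S_j L²`. -/
theorem mem_SSpace_succ {j : ℕ} {φ : L2 n} :
    φ ∈ SSpace m V (j + 1) ↔ φ ∈ SSpace m V j ∧
      ∀ χ ∈ SSpace m V j, inner ℂ χ (expansionOp m V j φ) = 0 := by
  have e : φ ∈ SSpace m V (j + 1) ↔ φ ∈ SSpace m V j ∧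
      compress (SSpace m V j) (expansionOp m V j) φ = 0 := Iff.rfl
  rw [e]
  refine and_congr_right fun hφ => ?_
  have hφ' : φ ∈ (SSpace m V j).toSubmodule := hφ
  have e2 : compress (SSpace m V j) (expansionOp m V j) φ =
      (SSpace m V j).toSubmodule.starProjection (expansionOp m V j φ) := by
    rw [compress]
    simp only [ContinuousLinearMap.comp_apply]
    rw [Submodule.starProjection_eq_self_iff.2 hφ']
  rw [e2, Submodule.starProjection_apply_eq_zero_iff, Submodule.mem_orthogonal]
  rfl

theorem mem_SSpace_one {φ : L2 n} : φ ∈ SSpace m V 1 ↔ expansionOp m V 0 φ = 0 := by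
  rw [mem_SSpace_succ]
  constructor
  · rintro ⟨-, h⟩
    exact inner_self_eq_zero.1 (h _ trivial)
  · intro h
    exact ⟨trivial, fun χ _ => by rw [h, inner_zero_right]⟩

theorem DecayingPotential.mem_SSpace_one_iff (h : DecayingPotential n m k V β) {φ : L2 n} :
    φ ∈ SSpace m V 1 ↔ φ =ᵐ[volume] UvMul V (resonance m V φ) := by
  rw [mem_SSpace_one, Lp.eq_zero_iff_ae_eq_zero]
  have hact := h.actsAs (Nat.zero_le k) φ
  have key : ∀ x, formalOp m V 0 φ x =
      (uFun V x : ℂ) * (φ x - UvMul V (resonance m V φ) x) := fun x => by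
    have hu : (uFun V x : ℂ) * uFun V x = 1 := by exact_mod_cast uFun_mul_self x
    have e : formalOp m V 0 φ x =
      (uFun V x : ℂ) * φ x + (vFun V x : ℂ) * rieszPotential m (vMul V φ) x := rfl
    rw [e, UvMul, resonance]
    linear_combination (-(vFun V x : ℂ) * rieszPotential m (vMul V φ) x) * hu
  have hu0 : ∀ x, (uFun V x : ℂ) ≠ 0 := fun x => by
    rw [← norm_pos_iff, norm_uFun]; exact one_pos
  constructor
  · intro h0
    filter_upwards [h0, hact] with x h1 h2
    rw [h2, key] at h1
    have := (mul_eq_zero.1 h1).resolve_left (hu0 x)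
    exact sub_eq_zero.1 this
  · intro h0
    filter_upwards [h0, hact] with x h1 h2
    rw [h2, key, ← h1]
    simp

theorem vMul_UvMul {φ : L2 n} {ψ : Rn n → ℂ} (hφ : φ =ᵐ[volume] UvMul V ψ) :
    vMul V φ =ᵐ[volume] fun x => (V x : ℂ) * ψ x := by
  filter_upwards [hφ] with x hx
  rw [vMul, hx, UvMul, ← uFun_mul_vFun_sq (V := V) x]
  push_cast
  ring

theorem solvesZeroEnergy_iff (h : DecayingPotential n m k V β) {φ : L2 n} {ψ : Rn n → ℂ}
    (hψ : LocallyIntegrable ψ) (hφ : φ =ᵐ[volume] UvMul V ψ) :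
    SolvesZeroEnergy m V ψ ↔ ∀ η : Rn n → ℂ, ContDiff ℝ ∞ η → HasCompactSupport η →
      (∫ x, ψ x * polyLaplacian n m η x) + ∫ x, vMul V φ x * η x = 0 := by
  refine forall_congr' fun η => forall_congr' fun hη => forall_congr' fun hηc => ?_
  have h1 : Integrable fun x => ψ x * polyLaplacian n m η x :=
    hψ.integrable_smul_right_of_hasCompactSupport (contDiff_polyLaplacian m hη hηc).continuous
      (hasCompactSupport_polyLaplacian m hηc)
  have h2 : Integrable fun x => vMul V φ x * η x :=
    (h.integrable_vMul φ).locallyIntegrable.integrable_smul_right_of_hasCompactSupport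
      hη.continuous hηc
  rw [← integral_add h1 h2]
  refine Eq.congr_left (integral_congr_ae ?_)
  filter_upwards [vMul_UvMul hφ] with x hx
  rw [hx]
  ring

theorem locallyIntegrable_of_mem_W {σ : ℝ} {ψ : Rn n → ℂ} (hψ : ψ ∈ W n σ) :
    LocallyIntegrable ψ :=
  WeightedL2.locallyIntegrable (hψ (σ + 1) (by linarith))

theorem DecayingPotential.solves_resonance (h : DecayingPotential n m k V β) {φ : L2 n}
    (hφ : φ ∈ SSpace m V 1) : SolvesZeroEnergy m V (resonance m V φ) := by
  rw [solvesZeroEnergy_iff h (locallyIntegrable_of_mem_W (h.resonance_mem_W φ))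
    (h.mem_SSpace_one_iff.1 hφ)]
  intro η hη hηc
  have := integral_rieszPotential_mul_polyLaplacian h.one_le_m h.two_mul_lt
    (h.integrable_vMul φ) hη hηc
  simp only [resonance, neg_mul, integral_neg]
  rw [this]
  simp

theorem WeightedL2.sub {s : ℝ} {f g : Rn n → ℂ} (hf : f ∈ WeightedL2 n s)
    (hg : g ∈ WeightedL2 n s) : (fun x => f x - g x) ∈ WeightedL2 n s := by
  refine (MemLp.sub hf hg).ae_eq (ae_of_all _ fun x => ?_)
  simp only [Pi.sub_apply, mul_sub]

/-- Uniqueness: a solution in the resonance class is recovered from `φ = U v ψ` by `-G₀ v φ`. The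
difference of the two is polyharmonic, so the Liouville theorem applies. -/
theorem DecayingPotential.eq_resonance (h : DecayingPotential n m k V β) {φ : L2 n}
    {ψ : Rn n → ℂ} (hψ : ψ ∈ W n (2 * m - n / 2)) (hsol : SolvesZeroEnergy m V ψ)
    (hφ : φ =ᵐ[volume] UvMul V ψ) : ψ =ᵐ[volume] resonance m V φ := by
  have h2 := h.two_mul_lt_real
  have hψl := locallyIntegrable_of_mem_W hψ
  have hρl := locallyIntegrable_of_mem_W (h.resonance_mem_W φ)
  rw [solvesZeroEnergy_iff h hψl hφ] at hsol
  have hw := WeightedL2.sub (hψ m (by linarith)) (h.resonance_mem_W φ m (by linarith))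
  have key := ae_eq_zero_of_polyharmonic (n := n) (m := m) (s := m) (Nat.cast_nonneg m)
    (by linarith) hw fun η hη hηc => ?_
  · filter_upwards [key] with x hx
    exact sub_eq_zero.1 hx
  · have hc := (contDiff_polyLaplacian m hη hηc).continuous
    have hs := hasCompactSupport_polyLaplacian m hηc
    have h1 : Integrable fun x => ψ x * polyLaplacian n m η x :=
      hψl.integrable_smul_right_of_hasCompactSupport hc hs
    have h3 : Integrable fun x => resonance m V φ x * polyLaplacian n m η x :=
      hρl.integrable_smul_right_of_hasCompactSupport hc hs
    have h4 := integral_rieszPotential_mul_polyLaplacian h.one_le_m h.two_mul_lt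
      (h.integrable_vMul φ) hη hηc
    have h5 := hsol η hη hηc
    simp only [sub_mul]
    rw [integral_sub h1 h3]
    simp only [resonance, neg_mul, integral_neg]
    rw [h4, sub_neg_eq_add, h5]

theorem UvMul_congr {ψ ψ' : Rn n → ℂ} (h : ψ =ᵐ[volume] ψ') :
    UvMul V ψ =ᵐ[volume] UvMul V ψ' := by
  filter_upwards [h] with x hx
  rw [UvMul, UvMul, hx]

theorem DecayingPotential.mem_SSpace_one_of_solution (h : DecayingPotential n m k V β) {φ : L2 n}
    {ψ : Rn n → ℂ} (hψ : ψ ∈ W n (2 * m - n / 2)) (hsol : SolvesZeroEnergy m V ψ)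
    (hφ : φ =ᵐ[volume] UvMul V ψ) : φ ∈ SSpace m V 1 :=
  h.mem_SSpace_one_iff.2 (hφ.trans (UvMul_congr (h.eq_resonance hψ hsol hφ)))

theorem resonance_zero {φ : L2 n} (hφ : φ = 0) (x : Rn n) : resonance m V φ x = 0 := by
  have h0 : (φ : Rn n → ℂ) =ᵐ[volume] 0 := by rw [hφ]; exact Lp.coeFn_zero _ _ _
  rw [resonance, rieszPotential, neg_eq_zero]
  refine integral_eq_zero_of_ae ?_
  filter_upwards [h0] with y hy
  simp [vMul, hy]

theorem DecayingPotential.ne_zero_of_solution (h : DecayingPotential n m k V β) {φ : L2 n}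
    {ψ : Rn n → ℂ} (hψ0 : ¬ ψ =ᵐ[volume] 0) (hψ : ψ ∈ W n (2 * m - n / 2))
    (hsol : SolvesZeroEnergy m V ψ) (hφ : φ =ᵐ[volume] UvMul V ψ) : φ ≠ 0 := fun h0 =>
  hψ0 ((h.eq_resonance hψ hsol hφ).trans (ae_of_all _ (resonance_zero h0)))

theorem resonance_ne_zero {φ : L2 n} (hφ0 : φ ≠ 0) (hφ : φ =ᵐ[volume] UvMul V (resonance m V φ)) :
    ¬ resonance m V φ =ᵐ[volume] 0 := fun h0 => by
  refine hφ0 ((Lp.eq_zero_iff_ae_eq_zero).2 (hφ.trans ?_))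
  filter_upwards [h0] with x hx
  simp [UvMul, hx]

end Resonance

/-! ### Moments -/

section Moments

variable {n m k : ℕ} {V : Rn n → ℝ} {β : ℝ}

/-- The moments of `v φ` of order at most `d` vanish. -/
def VanishingMoments (V : Rn n → ℝ) (φ : L2 n) (d : ℕ) : Prop :=
  ∀ p : MvPolynomial (Fin n) ℂ, p.totalDegree ≤ d →
    ∫ y, MvPolynomial.eval (fun i => ((y i : ℝ) : ℂ)) p * ((vFun V y : ℂ) * φ y) = 0

theorem VanishingMoments.mono {φ : L2 n} {d d' : ℕ} (h : VanishingMoments V φ d') (hd : d ≤ d') :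
    VanishingMoments V φ d := fun p hp => h p (hp.trans hd)

theorem exists_norm_eval_le {d : ℕ} {p : MvPolynomial (Fin n) ℂ} (hp : p.totalDegree ≤ d) :
    ∃ C : ℝ, 0 ≤ C ∧ ∀ y : Rn n,
      ‖MvPolynomial.eval (fun i => ((y i : ℝ) : ℂ)) p‖ ≤ C * (1 + ‖y‖) ^ d := by
  refine ⟨∑ s ∈ p.support, ‖p.coeff s‖, Finset.sum_nonneg fun s _ => norm_nonneg _, fun y => ?_⟩
  rw [MvPolynomial.eval_eq', Finset.sum_mul]
  refine (norm_sum_le _ _).trans (Finset.sum_le_sum fun s hs => ?_)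
  rw [norm_mul]
  refine mul_le_mul_of_nonneg_left ?_ (norm_nonneg _)
  have hy : (1 : ℝ) ≤ 1 + ‖y‖ := by linarith [norm_nonneg y]
  calc ‖∏ i, ((y i : ℝ) : ℂ) ^ s i‖ = ∏ i, ‖y i‖ ^ s i := by
        rw [norm_prod]; simp
    _ ≤ ∏ i, (1 + ‖y‖) ^ s i := by
        refine Finset.prod_le_prod (fun i _ => by positivity) fun i _ => ?_
        gcongr
        linarith [PiLp.norm_apply_le y i]
    _ = (1 + ‖y‖) ^ ∑ i, s i := Finset.prod_pow_eq_pow_sum _ _ _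
    _ ≤ (1 + ‖y‖) ^ d := by
        refine pow_le_pow_right₀ hy (le_trans ?_ hp)
        have := MvPolynomial.le_totalDegree hs
        rwa [Finsupp.sum_fintype _ _ (fun _ => rfl)] at this

theorem continuous_eval (p : MvPolynomial (Fin n) ℂ) :
    Continuous fun y : Rn n => MvPolynomial.eval (fun i => ((y i : ℝ) : ℂ)) p := by
  have h1 : Continuous fun y : Rn n => (fun i => ((y i : ℝ) : ℂ) : Fin n → ℂ) := by fun_prop
  exact (MvPolynomial.continuous_eval p).comp h1

theorem DecayingPotential.integrable_eval_mul (h : DecayingPotential n m k V β) {d : ℕ}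
    (hd : d ≤ 2 * k) {p : MvPolynomial (Fin n) ℂ} (hp : p.totalDegree ≤ d) (φ : L2 n) :
    Integrable fun y => MvPolynomial.eval (fun i => ((y i : ℝ) : ℂ)) p * vMul V φ y := by
  obtain ⟨C, hC0, hC⟩ := exists_norm_eval_le hp
  have hd' : ((d : ℕ) : ℝ) ≤ 2 * k := by exact_mod_cast hd
  refine ((h.integrable_weight_vMul hd' φ).norm.const_mul C).mono'
    ((continuous_eval p).aestronglyMeasurable.mul (h.integrable_vMul φ).1)
    (ae_of_all _ fun y => ?_)
  rw [norm_mul, norm_mul, ← mul_assoc, Complex.norm_real, Real.norm_of_nonneg (by positivity),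
    Real.rpow_natCast]
  exact mul_le_mul_of_nonneg_right (hC y) (norm_nonneg _)

/-- The polynomial `|X|^{2a} X_{I 1} ⋯ X_{I b}`. -/
noncomputable def radialMonomial (a : ℕ) {b : ℕ} (I : Fin b → Fin n) : MvPolynomial (Fin n) ℂ :=
  (∑ i, MvPolynomial.X i ^ 2) ^ a * ∏ l, MvPolynomial.X (I l)

theorem totalDegree_radialMonomial (a : ℕ) {b : ℕ} (I : Fin b → Fin n) :
    (radialMonomial a I).totalDegree ≤ 2 * a + b := by
  refine (MvPolynomial.totalDegree_mul _ _).trans (add_le_add ?_ ?_)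
  · refine (MvPolynomial.totalDegree_pow _ _).trans ?_
    rw [mul_comm 2 a]
    refine Nat.mul_le_mul_left a ?_
    refine MvPolynomial.totalDegree_finsetSum_le fun i _ => ?_
    rw [MvPolynomial.totalDegree_X_pow]
  · refine (MvPolynomial.totalDegree_finsetProd _ _).trans ?_
    simp [MvPolynomial.totalDegree_X]

theorem eval_radialMonomial (a : ℕ) {b : ℕ} (I : Fin b → Fin n) (y : Rn n) :
    MvPolynomial.eval (fun i => ((y i : ℝ) : ℂ)) (radialMonomial a I) =
      (((‖y‖ ^ 2) ^ a * ∏ l, y (I l) : ℝ) : ℂ) := by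
  simp [radialMonomial, EuclideanSpace.real_norm_sq_eq]

/-- The index set of the expansion of `|x - y|^{2r}`. -/
def expansionIndex (n r : ℕ) : Finset (Σ b : ℕ, ℕ × (Fin b → Fin n)) :=
  (Finset.range (r + 1)).sigma fun b => Finset.range (r - b + 1) ×ˢ Finset.univ

/-- The coefficients of the expansion of `|x - y|^{2r}`. -/
def expansionCoeff (r : ℕ) (t : Σ b : ℕ, ℕ × (Fin b → Fin n)) : ℝ :=
  r.choose t.1 * (r - t.1).choose t.2.1 * (-2) ^ t.1

/-- Multinomial expansion of `|x - y|^{2r} = (|x|² - 2 x·y + |y|²)^r`. -/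
theorem norm_sub_pow_expansion (r : ℕ) (x y : Rn n) :
    ‖x - y‖ ^ (2 * r) = ∑ t ∈ expansionIndex n r, expansionCoeff r t *
      (((‖x‖ ^ 2) ^ t.2.1 * ∏ l, x (t.2.2 l)) *
        ((‖y‖ ^ 2) ^ (r - t.1 - t.2.1) * ∏ l, y (t.2.2 l))) := by
  have hin : inner ℝ x y = ∑ i, x i * y i := by
    simp [PiLp.inner_apply, mul_comm]
  rw [expansionIndex, Finset.sum_sigma, pow_mul, norm_sub_sq_real,
    show ‖x‖ ^ 2 - 2 * inner ℝ x y + ‖y‖ ^ 2 = -2 * inner ℝ x y + (‖x‖ ^ 2 + ‖y‖ ^ 2) by ring,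
    add_pow]
  refine Finset.sum_congr rfl fun b _ => ?_
  rw [Finset.sum_product, add_pow, mul_pow, hin, Fintype.sum_pow, Finset.mul_sum, Finset.sum_mul]
  refine Finset.sum_congr rfl fun a _ => ?_
  rw [Finset.mul_sum, Finset.sum_mul, Finset.sum_mul]
  refine Finset.sum_congr rfl fun I _ => ?_
  simp only [expansionCoeff, Finset.prod_mul_distrib]
  ring

/-- The moments of `v φ` against the polynomials `|X|^{2a} X_I`. -/
noncomputable def radialMoment (V : Rn n → ℝ) (φ : L2 n) (a : ℕ) {b : ℕ} (I : Fin b → Fin n) : ℂ :=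
  ∫ y, (((‖y‖ ^ 2) ^ a * ∏ l, y (I l) : ℝ) : ℂ) * vMul V φ y

theorem VanishingMoments.radialMoment_eq_zero {φ : L2 n} {d : ℕ} (h : VanishingMoments V φ d)
    {a b : ℕ} (I : Fin b → Fin n) (hd : 2 * a + b ≤ d) : radialMoment V φ a I = 0 := by
  have := h (radialMonomial a I) ((totalDegree_radialMonomial a I).trans hd)
  simp only [eval_radialMonomial] at this
  exact this

theorem DecayingPotential.integrable_radial (h : DecayingPotential n m k V β) (φ : L2 n)
    {a b : ℕ} (I : Fin b → Fin n) (hd : 2 * a + b ≤ 2 * k) :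
    Integrable fun y => (((‖y‖ ^ 2) ^ a * ∏ l, y (I l) : ℝ) : ℂ) * vMul V φ y := by
  have := h.integrable_eval_mul hd (totalDegree_radialMonomial a I) φ
  simpa only [eval_radialMonomial] using this

theorem mem_expansionIndex {r : ℕ} {t : Σ b : ℕ, ℕ × (Fin b → Fin n)} :
    t ∈ expansionIndex n r ↔ t.1 + t.2.1 ≤ r := by
  simp only [expansionIndex, Finset.mem_sigma, Finset.mem_product, Finset.mem_range,
    Finset.mem_univ, and_true]
  omega

/-- The quadratic form of `v G v`, `G` with kernel `|x - y|^{2r}`, in terms of moments. -/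
theorem DecayingPotential.inner_expansionOp (h : DecayingPotential n m k V β) {i : ℕ}
    (hi : i + 2 ≤ k) (χ φ : L2 n) :
    inner ℂ χ (expansionOp m V (i + 2) φ) =
      ∑ t ∈ expansionIndex n (i + 1), (expansionCoeff (i + 1) t : ℂ) *
        (conj (radialMoment V χ t.2.1 t.2.2) *
          radialMoment V φ (i + 1 - t.1 - t.2.1) t.2.2) := by
  have hq : ∀ x : Rn n, ∫ y, ((‖x - y‖ ^ (2 * (i + 1)) : ℝ) : ℂ) * vMul V φ y =
      ∑ t ∈ expansionIndex n (i + 1), (expansionCoeff (i + 1) t : ℂ) *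
        ((((‖x‖ ^ 2) ^ t.2.1 * ∏ l, x (t.2.2 l) : ℝ) : ℂ) *
          radialMoment V φ (i + 1 - t.1 - t.2.1) t.2.2) := by
    intro x
    have e : ∀ y : Rn n, ((‖x - y‖ ^ (2 * (i + 1)) : ℝ) : ℂ) * vMul V φ y =
        ∑ t ∈ expansionIndex n (i + 1), ((expansionCoeff (i + 1) t : ℂ) *
          (((‖x‖ ^ 2) ^ t.2.1 * ∏ l, x (t.2.2 l) : ℝ) : ℂ)) *
          ((((‖y‖ ^ 2) ^ (i + 1 - t.1 - t.2.1) * ∏ l, y (t.2.2 l) : ℝ) : ℂ) * vMul V φ y) := by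
      intro y
      rw [norm_sub_pow_expansion, Complex.ofReal_sum, Finset.sum_mul]
      refine Finset.sum_congr rfl fun t _ => ?_
      push_cast
      ring
    simp only [e]
    rw [integral_finsetSum]
    · refine Finset.sum_congr rfl fun t _ => ?_
      rw [integral_const_mul, radialMoment, mul_assoc]
    · intro t ht
      have ht' := mem_expansionIndex.1 ht
      exact (h.integrable_radial φ t.2.2 (by omega)).const_mul _
  have e1 : inner ℂ χ (expansionOp m V (i + 2) φ) = ∫ x, conj (vMul V χ x) *
      ∫ y, ((‖x - y‖ ^ (2 * (i + 1)) : ℝ) : ℂ) * vMul V φ y := by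
    rw [L2.inner_def]
    refine integral_congr_ae ?_
    filter_upwards [h.actsAs hi φ] with x hx
    have e : formalOp m V (i + 2) φ x = (vFun V x : ℂ) *
      ∫ y, ((‖x - y‖ ^ (2 * (i + 1)) : ℝ) : ℂ) * vMul V φ y := rfl
    rw [hx, e, RCLike.inner_apply, vMul, map_mul, Complex.conj_ofReal]
    ring
  have e2 : ∀ t : Σ b : ℕ, ℕ × (Fin b → Fin n), (fun x => conj (vMul V χ x) *
      ((expansionCoeff (i + 1) t : ℂ) * ((((‖x‖ ^ 2) ^ t.2.1 * ∏ l, x (t.2.2 l) : ℝ) : ℂ) *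
          radialMoment V φ (i + 1 - t.1 - t.2.1) t.2.2))) =
      fun x => ((expansionCoeff (i + 1) t : ℂ) *
        radialMoment V φ (i + 1 - t.1 - t.2.1) t.2.2) *
        conj ((((‖x‖ ^ 2) ^ t.2.1 * ∏ l, x (t.2.2 l) : ℝ) : ℂ) * vMul V χ x) := by
    intro t
    ext x
    rw [map_mul, Complex.conj_ofReal]
    ring
  have hi2 : ∀ t ∈ expansionIndex n (i + 1), Integrable fun x =>
      ((((‖x‖ ^ 2) ^ t.2.1 * ∏ l, x (t.2.2 l) : ℝ) : ℂ) * vMul V χ x) := fun t ht => by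
    have ht' := mem_expansionIndex.1 ht
    exact h.integrable_radial χ t.2.2 (by omega)
  rw [e1]
  simp only [hq, Finset.mul_sum]
  rw [integral_finsetSum]
  · refine Finset.sum_congr rfl fun t _ => ?_
    rw [e2, integral_const_mul, integral_conj]
    simp only [radialMoment]
    ring
  · intro t ht
    rw [e2]
    exact (Complex.conjCLE.toContinuousLinearMap.integrable_comp (hi2 t ht)).const_mul _

/-- A monomial is a product of variables. -/
theorem exists_monomial_eq_radialMonomial (s : Fin n →₀ ℕ) :
    ∃ I : Fin (∑ i, s i) → Fin n, MvPolynomial.monomial s (1 : ℂ) = radialMonomial 0 I := by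
  have key : ∀ (d : ℕ) (s : Fin n →₀ ℕ), ∑ i, s i = d →
      ∃ I : Fin d → Fin n, MvPolynomial.monomial s (1 : ℂ) = ∏ l, MvPolynomial.X (I l) := by
    intro d
    induction d with
    | zero =>
      intro s hs
      have : s = 0 := by
        ext i
        simpa using (Finset.sum_eq_zero_iff.1 hs) i (Finset.mem_univ i)
      exact ⟨Fin.elim0, by simp [this]⟩
    | succ d ih =>
      intro s hs
      obtain ⟨i, hi⟩ : ∃ i, s i ≠ 0 := by
        by_contra hcon
        push Not at hcon
        simp [hcon] at hs
      have hle : Finsupp.single i 1 ≤ s := by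
        rw [Finsupp.single_le_iff]; omega
      obtain ⟨u, rfl⟩ := exists_add_of_le hle
      have hu : ∑ j, u j = d := by
        simp only [Finsupp.add_apply, Finset.sum_add_distrib, Finsupp.single_apply] at hs
        simp at hs
        omega
      obtain ⟨I, hI⟩ := ih u hu
      refine ⟨Fin.cons i I, ?_⟩
      rw [Fin.prod_univ_succ]
      simp only [Fin.cons_zero, Fin.cons_succ]
      rw [← hI, MvPolynomial.X, MvPolynomial.monomial_mul, one_mul]
  obtain ⟨I, hI⟩ := key _ s rfl
  exact ⟨I, by rw [hI, radialMonomial, pow_zero, one_mul]⟩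

theorem DecayingPotential.vanishingMoments_of_monomials (h : DecayingPotential n m k V β)
    {φ : L2 n} {d : ℕ} (hd : d ≤ 2 * k)
    (hmon : ∀ b ≤ d, ∀ I : Fin b → Fin n, radialMoment V φ 0 I = 0) :
    VanishingMoments V φ d := by
  intro p hp
  have hdeg : ∀ s ∈ p.support, ∑ i, s i ≤ d := fun s hs => by
    have := MvPolynomial.le_totalDegree hs
    rw [Finsupp.sum_fintype _ _ (fun _ => rfl)] at this
    exact this.trans hp
  have e : ∀ y : Rn n, MvPolynomial.eval (fun i => ((y i : ℝ) : ℂ)) p * vMul V φ y =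
      ∑ s ∈ p.support, p.coeff s *
        (MvPolynomial.eval (fun i => ((y i : ℝ) : ℂ)) (MvPolynomial.monomial s 1) *
          vMul V φ y) := by
    intro y
    conv_lhs => rw [p.as_sum]
    rw [map_sum, Finset.sum_mul]
    refine Finset.sum_congr rfl fun s _ => ?_
    rw [MvPolynomial.eval_monomial, MvPolynomial.eval_monomial]
    ring
  change ∫ y, MvPolynomial.eval (fun i => ((y i : ℝ) : ℂ)) p * vMul V φ y = 0
  simp only [e]
  rw [integral_finsetSum]
  · refine Finset.sum_eq_zero fun s hs => ?_
    obtain ⟨I, hI⟩ := exists_monomial_eq_radialMonomial s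
    rw [integral_const_mul, hI]
    simp only [eval_radialMonomial]
    have := hmon _ (hdeg s hs) I
    rw [radialMoment] at this
    rw [this, mul_zero]
  · intro s hs
    obtain ⟨I, hI⟩ := exists_monomial_eq_radialMonomial s
    rw [hI]
    refine (h.integrable_eval_mul (d := ∑ i, s i) ((hdeg s hs).trans hd) ?_ φ).const_mul _
    simpa using totalDegree_radialMonomial 0 I

/-- One step of the induction: on functions whose moments of order at most `r - 1` vanish, the form
of `v G v` is, up to the sign `(-1)^r`, a sum of squares of the moments of order `r`. -/
theorem DecayingPotential.vanishingMoments_of_inner_eq_zero (h : DecayingPotential n m k V β)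
    {i : ℕ} (hi : i + 2 ≤ k) {φ : L2 n} (hφ : VanishingMoments V φ i)
    (h0 : inner ℂ φ (expansionOp m V (i + 2) φ) = 0) : VanishingMoments V φ (i + 1) := by
  rw [h.inner_expansionOp hi] at h0
  set τ : (Σ b : ℕ, ℕ × (Fin b → Fin n)) → ℝ := fun t =>
    if 2 * t.2.1 + t.1 = i + 1 then (i + 1).choose t.1 * (i + 1 - t.1).choose t.2.1 * 2 ^ t.1 *
      ‖radialMoment V φ t.2.1 t.2.2‖ ^ 2 else 0 with hτ
  have hτ0 : ∀ t, 0 ≤ τ t := fun t => by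
    simp only [hτ]; split_ifs <;> positivity
  have hterm : ∀ t ∈ expansionIndex n (i + 1), (expansionCoeff (i + 1) t : ℂ) *
        (conj (radialMoment V φ t.2.1 t.2.2) *
          radialMoment V φ (i + 1 - t.1 - t.2.1) t.2.2) = (-1) ^ (i + 1) * (τ t : ℂ) := by
    intro t ht
    have ht' := mem_expansionIndex.1 ht
    simp only [hτ]
    split_ifs with hd
    · have e : i + 1 - t.1 - t.2.1 = t.2.1 := by omega
      rw [e, ← Complex.normSq_eq_conj_mul_self, Complex.normSq_eq_norm_sq, expansionCoeff]
      have e2 : (-1 : ℂ) ^ (i + 1) = (-1) ^ t.1 := by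
        rw [← hd, pow_add, pow_mul]; simp
      rw [e2, neg_pow (2 : ℝ)]
      push_cast
      ring
    · rcases lt_or_gt_of_ne hd with hlt | hgt
      · rw [hφ.radialMoment_eq_zero t.2.2 (by omega)]; simp
      · rw [hφ.radialMoment_eq_zero (a := i + 1 - t.1 - t.2.1) t.2.2 (by omega)]; simp
  rw [Finset.sum_congr rfl hterm, ← Finset.mul_sum, ← Complex.ofReal_sum] at h0
  have hsum : ∑ t ∈ expansionIndex n (i + 1), τ t = 0 := by
    have := (mul_eq_zero.1 h0).resolve_left (pow_ne_zero _ (by norm_num))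
    exact_mod_cast this
  rw [Finset.sum_eq_zero_iff_of_nonneg fun t _ => hτ0 t] at hsum
  have hk := h.one_le
  refine h.vanishingMoments_of_monomials (by omega) fun b hb I => ?_
  rcases Nat.lt_or_ge i b with hib | hib
  · obtain rfl : b = i + 1 := by omega
    have := hsum ⟨i + 1, 0, I⟩ (mem_expansionIndex.2 (by simp))
    simpa [hτ] using this
  · exact hφ.radialMoment_eq_zero I (by omega)

theorem DecayingPotential.inner_eq_zero_of_vanishingMoments (h : DecayingPotential n m k V β)
    {i : ℕ} (hi : i + 2 ≤ k) {χ φ : L2 n} (hχ : VanishingMoments V χ i)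
    (hφ : VanishingMoments V φ (i + 1)) :
    inner ℂ χ (expansionOp m V (i + 2) φ) = 0 := by
  rw [h.inner_expansionOp hi]
  refine Finset.sum_eq_zero fun t ht => ?_
  have ht' := mem_expansionIndex.1 ht
  rcases Nat.lt_or_ge (2 * t.2.1 + t.1) (i + 1) with hlt | hge
  · rw [hχ.radialMoment_eq_zero t.2.2 (by omega)]; simp
  · rw [hφ.radialMoment_eq_zero (a := i + 1 - t.1 - t.2.1) t.2.2 (by omega)]; simp

theorem DecayingPotential.inner_projection (h : DecayingPotential n m k V β) (χ φ : L2 n) :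
    inner ℂ χ (expansionOp m V 1 φ) = (((∫ y, vFun V y ^ 2)⁻¹ : ℝ) : ℂ) *
      (conj (∫ y, vMul V χ y) * ∫ y, vMul V φ y) := by
  rw [L2.inner_def, ← integral_conj, ← integral_mul_const, ← integral_const_mul]
  refine integral_congr_ae ?_
  filter_upwards [h.actsAs h.one_le φ] with x hx
  have e : formalOp m V 1 φ x = (((∫ y, vFun V y ^ 2)⁻¹ : ℝ) : ℂ) * (vFun V x : ℂ) *
    ∫ y, vMul V φ y := rfl
  rw [hx, e, RCLike.inner_apply]
  simp only [vMul, map_mul, Complex.conj_ofReal]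
  ring

theorem DecayingPotential.integral_vMul_eq_zero_of_inner (h : DecayingPotential n m k V β)
    {φ : L2 n} (h0 : inner ℂ φ (expansionOp m V 1 φ) = 0) : ∫ y, vMul V φ y = 0 := by
  rw [h.inner_projection] at h0
  rcases mul_eq_zero.1 h0 with h1 | h1
  · have h2 : ∫ y, vFun V y ^ 2 = 0 := by
      have : (∫ y, vFun V y ^ 2)⁻¹ = 0 := by exact_mod_cast h1
      exact inv_eq_zero.1 this
    have hi : Integrable fun y => vFun V y ^ 2 := by
      have := (h.memLp_weight (d := 0) (by have := h.one_le_real; linarith)).integrable_sq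
      simpa using this
    rw [integral_eq_zero_iff_of_nonneg (fun y => sq_nonneg _) hi] at h2
    refine integral_eq_zero_of_ae ?_
    filter_upwards [h2] with y hy
    have : vFun V y = 0 := by simpa using hy
    simp [vMul, this]
  · rcases mul_eq_zero.1 h1 with h2 | h2
    · simpa using h2
    · exact h2

/-- The spaces `S_{r+2} L²` are cut out of `S_1 L²` by the vanishing of moments. -/
theorem DecayingPotential.mem_SSpace_iff_moments (h : DecayingPotential n m k V β) {r : ℕ}
    (hr : r + 1 ≤ k) (φ : L2 n) :
    φ ∈ SSpace m V (r + 2) ↔ φ ∈ SSpace m V 1 ∧ VanishingMoments V φ r := by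
  induction r generalizing φ with
  | zero =>
    rw [mem_SSpace_succ]
    refine and_congr_right fun hφ => ⟨fun h0 => ?_, fun h0 χ _ => ?_⟩
    · have h1 := h.integral_vMul_eq_zero_of_inner (h0 φ hφ)
      intro p hp
      rw [MvPolynomial.totalDegree_eq_zero_iff_eq_C.1 (Nat.le_zero.1 hp)]
      simp only [MvPolynomial.eval_C]
      rw [integral_const_mul]
      simp only [vMul] at h1
      rw [h1, mul_zero]
    · have h1 := h0 1 (by simp)
      simp only [map_one, one_mul] at h1
      rw [h.inner_projection]
      simp only [vMul]
      rw [h1, mul_zero, mul_zero]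
  | succ r ih =>
    have ih' := fun φ => ih (by omega) φ
    rw [mem_SSpace_succ]
    constructor
    · rintro ⟨h1, h2⟩
      have h3 := (ih' φ).1 h1
      exact ⟨h3.1, h.vanishingMoments_of_inner_eq_zero (by omega) h3.2 (h2 φ h1)⟩
    · rintro ⟨h1, h2⟩
      refine ⟨(ih' φ).2 ⟨h1, h2.mono (Nat.le_succ r)⟩, fun χ hχ => ?_⟩
      exact h.inner_eq_zero_of_vanishingMoments (by omega) ((ih' χ).1 hχ).2 h2

end Moments

/-! ### Decay forces moments to vanish -/

section Scaling

variable {n : ℕ}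

theorem laplacian_const_smul_comp_smul {f : Rn n → ℂ} (hf : ContDiff ℝ ∞ f) (a c : ℝ) (x : Rn n) :
    Laplacian.laplacian (fun x => a • f (c • x)) x =
      (a * c ^ 2) • Laplacian.laplacian f (c • x) := by
  have hf2 : ContDiff ℝ 2 f := hf.of_le (WithTop.coe_le_coe.2 le_top)
  have hc : ContDiff ℝ 2 fun x => f (c • x) := hf2.comp (contDiff_const_smul c)
  have e := InnerProductSpace.laplacian_smul a (hc.contDiffAt (x := x))
  have e' : (a • fun x => f (c • x)) = fun x => a • f (c • x) := rfl
  rw [e'] at e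
  rw [e, mul_smul]
  congr 1
  simp only [InnerProductSpace.laplacian_eq_iteratedFDeriv_orthonormalBasis _
    (EuclideanSpace.basisFun (Fin n) ℝ)]
  rw [iteratedFDeriv_comp_const_smul c (i := 2) hf2, Finset.smul_sum]
  rfl

theorem polyLaplacian_comp_smul (m : ℕ) {f : Rn n → ℂ} (hf : ContDiff ℝ ∞ f)
    (hc : HasCompactSupport f) (c : ℝ) :
    polyLaplacian n m (fun x => f (c • x)) =
      fun x => (c ^ (2 * m)) • polyLaplacian n m f (c • x) := by
  induction m with
  | zero => simp [polyLaplacian]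
  | succ m ih =>
    simp only [polyLaplacian, Function.iterate_succ_apply'] at ih ⊢
    rw [ih]
    ext x
    simp only [Pi.neg_apply]
    have := laplacian_const_smul_comp_smul (contDiff_polyLaplacian m hf hc) (c ^ (2 * m)) c x
    rw [polyLaplacian] at this
    rw [this, smul_neg, mul_add, pow_add, mul_one]

end Scaling

section Moments

variable {n m k : ℕ} {V : Rn n → ℝ} {β : ℝ}

/-- Testing the equation with a monomial cut off at scale `R` shows that a solution in `L²_{-s}`
gives vanishing moments of every order `b < 2m - n/2 - s`: the term with `(-Δ)^m` is
`O(R^{b - 2m + s + n/2})`. -/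
theorem DecayingPotential.radialMoment_eq_zero_of_mem_weightedL2
    (h : DecayingPotential n m k V β) {φ : L2 n} {ψ : Rn n → ℂ}
    (hsol : SolvesZeroEnergy m V ψ) (hφ : φ =ᵐ[volume] UvMul V ψ) {s : ℝ} (hs : 0 ≤ s)
    (hψ : ψ ∈ WeightedL2 n (-s)) {b : ℕ} (hb : b + s < 2 * m - n / 2) (I : Fin b → Fin n) :
    radialMoment V φ 0 I = 0 := by
  have hdim := h.dim_eq_real
  have hb2 : 2 * 0 + b ≤ 2 * k := by
    have : (b : ℝ) ≤ 2 * k := by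
      have := h.one_le_real
      linarith
    simpa using (by exact_mod_cast this : b ≤ 2 * k)
  have hψl := WeightedL2.locallyIntegrable hψ
  obtain ⟨C, hC0, hC⟩ := exists_setIntegral_norm_le hs hψ
  rw [solvesZeroEnergy_iff h hψl hφ] at hsol
  let θ : ContDiffBump (0 : Rn n) := ⟨1, 2, one_pos, one_lt_two⟩
  set mono : Rn n → ℝ := fun x => ∏ l, x (I l) with hmono
  set η : Rn n → ℂ := fun x => ((θ x * mono x : ℝ) : ℂ) with hη
  have hmonoC : ContDiff ℝ ∞ mono := contDiff_prod fun l _ => by fun_prop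
  have hηC : ContDiff ℝ ∞ η :=
    Complex.ofRealCLM.contDiff.comp (θ.contDiff.mul hmonoC)
  have hηc : HasCompactSupport η := by
    refine θ.hasCompactSupport.mono fun x hx => ?_
    simp only [hη, Function.mem_support] at hx ⊢
    intro h0
    exact hx (by rw [h0]; simp)
  set g := polyLaplacian n m η with hg
  have hgC : Continuous g := (contDiff_polyLaplacian m hηC hηc).continuous
  have hgc : HasCompactSupport g := hasCompactSupport_polyLaplacian m hηc
  obtain ⟨B, hB⟩ := hgC.bounded_above_of_compact_support hgc
  have hB0 : 0 ≤ B := (norm_nonneg _).trans (hB 0)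
  obtain ⟨ρ, hρ1, hρ⟩ : ∃ ρ : ℝ, 1 ≤ ρ ∧ ∀ x, ρ < ‖x‖ → g x = 0 := by
    obtain ⟨ρ, hρ⟩ := hgc.isCompact.isBounded.subset_closedBall (0 : Rn n)
    refine ⟨max ρ 1, le_max_right _ _, fun x hx => ?_⟩
    refine image_eq_zero_of_notMem_tsupport fun hx' => ?_
    have := hρ hx'
    rw [mem_closedBall_zero_iff] at this
    exact absurd hx (not_lt.2 (this.trans (le_max_left _ _)))
  set G : ℝ → ℂ := fun R => ∫ y, (θ (R⁻¹ • y) : ℂ) *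
    ((((‖y‖ ^ 2) ^ 0 * ∏ l, y (I l) : ℝ) : ℂ) * vMul V φ y) with hG
  have hint := h.integrable_radial φ I hb2
  have hlim : Tendsto G atTop (𝓝 (radialMoment V φ 0 I)) := by
    refine tendsto_integral_filter_of_dominated_convergence _ (Eventually.of_forall fun R => ?_)
      (Eventually.of_forall fun R => ae_of_all _ fun y => ?_) hint.norm (ae_of_all _ fun y => ?_)
    · refine AEStronglyMeasurable.mul (Continuous.aestronglyMeasurable ?_) hint.1
      exact Complex.continuous_ofReal.comp (θ.continuous.comp (continuous_const_smul _))
    · rw [norm_mul, Complex.norm_real, Real.norm_of_nonneg θ.nonneg]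
      exact mul_le_of_le_one_left (norm_nonneg _) θ.le_one
    · refine tendsto_const_nhds.congr' ?_
      filter_upwards [eventually_ge_atTop (max 1 ‖y‖)] with R hR
      have hR0 : 0 < R := lt_of_lt_of_le one_pos ((le_max_left _ _).trans hR)
      rw [θ.one_of_mem_closedBall, Complex.ofReal_one, one_mul]
      rw [mem_closedBall_zero_iff, norm_smul, norm_inv, Real.norm_of_nonneg hR0.le,
        inv_mul_le_iff₀ hR0]
      simpa [θ] using (le_max_right _ _).trans hR
  set e : ℝ := b - 2 * m + (s + n / 2) with he
  have he0 : e < 0 := by rw [he]; linarith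
  have hbound : ∀ R : ℝ, 1 ≤ R → ‖G R‖ ≤ (B * C * ρ ^ (s + (n : ℝ) / 2)) * R ^ e := by
    intro R hR
    have hR0 : 0 < R := one_pos.trans_le hR
    have ht := hsol (fun x => η (R⁻¹ • x)) (hηC.comp (contDiff_const_smul _))
      (hηc.comp_smul (inv_ne_zero hR0.ne'))
    rw [polyLaplacian_comp_smul m hηC hηc, ← hg] at ht
    have e1 : G R = (R : ℂ) ^ b * ∫ x, vMul V φ x * η (R⁻¹ • x) := by
      rw [← integral_const_mul]
      refine integral_congr_ae (ae_of_all _ fun y => ?_)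
      simp only [hη, hmono, PiLp.smul_apply, smul_eq_mul, Finset.prod_mul_distrib,
        Finset.prod_const, Finset.card_univ, Fintype.card_fin]
      have : (R : ℂ) ^ b * ((R : ℂ)⁻¹) ^ b = 1 := by
        rw [← mul_pow, mul_inv_cancel₀ (by exact_mod_cast hR0.ne'), one_pow]
      push_cast
      linear_combination (-(θ (R⁻¹ • y) : ℂ) * (∏ l, (y (I l) : ℂ)) * vMul V φ y) * this
    have e2 : ‖∫ x, ψ x * (R⁻¹ ^ (2 * m)) • g (R⁻¹ • x)‖ ≤
        R⁻¹ ^ (2 * m) * B * (C * (ρ * R) ^ (s + (n : ℝ) / 2)) := by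
      have hρR : 1 ≤ ρ * R := by nlinarith
      obtain ⟨hi, hle⟩ := hC (ρ * R) hρR
      have e3 : ∫ x, ψ x * (R⁻¹ ^ (2 * m)) • g (R⁻¹ • x) =
          ∫ x in closedBall 0 (ρ * R), ψ x * (R⁻¹ ^ (2 * m)) • g (R⁻¹ • x) := by
        refine (setIntegral_eq_integral_of_forall_compl_eq_zero fun x hx => ?_).symm
        rw [hρ, smul_zero, mul_zero]
        rw [mem_closedBall_zero_iff, not_le] at hx
        rw [norm_smul, norm_inv, Real.norm_of_nonneg hR0.le, lt_inv_mul_iff₀ hR0]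
        linarith
      rw [e3]
      refine (norm_integral_le_of_norm_le (hi.norm.const_mul (R⁻¹ ^ (2 * m) * B))
        (ae_of_all _ fun x => ?_)).trans ?_
      · rw [norm_mul, norm_smul, Real.norm_of_nonneg (by positivity), mul_comm]
        gcongr
        exact hB _
      · rw [integral_const_mul]
        gcongr
    rw [e1, eq_neg_of_add_eq_zero_right ht, norm_mul, norm_neg, norm_pow, Complex.norm_real,
      Real.norm_of_nonneg hR0.le]
    refine (mul_le_mul_of_nonneg_left e2 (by positivity)).trans (le_of_eq ?_)
    rw [Real.mul_rpow (by positivity) hR0.le, he,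
      Real.rpow_add hR0 (b - 2 * m : ℝ), Real.rpow_sub hR0,
      inv_pow, Real.rpow_natCast,
      show (2 * (m : ℝ)) = ((2 * m : ℕ) : ℝ) by push_cast; ring, Real.rpow_natCast]
    ring
  have hz : Tendsto G atTop (𝓝 0) := by
    rw [tendsto_zero_iff_norm_tendsto_zero]
    have h1 := (tendsto_rpow_neg_atTop (y := -e) (by linarith)).const_mul
      (B * C * ρ ^ (s + (n : ℝ) / 2))
    rw [neg_neg, mul_zero] at h1
    refine squeeze_zero' (Eventually.of_forall fun R => norm_nonneg _) ?_ h1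
    filter_upwards [eventually_ge_atTop 1] with R hR using hbound R hR
  exact tendsto_nhds_unique hlim hz

theorem DecayingPotential.vanishingMoments_of_mem_weightedL2
    (h : DecayingPotential n m k V β) {φ : L2 n} {ψ : Rn n → ℂ}
    (hsol : SolvesZeroEnergy m V ψ) (hφ : φ =ᵐ[volume] UvMul V ψ) {s : ℝ} (hs : 0 ≤ s)
    (hψ : ψ ∈ WeightedL2 n (-s)) {d : ℕ} (hd : d + s < 2 * m - n / 2) :
    VanishingMoments V φ d := by
  have hdim := h.dim_eq_real
  have hd2 : d ≤ 2 * k := by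
    have : (d : ℝ) ≤ 2 * k := by
      have := h.one_le_real
      linarith
    exact_mod_cast this
  refine h.vanishingMoments_of_monomials hd2 fun b hb I => ?_
  have hb' : (b : ℝ) ≤ d := by exact_mod_cast hb
  exact h.radialMoment_eq_zero_of_mem_weightedL2 hsol hφ hs hψ (by linarith) I

end Moments

/-! ### Expansion of the Riesz kernel at infinity -/

section Kernel

variable {n : ℕ}

/-- Taylor's formula for the binomial series at `0`. -/
theorem exists_one_add_rpow_approx (α : ℝ) (N : ℕ) : ∃ (c : ℕ → ℝ) (C δ : ℝ), 0 ≤ C ∧ 0 < δ ∧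
    ∀ t : ℝ, |t| ≤ δ → |(1 + t) ^ α - ∑ l ∈ Finset.range N, c l * t ^ l| ≤ C * |t| ^ N := by
  have hp := (Real.one_add_rpow_hasFPowerSeriesAt_zero (a := α)).isBigO_sub_partialSum_pow N
  obtain ⟨C, hC0, hC⟩ := hp.exists_nonneg
  rw [Asymptotics.isBigOWith_iff, Metric.eventually_nhds_iff_ball] at hC
  obtain ⟨ε, hε, h⟩ := hC
  refine ⟨fun l => (binomialSeries ℝ α).coeff l, C, ε / 2, hC0, by positivity, fun t ht => ?_⟩
  have := h t (by rw [mem_ball_zero_iff, Real.norm_eq_abs]; linarith)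
  simpa [FormalMultilinearSeries.partialSum, FormalMultilinearSeries.apply_eq_pow_smul_coeff,
    mul_comm] using this

/-- The part of `∑ c_l (r² + u)^l`, `l < N`, of degree less than `N`, where `r` and `u` both have
degree one. -/
noncomputable def truncatedSum (c : ℕ → ℝ) (N : ℕ) (r u : ℝ) : ℝ :=
  ∑ l ∈ Finset.range N, ∑ i ∈ Finset.range (l + 1),
    if l + i < N then c l * ((r ^ 2) ^ i * u ^ (l - i) * l.choose i) else 0

theorem abs_term_le (c : ℝ) {l i : ℕ} (hi : i ≤ l) {r u : ℝ} (hr : 0 ≤ r) (hu : |u| ≤ 2 * r) :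
    |c * ((r ^ 2) ^ i * u ^ (l - i) * l.choose i)| ≤
      |c| * 2 ^ (l - i) * l.choose i * r ^ (l + i) := by
  rw [abs_mul, abs_mul, abs_mul, abs_pow, abs_pow, abs_pow, abs_of_nonneg hr, Nat.abs_cast]
  calc |c| * ((r ^ 2) ^ i * |u| ^ (l - i) * l.choose i)
      ≤ |c| * ((r ^ 2) ^ i * (2 * r) ^ (l - i) * l.choose i) := by gcongr
    _ = |c| * 2 ^ (l - i) * l.choose i * (r ^ (2 * i) * r ^ (l - i)) := by
        rw [mul_pow, pow_mul]; ring
    _ = |c| * 2 ^ (l - i) * l.choose i * r ^ (l + i) := by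
        rw [← pow_add]; congr 2; omega

theorem exists_truncatedSum_bound (c : ℕ → ℝ) (N : ℕ) : ∃ K : ℝ, 0 ≤ K ∧
    ∀ r u : ℝ, 0 ≤ r → |u| ≤ 2 * r →
      (r ≤ 1 → |∑ l ∈ Finset.range N, c l * (r ^ 2 + u) ^ l - truncatedSum c N r u| ≤ K * r ^ N) ∧
      ∀ δ : ℝ, 0 < δ → δ ≤ 1 → δ ≤ r → |truncatedSum c N r u| ≤ K * (r / δ) ^ N := by
  refine ⟨∑ l ∈ Finset.range N, ∑ i ∈ Finset.range (l + 1), |c l| * 2 ^ (l - i) * l.choose i,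
    Finset.sum_nonneg fun l _ => Finset.sum_nonneg fun i _ => by positivity,
    fun r u hr hu => ⟨fun hr1 => ?_, fun δ hδ hδ1 hδr => ?_⟩⟩
  · rw [truncatedSum, ← Finset.sum_sub_distrib, Finset.sum_mul]
    refine (Finset.abs_sum_le_sum_abs _ _).trans (Finset.sum_le_sum fun l _ => ?_)
    rw [add_pow, Finset.mul_sum, ← Finset.sum_sub_distrib, Finset.sum_mul]
    refine (Finset.abs_sum_le_sum_abs _ _).trans (Finset.sum_le_sum fun i hi => ?_)
    have hi' : i ≤ l := Nat.lt_succ_iff.1 (Finset.mem_range.1 hi)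
    split_ifs with hN
    · rw [sub_self, abs_zero]; positivity
    · rw [sub_zero]
      refine (abs_term_le (c l) hi' hr hu).trans ?_
      exact mul_le_mul_of_nonneg_left (pow_le_pow_of_le_one hr hr1 (not_lt.1 hN)) (by positivity)
  · rw [truncatedSum, Finset.sum_mul]
    refine (Finset.abs_sum_le_sum_abs _ _).trans (Finset.sum_le_sum fun l _ => ?_)
    rw [Finset.sum_mul]
    refine (Finset.abs_sum_le_sum_abs _ _).trans (Finset.sum_le_sum fun i hi => ?_)
    have hi' : i ≤ l := Nat.lt_succ_iff.1 (Finset.mem_range.1 hi)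
    split_ifs with hN
    · refine (abs_term_le (c l) hi' hr hu).trans ?_
      refine mul_le_mul_of_nonneg_left ?_ (by positivity)
      calc r ^ (l + i) ≤ (r / δ) ^ (l + i) :=
            pow_le_pow_left₀ hr (le_div_self hr hδ hδ1) _
        _ ≤ (r / δ) ^ N := pow_le_pow_right₀ ((one_le_div hδ).2 hδr) hN.le
    · rw [abs_zero]; positivity

/-- For fixed `x`, the truncated sum at `r = |y|/|x|`, `u = -2 x·y/|x|²` is a polynomial in `y`. -/
theorem exists_eval_eq_truncatedSum (c : ℕ → ℝ) (N : ℕ) (x : Rn n) :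
    ∃ p : MvPolynomial (Fin n) ℂ, p.totalDegree ≤ N - 1 ∧
      ∀ y : Rn n, MvPolynomial.eval (fun i => ((y i : ℝ) : ℂ)) p =
        ((truncatedSum c N (‖y‖ / ‖x‖) (-2 * inner ℝ x y / ‖x‖ ^ 2) : ℝ) : ℂ) := by
  set q : MvPolynomial (Fin n) ℂ :=
    MvPolynomial.C ((((‖x‖ ^ 2)⁻¹ : ℝ)) : ℂ) * ∑ i, MvPolynomial.X i ^ 2
  set s : MvPolynomial (Fin n) ℂ :=
    ∑ i, MvPolynomial.C ((-2 * x i / ‖x‖ ^ 2 : ℝ) : ℂ) * MvPolynomial.X i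
  have hq : q.totalDegree ≤ 2 := by
    refine (MvPolynomial.totalDegree_mul _ _).trans ?_
    rw [MvPolynomial.totalDegree_C, zero_add]
    refine MvPolynomial.totalDegree_finsetSum_le fun i _ => ?_
    rw [MvPolynomial.totalDegree_X_pow]
  have hs : s.totalDegree ≤ 1 := by
    refine MvPolynomial.totalDegree_finsetSum_le fun i _ => ?_
    refine (MvPolynomial.totalDegree_mul _ _).trans ?_
    rw [MvPolynomial.totalDegree_C, zero_add, MvPolynomial.totalDegree_X]
  refine ⟨∑ l ∈ Finset.range N, ∑ i ∈ Finset.range (l + 1),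
    if l + i < N then MvPolynomial.C (c l : ℂ) *
      (q ^ i * s ^ (l - i) * (l.choose i : MvPolynomial (Fin n) ℂ)) else 0, ?_, fun y => ?_⟩
  · refine MvPolynomial.totalDegree_finsetSum_le fun l _ =>
      MvPolynomial.totalDegree_finsetSum_le fun i hi => ?_
    have hi' : i ≤ l := Nat.lt_succ_iff.1 (Finset.mem_range.1 hi)
    split_ifs with hN
    · refine (MvPolynomial.totalDegree_mul _ _).trans ?_
      rw [MvPolynomial.totalDegree_C, zero_add]
      have h1 := MvPolynomial.totalDegree_mul (q ^ i * s ^ (l - i))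
        (l.choose i : MvPolynomial (Fin n) ℂ)
      have h2 := MvPolynomial.totalDegree_mul (q ^ i) (s ^ (l - i))
      have h3 := (MvPolynomial.totalDegree_pow q i).trans (Nat.mul_le_mul_left i hq)
      have h4 := (MvPolynomial.totalDegree_pow s (l - i)).trans (Nat.mul_le_mul_left (l - i) hs)
      have h5 : (l.choose i : MvPolynomial (Fin n) ℂ).totalDegree = 0 := by
        rw [← MvPolynomial.C_eq_coe_nat, MvPolynomial.totalDegree_C]
      omega
    · simp
  · have hq' : MvPolynomial.eval (fun i => ((y i : ℝ) : ℂ)) q = (((‖y‖ / ‖x‖) ^ 2 : ℝ) : ℂ) := by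
      simp only [q, map_mul, map_sum, map_pow, MvPolynomial.eval_C, MvPolynomial.eval_X]
      rw [div_pow, EuclideanSpace.real_norm_sq_eq y]
      push_cast
      ring
    have hs' : MvPolynomial.eval (fun i => ((y i : ℝ) : ℂ)) s =
        ((-2 * inner ℝ x y / ‖x‖ ^ 2 : ℝ) : ℂ) := by
      have hin : inner ℝ x y = ∑ i, x i * y i := by
        simp [PiLp.inner_apply, mul_comm]
      simp only [s, map_mul, map_sum, MvPolynomial.eval_C, MvPolynomial.eval_X]
      rw [hin, Finset.mul_sum, Finset.sum_div]
      push_cast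
      refine Finset.sum_congr rfl fun i _ => ?_
      ring
    rw [truncatedSum]
    simp only [map_sum, Complex.ofReal_sum]
    refine Finset.sum_congr rfl fun l _ => Finset.sum_congr rfl fun i _ => ?_
    split_ifs with hN
    · simp only [map_mul, map_pow, MvPolynomial.eval_C, hq', hs', map_natCast]
      push_cast
      ring
    · simp

/-- The kernel `|x - y|^{-a}` differs from a polynomial in `y` of degree less than `N`, its
Taylor polynomial at `y = 0`, by `O(|x|^{-a-N})`, with a constant that grows at a controlled rate
in `y` and keeps the singularity at `y = x`. -/
theorem exists_kernel_expansion {a : ℝ} (ha : 0 < a) (N : ℕ) : ∃ D : ℝ, 0 ≤ D ∧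
    ∀ x : Rn n, x ≠ 0 → ∃ p : MvPolynomial (Fin n) ℂ, p.totalDegree ≤ N - 1 ∧ ∀ y : Rn n,
      ‖((‖x - y‖ ^ (-a) : ℝ) : ℂ) - MvPolynomial.eval (fun i => ((y i : ℝ) : ℂ)) p‖ ≤
        D * ‖x‖ ^ (-(a + N)) * (‖y‖ ^ N + ‖y‖ ^ (a + N) * ‖x - y‖ ^ (-a)) := by
  obtain ⟨c, C, ε, hC0, hε, hC⟩ := exists_one_add_rpow_approx (-a / 2) N
  obtain ⟨K, hK0, hK⟩ := exists_truncatedSum_bound c N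
  set δ : ℝ := min 1 (ε / 3) with hδdef
  have hδ0 : 0 < δ := by positivity
  have hδ1 : δ ≤ 1 := min_le_left _ _
  have hδε : 3 * δ ≤ ε := by have := min_le_right 1 (ε / 3); linarith
  refine ⟨C * 3 ^ N + K + K / δ ^ N + (δ⁻¹) ^ (a + N), by positivity, fun x hx => ?_⟩
  have hx0 : 0 < ‖x‖ := norm_pos_iff.2 hx
  obtain ⟨p, hp, hpe⟩ := exists_eval_eq_truncatedSum c N x
  refine ⟨MvPolynomial.C ((‖x‖ ^ (-a) : ℝ) : ℂ) * p, ?_, fun y => ?_⟩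
  · refine (MvPolynomial.totalDegree_mul _ _).trans ?_
    rwa [MvPolynomial.totalDegree_C, zero_add]
  set r := ‖y‖ / ‖x‖ with hr
  set u := -2 * inner ℝ x y / ‖x‖ ^ 2 with hu
  have hr0 : 0 ≤ r := by positivity
  have hur : |u| ≤ 2 * r := by
    have h1 := abs_real_inner_le_norm x y
    rw [hu, hr, abs_div, abs_mul, abs_of_pos (by positivity : 0 < ‖x‖ ^ 2),
      div_le_iff₀ (by positivity)]
    calc |(-2 : ℝ)| * |inner ℝ x y| ≤ 2 * (‖x‖ * ‖y‖) := by
          rw [abs_neg, abs_two]; linarith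
      _ = 2 * (‖y‖ / ‖x‖) * ‖x‖ ^ 2 := by field_simp
  have hrN : ‖x‖ ^ (-a) * r ^ N = ‖x‖ ^ (-(a + N)) * ‖y‖ ^ N := by
    rw [hr, div_pow, neg_add, Real.rpow_add hx0, Real.rpow_neg hx0.le (N : ℝ), Real.rpow_natCast]
    ring
  rw [map_mul, MvPolynomial.eval_C, hpe, ← Complex.ofReal_mul, ← Complex.ofReal_sub,
    Complex.norm_real, Real.norm_eq_abs]
  have hS : 0 ≤ ‖x‖ ^ (-(a + N)) * (‖y‖ ^ (a + N) * ‖x - y‖ ^ (-a)) := by positivity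
  have hS' : 0 ≤ ‖x‖ ^ (-(a + N)) * ‖y‖ ^ N := by positivity
  -- the binomial series applies for `|y| ≤ δ |x|`; otherwise kernel and polynomial are both small
  rcases le_total r δ with hrδ | hrδ
  · have ht : |r ^ 2 + u| ≤ 3 * r := by
      refine (abs_add_le _ _).trans ?_
      rw [abs_of_nonneg (by positivity)]
      nlinarith
    have e : ‖x - y‖ ^ (-a) = ‖x‖ ^ (-a) * (1 + (r ^ 2 + u)) ^ (-a / 2) := by
      have e1 : 1 + (r ^ 2 + u) = (‖x - y‖ / ‖x‖) ^ 2 := by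
        rw [div_pow ‖x - y‖, norm_sub_sq_real, hr, hu]
        field_simp
        ring
      rw [e1, ← Real.rpow_natCast, ← Real.rpow_mul (by positivity), Nat.cast_ofNat,
        mul_div_cancel₀ _ (two_ne_zero), Real.div_rpow (norm_nonneg _) hx0.le,
        mul_div_cancel₀ _ (by positivity)]
    rw [e] at hS ⊢
    rw [← mul_sub, abs_mul, abs_of_nonneg (by positivity)]
    have h1 := hC (r ^ 2 + u) (ht.trans (by linarith))
    have h2 := (hK r u hr0 hur).1 (hrδ.trans hδ1)
    have h3 : |(1 + (r ^ 2 + u)) ^ (-a / 2) - truncatedSum c N r u| ≤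
        (C * 3 ^ N + K) * r ^ N := by
      refine (abs_sub_le _ (∑ l ∈ Finset.range N, c l * (r ^ 2 + u) ^ l) _).trans ?_
      have : C * |r ^ 2 + u| ^ N ≤ C * (3 * r) ^ N := by gcongr
      rw [mul_pow] at this
      linarith
    refine (mul_le_mul_of_nonneg_left h3 (by positivity)).trans ?_
    rw [mul_left_comm, hrN]
    have hD : C * 3 ^ N + K ≤ C * 3 ^ N + K + K / δ ^ N + (δ⁻¹) ^ (a + N) := by
      have : 0 ≤ K / δ ^ N := by positivity
      have : 0 ≤ (δ⁻¹) ^ (a + N) := by positivity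
      linarith
    rw [mul_assoc, mul_add]
    exact mul_le_mul hD (le_add_of_nonneg_right hS) hS' (by positivity)
  · have h2 := (hK r u hr0 hur).2 δ hδ0 hδ1 hrδ
    have h4 : ‖x‖ ^ (-a) * |truncatedSum c N r u| ≤ K / δ ^ N * (‖x‖ ^ (-(a + N)) * ‖y‖ ^ N) := by
      refine (mul_le_mul_of_nonneg_left h2 (by positivity)).trans (le_of_eq ?_)
      rw [← hrN, div_pow]
      ring
    have h5 : ‖x - y‖ ^ (-a) ≤
        (δ⁻¹) ^ (a + N) * (‖x‖ ^ (-(a + N)) * (‖y‖ ^ (a + N) * ‖x - y‖ ^ (-a))) := by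
      have h6 : (1 : ℝ) ≤ (δ⁻¹ * (‖x‖⁻¹ * ‖y‖)) ^ (a + N) := by
        refine Real.one_le_rpow ?_ (by positivity)
        rw [← div_eq_inv_mul, ← div_eq_inv_mul, one_le_div hδ0]
        exact hrδ
      rw [Real.mul_rpow (by positivity) (by positivity), Real.mul_rpow (by positivity)
        (by positivity), Real.inv_rpow hx0.le, ← Real.rpow_neg hx0.le] at h6
      calc ‖x - y‖ ^ (-a) = 1 * ‖x - y‖ ^ (-a) := (one_mul _).symm
        _ ≤ _ := mul_le_mul_of_nonneg_right h6 (by positivity)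
        _ = _ := by ring
    refine (abs_sub _ _).trans ?_
    rw [abs_of_nonneg (by positivity : 0 ≤ ‖x - y‖ ^ (-a)), abs_mul,
      abs_of_nonneg (by positivity : 0 ≤ ‖x‖ ^ (-a))]
    refine (add_le_add h5 h4).trans ?_
    have h7 : 0 ≤ C * 3 ^ N + K := by positivity
    have h8 : 0 ≤ K / δ ^ N := by positivity
    have h9 : 0 ≤ (δ⁻¹) ^ (a + N) := by positivity
    nlinarith [mul_nonneg h7 hS, mul_nonneg h7 hS', mul_nonneg h8 hS, mul_nonneg h9 hS']

end Kernel

/-! ### Vanishing moments give decay -/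

section Decay

variable {n m k : ℕ} {V : Rn n → ℝ} {β : ℝ}

/-- Decay of the source `v φ = V ψ` for `φ ∈ S_1 L²`. -/
theorem DecayingPotential.exists_vMul_bound (h : DecayingPotential n m k V β) {φ : L2 n}
    (hφ : φ ∈ SSpace m V 1) :
    ∃ C : ℝ, 0 ≤ C ∧ ∀ᵐ y, ‖vMul V φ y‖ ≤ C * (1 + ‖y‖) ^ (-(β + (n - 2 * m))) := by
  obtain ⟨C₁, hC₁, h₁⟩ := h.exists_resonance_bound φ
  obtain ⟨C₂, h₂⟩ := h.bound
  refine ⟨|C₂| * C₁, by positivity, ?_⟩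
  filter_upwards [vMul_UvMul (h.mem_SSpace_one_iff.1 hφ)] with y hy
  have hy0 := one_add_norm_pos y
  rw [hy, norm_mul, Complex.norm_real, Real.norm_eq_abs, neg_add, Real.rpow_add hy0]
  calc |V y| * ‖resonance m V φ y‖
      ≤ (|C₂| * (1 + ‖y‖) ^ (-β)) * (C₁ * (1 + ‖y‖) ^ (-((n : ℝ) - 2 * m))) := by
        refine mul_le_mul ((h₂ y).trans ?_) (h₁ y) (norm_nonneg _) (by positivity)
        gcongr
        exact le_abs_self _
    _ = _ := by ring

/-- A bound near the origin and a faster rate of decay away from it combine. -/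
theorem exists_bound_of_near_of_far {g : Rn n → ℂ} {a : ℝ} (ha0 : 0 ≤ a) {N : ℕ} {C₀ E : ℝ}
    (hC₀ : 0 ≤ C₀) (hE0 : 0 ≤ E) (hb₀ : ∀ x, ‖g x‖ ≤ C₀ * (1 + ‖x‖) ^ (-a))
    (far : ∀ x : Rn n, x ≠ 0 → ‖g x‖ ≤ E * ‖x‖ ^ (-(a + N))) :
    ∃ C : ℝ, 0 ≤ C ∧ ∀ x, ‖g x‖ ≤ C * (1 + ‖x‖) ^ (-(a + N)) := by
  refine ⟨C₀ * 2 ^ (N : ℝ) + E * 2 ^ (a + N), by positivity, fun x => ?_⟩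
  have hx0 := one_add_norm_pos x
  rcases le_total ‖x‖ 1 with hx | hx
  · have h3 : (1 : ℝ) ≤ 2 ^ (N : ℝ) * (1 + ‖x‖) ^ (-(N : ℝ)) := by
      rw [Real.rpow_neg hx0.le, ← div_eq_mul_inv, ← Real.div_rpow (by norm_num) hx0.le]
      refine Real.one_le_rpow ?_ (Nat.cast_nonneg N)
      rw [one_le_div hx0]; linarith
    calc ‖g x‖ ≤ C₀ * (1 + ‖x‖) ^ (-a) * 1 := by rw [mul_one]; exact hb₀ x
      _ ≤ C₀ * (1 + ‖x‖) ^ (-a) * (2 ^ (N : ℝ) * (1 + ‖x‖) ^ (-(N : ℝ))) := by gcongr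
      _ = C₀ * 2 ^ (N : ℝ) * (1 + ‖x‖) ^ (-(a + N)) := by
          rw [neg_add, Real.rpow_add hx0]; ring
      _ ≤ _ := by
          gcongr
          have : 0 ≤ E * 2 ^ (a + N) := by positivity
          linarith
  · have hx1 : 0 < ‖x‖ := by linarith
    have h3 : ‖x‖ ^ (-(a + N)) ≤ 2 ^ (a + N) * (1 + ‖x‖) ^ (-(a + N)) := by
      rw [Real.rpow_neg hx1.le, Real.rpow_neg hx0.le, ← div_eq_mul_inv,
        ← Real.div_rpow (by norm_num) hx0.le, ← Real.inv_rpow hx1.le]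
      refine Real.rpow_le_rpow (by positivity) ?_ (by positivity)
      rw [inv_eq_one_div, div_le_div_iff₀ hx1 hx0]; linarith
    calc ‖g x‖ ≤ E * ‖x‖ ^ (-(a + N)) := far x (norm_pos_iff.1 hx1)
      _ ≤ E * (2 ^ (a + N) * (1 + ‖x‖) ^ (-(a + N))) := by gcongr
      _ = E * 2 ^ (a + N) * (1 + ‖x‖) ^ (-(a + N)) := by ring
      _ ≤ _ := by
          gcongr
          have : 0 ≤ C₀ * 2 ^ (N : ℝ) := by positivity
          linarith

/-- The vanishing of the moments of order less than `N` improves the decay of the Riesz potential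
by `N` powers, since the Taylor polynomial of the kernel drops out. -/
theorem DecayingPotential.exists_resonance_bound_of_moments (h : DecayingPotential n m k V β)
    {φ : L2 n} (hφ : φ ∈ SSpace m V 1) {N : ℕ} (hN : N ≤ k)
    (hmom : VanishingMoments V φ (N - 1)) :
    ∃ C : ℝ, 0 ≤ C ∧ ∀ x, ‖resonance m V φ x‖ ≤ C * (1 + ‖x‖) ^ (-((n : ℝ) - 2 * m + N)) := by
  have h2 := h.two_mul_lt_real
  have hk1 := h.one_le_real
  have hβ := h.lt_decay
  have hNk : (N : ℝ) ≤ k := by exact_mod_cast hN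
  set a : ℝ := n - 2 * m with ha
  have ha0 : 0 < a := by rw [ha]; linarith
  have hn1 : 1 ≤ n := by have := h.two_mul_lt; omega
  have hm0 : (1 : ℝ) ≤ m := by exact_mod_cast h.one_le_m
  obtain ⟨C₀, hC₀, hb₀⟩ := h.exists_resonance_bound φ
  obtain ⟨Cf, hCf, hf⟩ := h.exists_vMul_bound hφ
  obtain ⟨D, hD0, hD⟩ := exists_kernel_expansion (n := n) ha0 N
  obtain ⟨M, hM0, hM⟩ := exists_kernel_bound (n := n) hn1 (b := a) (r := β - N)
    ha0.le (by rw [ha]; linarith) (by linarith)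
  have hw := integrable_weight (n := n) (r := β - N) (by linarith)
  set J : ℝ := ∫ y : Rn n, (1 + ‖y‖) ^ (-(β - N)) with hJ
  have hJ0 : 0 ≤ J := integral_nonneg fun y => by positivity
  set E : ℝ := |rieszConst n m| * (D * Cf * (J + M)) with hE
  have hE0 : 0 ≤ E := by positivity
  have far : ∀ x : Rn n, x ≠ 0 → ‖resonance m V φ x‖ ≤ E * ‖x‖ ^ (-(a + N)) := by
    intro x hx
    obtain ⟨p, hp, hpb⟩ := hD x hx
    have hx0 : 0 < ‖x‖ := norm_pos_iff.2 hx
    have hbound : ∀ᵐ y, ‖(((‖x - y‖ ^ (-a) : ℝ) : ℂ) -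
        MvPolynomial.eval (fun i => ((y i : ℝ) : ℂ)) p) * vMul V φ y‖ ≤
        D * ‖x‖ ^ (-(a + N)) * Cf * ((1 + ‖y‖) ^ (-(β - N)) +
          ‖x - y‖ ^ (-a) * (1 + ‖y‖) ^ (-(β - N))) := by
      filter_upwards [hf] with y hy
      have hy0 := one_add_norm_pos y
      have hle : ‖y‖ ≤ 1 + ‖y‖ := by linarith
      have h1le : 1 ≤ 1 + ‖y‖ := by linarith [norm_nonneg y]
      have p1 : ‖y‖ ^ N * (1 + ‖y‖) ^ (-(β + a)) ≤ (1 + ‖y‖) ^ (-(β - N)) := by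
        calc ‖y‖ ^ N * (1 + ‖y‖) ^ (-(β + a)) ≤ (1 + ‖y‖) ^ N * (1 + ‖y‖) ^ (-(β + a)) := by
              gcongr
          _ = (1 + ‖y‖) ^ (N + -(β + a)) := by rw [Real.rpow_add hy0, Real.rpow_natCast]
          _ ≤ _ := Real.rpow_le_rpow_of_exponent_le h1le (by linarith)
      have p2 : ‖y‖ ^ (a + N) * (1 + ‖y‖) ^ (-(β + a)) ≤ (1 + ‖y‖) ^ (-(β - N)) := by
        calc ‖y‖ ^ (a + N) * (1 + ‖y‖) ^ (-(β + a))
            ≤ (1 + ‖y‖) ^ (a + N) * (1 + ‖y‖) ^ (-(β + a)) := by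
              gcongr
          _ = (1 + ‖y‖) ^ (a + N + -(β + a)) := by rw [← Real.rpow_add hy0]
          _ ≤ _ := Real.rpow_le_rpow_of_exponent_le h1le (by linarith)
      rw [norm_mul]
      calc _ ≤ (D * ‖x‖ ^ (-(a + N)) * (‖y‖ ^ N + ‖y‖ ^ (a + N) * ‖x - y‖ ^ (-a))) *
            (Cf * (1 + ‖y‖) ^ (-(β + a))) :=
            mul_le_mul (hpb y) hy (norm_nonneg _) (by positivity)
        _ = D * ‖x‖ ^ (-(a + N)) * Cf * (‖y‖ ^ N * (1 + ‖y‖) ^ (-(β + a)) +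
              ‖x - y‖ ^ (-a) * (‖y‖ ^ (a + N) * (1 + ‖y‖) ^ (-(β + a)))) := by ring
        _ ≤ _ := by gcongr
    have hGi : Integrable fun y => D * ‖x‖ ^ (-(a + N)) * Cf * ((1 + ‖y‖) ^ (-(β - N)) +
          ‖x - y‖ ^ (-a) * (1 + ‖y‖) ^ (-(β - N))) := (hw.add (hM x).1).const_mul _
    have hpi : Integrable fun y => MvPolynomial.eval (fun i => ((y i : ℝ) : ℂ)) p * vMul V φ y :=
      h.integrable_eval_mul (d := N - 1) (by omega) hp φ
    have hdi : Integrable fun y => (((‖x - y‖ ^ (-a) : ℝ) : ℂ) -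
        MvPolynomial.eval (fun i => ((y i : ℝ) : ℂ)) p) * vMul V φ y := by
      refine hGi.mono' (AEStronglyMeasurable.mul (AEStronglyMeasurable.sub ?_
        (continuous_eval p).aestronglyMeasurable) (h.integrable_vMul φ).1) hbound
      exact Measurable.aestronglyMeasurable (by fun_prop)
    have hp0 : ∫ y, MvPolynomial.eval (fun i => ((y i : ℝ) : ℂ)) p * vMul V φ y = 0 := hmom p hp
    have e : resonance m V φ x = -((rieszConst n m : ℂ) * ∫ y, (((‖x - y‖ ^ (-a) : ℝ) : ℂ) -
        MvPolynomial.eval (fun i => ((y i : ℝ) : ℂ)) p) * vMul V φ y) := by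
      rw [← add_zero (∫ y, (((‖x - y‖ ^ (-a) : ℝ) : ℂ) -
        MvPolynomial.eval (fun i => ((y i : ℝ) : ℂ)) p) * vMul V φ y), ← hp0,
        ← integral_add hdi hpi, ← integral_const_mul, resonance, rieszPotential]
      congr 1
      refine integral_congr_ae (ae_of_all _ fun y => ?_)
      simp only [ha, neg_sub]
      push_cast
      ring
    rw [e, norm_neg, norm_mul, Complex.norm_real, Real.norm_eq_abs, hE, mul_assoc]
    gcongr
    refine (norm_integral_le_of_norm_le hGi hbound).trans ?_
    rw [integral_const_mul, integral_add hw (hM x).1]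
    calc _ ≤ D * ‖x‖ ^ (-(a + N)) * Cf * (J + M) := by
          gcongr
          exact (hM x).2
      _ = _ := by ring
  exact exists_bound_of_near_of_far ha0.le hC₀ hE0 hb₀ far

end Decay

/-! ### Moments and weighted spaces -/

section Characterization

variable {n m k : ℕ} {V : Rn n → ℝ} {β : ℝ}

theorem WeightedL2.congr {s : ℝ} {f g : Rn n → ℂ} (hf : f ∈ WeightedL2 n s)
    (hfg : f =ᵐ[volume] g) : g ∈ WeightedL2 n s := by
  refine MemLp.ae_eq ?_ hf
  filter_upwards [hfg] with x hx
  rw [hx]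

theorem W_mono {σ τ : ℝ} (h : σ ≤ τ) : W n σ ⊆ W n τ := fun _ hf s hs => hf s (h.trans_lt hs)

theorem DecayingPotential.resonance_mem_weightedL2 (h : DecayingPotential n m k V β) {φ : L2 n}
    (hφ : φ ∈ SSpace m V 1) {N : ℕ} (hN : N ≤ k) (hmom : VanishingMoments V φ (N - 1)) {s : ℝ}
    (hs : 2 * m - n / 2 - N < s) : resonance m V φ ∈ WeightedL2 n (-s) := by
  obtain ⟨C, -, hC⟩ := h.exists_resonance_bound_of_moments hφ hN hmom
  exact mem_weightedL2_of_bound (h.aestronglyMeasurable_resonance φ) (ae_of_all _ hC)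
    (by linarith)

/-- For a solution `ψ` in the resonance class, membership of `U v ψ` in `S_{N+1} L²` is read off
from the decay of `ψ`. -/
theorem DecayingPotential.mem_SSpace_iff_mem_W (h : DecayingPotential n m k V β) {N : ℕ}
    (hN1 : 1 ≤ N) (hN : N ≤ k) {φ : L2 n} {ψ : Rn n → ℂ} (hψ : ψ ∈ W n (2 * m - n / 2))
    (hsol : SolvesZeroEnergy m V ψ) (hφ : φ =ᵐ[volume] UvMul V ψ) :
    φ ∈ SSpace m V (N + 1) ↔ ψ ∈ W n (2 * m - n / 2 - N) := by
  obtain ⟨r, rfl⟩ : ∃ r, N = r + 1 := ⟨N - 1, by omega⟩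
  have hdim := h.dim_eq_real
  have hNk : ((r + 1 : ℕ) : ℝ) ≤ k := by exact_mod_cast hN
  have h1 := h.mem_SSpace_one_of_solution hψ hsol hφ
  rw [h.mem_SSpace_iff_moments hN, and_iff_right h1]
  constructor
  · intro hmom s hs
    exact WeightedL2.congr (h.resonance_mem_weightedL2 h1 hN hmom hs)
      (h.eq_resonance hψ hsol hφ).symm
  · intro hW
    -- the weight exponent lies in `(2m - n/2 - N, 2m - n/2 - (N - 1))` and is nonnegative
    have hs := hW (k + 1 / 4 - (r + 1 : ℕ)) (by linarith)
    refine h.vanishingMoments_of_mem_weightedL2 hsol hφ (by linarith) hs ?_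
    push_cast
    linarith

theorem DecayingPotential.mem_SSpace_iff_memLp (h : DecayingPotential n m k V β)
    {φ : L2 n} {ψ : Rn n → ℂ} (hψ : ψ ∈ W n (2 * m - n / 2))
    (hsol : SolvesZeroEnergy m V ψ) (hφ : φ =ᵐ[volume] UvMul V ψ) :
    φ ∈ SSpace m V (k + 1) ↔ MemLp ψ 2 volume := by
  have hdim := h.dim_eq_real
  rw [h.mem_SSpace_iff_mem_W h.one_le le_rfl hψ hsol hφ, ← mem_weightedL2_zero]
  constructor
  · intro hW
    simpa using hW 0 (by linarith)
  · intro h0 s hs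
    -- square integrability makes the moments vanish, and these improve the decay of `ψ`
    obtain ⟨r, hr⟩ : ∃ r, k = r + 1 := ⟨k - 1, by have := h.one_le; omega⟩
    have hkr : (k : ℝ) = r + 1 := by exact_mod_cast hr
    have hmom : VanishingMoments V φ (k - 1) := by
      refine h.vanishingMoments_of_mem_weightedL2 hsol hφ le_rfl (by simpa using h0) ?_
      rw [show k - 1 = r by omega]
      linarith
    exact WeightedL2.congr (h.resonance_mem_weightedL2
      (h.mem_SSpace_one_of_solution hψ hsol hφ) le_rfl hmom hs)
      (h.eq_resonance hψ hsol hφ).symm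

theorem DecayingPotential.memLp_mem_W (h : DecayingPotential n m k V β) {ψ : Rn n → ℂ}
    (hψ : MemLp ψ 2 volume) : ψ ∈ W n (2 * m - n / 2) := fun s hs => by
  have hdim := h.dim_eq_real
  have hk := h.one_le_real
  exact WeightedL2.mono (by linarith) (mem_weightedL2_zero.2 hψ)

theorem DecayingPotential.mem_SSpace_one_of_mem (h : DecayingPotential n m k V β) {N : ℕ}
    (hN : N ≤ k) {φ : L2 n} (hφ : φ ∈ SSpace m V (N + 1)) : φ ∈ SSpace m V 1 := by
  rcases N with _ | r
  · exact hφ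
  · exact ((h.mem_SSpace_iff_moments hN φ).1 hφ).1

end Characterization

end HigherSchrodinger

theorem proposition2p5 (n m k : ℕ) (hk : 1 ≤ k) (hkm : k ≤ m / 2 + 1)
    (hn : n + 2 * k = 4 * m + 1)
    (V : Rn n → ℝ) (hVm : Measurable V)
    (β : ℝ) (hβ : (n : ℝ) + 4 * k < β)
    (hV : ∃ C : ℝ, ∀ x, |V x| ≤ C * (1 + ‖x‖) ^ (-β)) :
    -- the operators through which the spaces are defined are bounded on `L²`
    (∀ j : ℕ, j ≤ k → ActsAs (expansionOp m V j) (formalOp m V j)) ∧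
    -- (i)
    (∀ φ : L2 n, (φ ∈ SSpace m V 1 ∧ φ ≠ 0) ↔
      ∃ ψ : Rn n → ℂ, ¬ ψ =ᵐ[volume] 0 ∧ ψ ∈ W n (2 * m - n / 2) ∧
        SolvesZeroEnergy m V ψ ∧ φ =ᵐ[volume] UvMul V ψ) ∧
    -- (ii)
    (∀ j : ℕ, 2 ≤ j → j ≤ k →
      (∀ φ : L2 n, (φ ∈ SSpace m V j ∧ φ ≠ 0) ↔
        ∃ ψ : Rn n → ℂ, ¬ ψ =ᵐ[volume] 0 ∧ ψ ∈ W n (2 * m - n / 2 - j + 1) ∧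
          SolvesZeroEnergy m V ψ ∧ φ =ᵐ[volume] UvMul V ψ) ∧
      (∀ (φ : L2 n) (ψ : Rn n → ℂ), ¬ ψ =ᵐ[volume] 0 → ψ ∈ W n (2 * m - n / 2) →
        SolvesZeroEnergy m V ψ → φ =ᵐ[volume] UvMul V ψ →
        ((φ ∈ SSpace m V j ∧ φ ≠ 0) ↔ ψ ∈ W n (2 * m - n / 2 - j + 1)))) ∧
    -- (iii)
    ((∀ φ : L2 n, (φ ∈ SSpace m V (k + 1) ∧ φ ≠ 0) ↔
        ∃ ψ : Rn n → ℂ, ¬ ψ =ᵐ[volume] 0 ∧ MemLp ψ 2 volume ∧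
          SolvesZeroEnergy m V ψ ∧ φ =ᵐ[volume] UvMul V ψ) ∧
      (∀ (φ : L2 n) (ψ : Rn n → ℂ), ¬ ψ =ᵐ[volume] 0 → ψ ∈ W n (2 * m - n / 2) →
        SolvesZeroEnergy m V ψ → φ =ᵐ[volume] UvMul V ψ →
        ((φ ∈ SSpace m V (k + 1) ∧ φ ≠ 0) ↔ MemLp ψ 2 volume))) ∧
    -- the same spaces through vanishing moments of `v φ`
    (∀ N : ℕ, 1 ≤ N → N ≤ k → ∀ φ : L2 n, φ ∈ SSpace m V (N + 1) ↔
      φ ∈ SSpace m V 1 ∧ ∀ p : MvPolynomial (Fin n) ℂ, p.totalDegree ≤ N - 1 →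
        ∫ y, MvPolynomial.eval (fun i => ((y i : ℝ) : ℂ)) p * ((vFun V y : ℂ) * φ y) = 0) := by
  have h : DecayingPotential n m k V β := ⟨hk, hkm, hn, hVm, hβ, hV⟩
  -- the non-zero elements of `S_{N+1} L²`, for a class `Q` of functions inside the resonance class
  have key : ∀ (N : ℕ) (Q : (Rn n → ℂ) → Prop), N ≤ k → (∀ ψ, Q ψ → ψ ∈ W n (2 * m - n / 2)) →
      (∀ (φ : L2 n) (ψ : Rn n → ℂ), ψ ∈ W n (2 * m - n / 2) → SolvesZeroEnergy m V ψ →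
        φ =ᵐ[volume] UvMul V ψ → (φ ∈ SSpace m V (N + 1) ↔ Q ψ)) → ∀ φ : L2 n,
      (φ ∈ SSpace m V (N + 1) ∧ φ ≠ 0) ↔ ∃ ψ : Rn n → ℂ, ¬ ψ =ᵐ[volume] 0 ∧ Q ψ ∧
        SolvesZeroEnergy m V ψ ∧ φ =ᵐ[volume] UvMul V ψ := by
    intro N Q hN hQ hiff φ
    constructor
    · rintro ⟨hφ, hφ0⟩
      have h1 := h.mem_SSpace_one_of_mem hN hφ
      have h2 := h.mem_SSpace_one_iff.1 h1
      have h3 := h.solves_resonance h1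
      exact ⟨resonance m V φ, resonance_ne_zero hφ0 h2,
        (hiff φ _ (h.resonance_mem_W φ) h3 h2).1 hφ, h3, h2⟩
    · rintro ⟨ψ, hψ0, hψQ, hsol, hφ⟩
      exact ⟨(hiff φ ψ (hQ ψ hψQ) hsol hφ).2 hψQ, h.ne_zero_of_solution hψ0 (hQ ψ hψQ) hsol hφ⟩
  refine ⟨fun j hj => h.actsAs hj, ?_, fun j hj2 hjk => ?_, ⟨?_, ?_⟩, fun N hN1 hN φ => ?_⟩
  · exact key 0 (· ∈ W n (2 * m - n / 2)) (Nat.zero_le k) (fun ψ hψ => hψ)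
      fun φ ψ hψ hsol hφ => iff_of_true (h.mem_SSpace_one_of_solution hψ hsol hφ) hψ
  · obtain ⟨N, rfl⟩ : ∃ N, j = N + 1 := ⟨j - 1, by omega⟩
    have e : 2 * (m : ℝ) - n / 2 - ((N + 1 : ℕ) : ℝ) + 1 = 2 * m - n / 2 - N := by
      push_cast; ring
    rw [e]
    have hiff := fun (φ : L2 n) (ψ : Rn n → ℂ) =>
      h.mem_SSpace_iff_mem_W (N := N) (φ := φ) (ψ := ψ) (by omega) (by omega)
    refine ⟨key N (· ∈ W n (2 * m - n / 2 - N)) (by omega) (fun ψ hψ => ?_) hiff,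
      fun φ ψ hψ0 hψ hsol hφ => ?_⟩
    · exact W_mono (sub_le_self _ (Nat.cast_nonneg N)) hψ
    · rw [and_iff_left (h.ne_zero_of_solution hψ0 hψ hsol hφ)]
      exact hiff φ ψ hψ hsol hφ
  · exact key k (MemLp · 2 volume) le_rfl (fun ψ hψ => h.memLp_mem_W hψ)
      fun φ ψ hψ hsol hφ => h.mem_SSpace_iff_memLp hψ hsol hφ
  · intro φ ψ hψ0 hψ hsol hφ
    rw [and_iff_left (h.ne_zero_of_solution hψ0 hψ hsol hφ)]
    exact h.mem_SSpace_iff_memLp hψ hsol hφ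
  · obtain ⟨r, rfl⟩ : ∃ r, N = r + 1 := ⟨N - 1, by omega⟩
    exact h.mem_SSpace_iff_moments hN φ
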